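/- Let $H$ be a finite-dimensional Hopf $C^*$-algebra over $\mathbb{C}$ (a Hopf algebra that is a $C^*$-algebra with $\Delta(x^*)=\Delta(x)^*$), with antipode $S$ and counit $\epsilon$. Let $h\in H$ be its Haar integral, i.e. $xh=hx=\epsilon(x)h$ for all $x$ and $\epsilon(h)=1$, and let $\phi\in H^*$ be its Haar functional, i.e. $\sum x'\phi(x'')=\sum\phi(x')x''=\phi(x)1_H$ for all $x$ and $\phi(1_H)=1$. Let $X=(H^{\mathrm{op}})^*$, with coproduct $\sum f'(x)f''(y)=f(yx)$. Let $\Gamma$ be a finite oriented graph with vertices $V$, edges $E$ and faces $F$, cellularly embedded in a closed oriented surface, each component of the surface containing at least one edge; loops and multiple edges are allowed. Let $\mathcal N_\Gamma=\bigotimes_{e\in E}H$ with the inner product $\langle\otimes x_e,\otimes y_e\rangle=\prod_e\phi(x_e^*y_e)$. For $a,x\in H$, $f\in X$ put $L_+^a(x)=ax$, $L_-^a(x)=x\,S(a)$, $T_+^f(x)=\sum f(x'')x'$, $T_-^f(x)=\sum f(S^{-1}(x'))x''$. For a site $(s,p)$ (a corner of the embedded graph, with vertex $s$ and face $p$), $A_a(s,p)$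 distributes the coproduct of $a\in H$ over the edge ends at $s$, counterclockwise starting from $p$, acting by $L_+$ at the end and by $L_-$ at the origin of an edge; $B_f(s,p)$ distributes the coproduct of $f\in X$ over the edge sides bounding $p$, clockwise starting from $s$, acting by $T_-$ if $p$ is to the left and by $T_+$ if $p$ is to the right of the edge. Put $A(s)=A_h(s,p)$, $B(p)=B_\phi(s,p)$; the Hamiltonian of the $\mathrm{D}(H)$-model is $\mathcal H=-\sum_{s\in V}A(s)-\sum_{p\in F}B(p)$. For $x_e\in H$ and $f_p\in X$ let $\mathrm{ttr}_\Gamma(\{x_e\};\{f_p\})=\sum_{(x_e)}\prod_{p\in F}f_p(\cdots)$, where the argument of $f_p$ is the product, in clockwise order around $p$ from a chosen starting corner, of the elements attributed to $p$ by its bounding edges: each edge $e$ attributes $x_e''$ to the face on its left and $S(x_e')$ to the face on its right. Let $$|\psi_\Gamma\rangle=\sum_{(h_e)}\mathrm{ttr}_\Gamma(\{h_e''\};\{\phi\})\bigotimes_{e\in E}|h_e'\rangle,\qquad h_e=h\ \text{for all } e .$$ Then, for every choice of the starting corners of the loops and of the sites used for $A(s)$ and $B(p)$ in $\mathcal H$: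 1. $A_h(s,p)|\psi_\Gamma\rangle=|\psi_\Gamma\rangle$ and $B_\phi(s,p)|\psi_\Gamma\rangle=|\psi_\Gamma\rangle$ at every site, i.e. $|\psi_\Gamma\rangle$ is invariant under every $A(s)$ and $B(p)$. 2. $|\psi_\Gamma\rangle$ is a ground state of the $\mathrm{D}(H)$-model: it is non-zero, $\mathcal H|\psi_\Gamma\rangle=E_0|\psi_\Gamma\rangle$ for a real $E_0$, and $\langle v,\mathcal Hv\rangle$ is real and $\ge E_0\langle v,v\rangle$ for all $v\in\mathcal N_\Gamma$. 3. $|\psi_\Gamma\rangle$ carries the trivial representation of $\mathrm{D}(H)$ at every site: $B_f(s,p)A_a(s,p)|\psi_\Gamma\rangle=f(1_H)\,\epsilon(a)\,|\psi_\Gamma\rangle$ for all $f\otimes a\in\mathrm{D}(H)=X\otimes H$, and correspondingly by linearity for all elements of $\mathrm{D}(H)$. -/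

import Mathlib

open scoped TensorProduct Coalgebra
open Coalgebra HopfAlgebra

universe u v

/-- A finite oriented graph with edge set `E`, cellularly embedded in a closed oriented surface,
given by its rotation system. A dart is an edge with a direction: `(e, true)` traverses `e` along
its orientation, `(e, false)` against it; a dart is also the half-edge at the vertex it leaves.
`rot` sends a dart to the next dart, in counterclockwise order, leaving the same vertex.
(Every permutation of the darts is the rotation system of exactly one such embedded graph.) -/
structure SurfaceGraph (E : Type u) where
  rot : Equiv.Perm (E × Bool)

namespace SurfaceGraph

variable {E : Type u}

/-- Reversal of the direction of a dart. -/
def flip : Equiv.Perm (E × Bool) :=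
  Equiv.prodCongr (Equiv.refl E) Equiv.boolNot

/-- The next dart in counterclockwise order along the boundary of the face to the left. -/
def faceNext (Γ : SurfaceGraph E) : Equiv.Perm (E × Bool) :=
  flip.trans Γ.rot.symm

/-- The vertices are the cycles of `rot`. -/
def Vertex (Γ : SurfaceGraph E) : Type u :=
  Quotient (Equiv.Perm.SameCycle.setoid Γ.rot)

/-- The faces are the cycles of `faceNext`. -/
def Face (Γ : SurfaceGraph E) : Type u :=
  Quotient (Equiv.Perm.SameCycle.setoid Γ.faceNext)

/-- The vertex which a dart leaves. -/
def vertexOf (Γ : SurfaceGraph E) (d : E × Bool) : Γ.Vertex :=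
  Quotient.mk (Equiv.Perm.SameCycle.setoid Γ.rot) d

/-- The face to the left of a dart. -/
def faceOf (Γ : SurfaceGraph E) (d : E × Bool) : Γ.Face :=
  Quotient.mk (Equiv.Perm.SameCycle.setoid Γ.faceNext) d

instance [Finite E] (Γ : SurfaceGraph E) : Finite Γ.Vertex :=
  Quotient.finite _

instance [Finite E] (Γ : SurfaceGraph E) : Finite Γ.Face :=
  Quotient.finite _

noncomputable instance [Finite E] (Γ : SurfaceGraph E) : Fintype Γ.Vertex :=
  Fintype.ofFinite _

noncomputable instance [Finite E] (Γ : SurfaceGraph E) : Fintype Γ.Face :=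
  Fintype.ofFinite _

/-- The darts `d, p d, p (p d), …` of the cycle of `p` through `d`, each one once. -/
noncomputable def cycleFrom (p : Equiv.Perm (E × Bool)) (d : E × Bool) : List (E × Bool) :=
  (List.range (Function.minimalPeriod p d)).map fun i => p^[i] d

/-- A site is a vertex together with an adjacent face, i.e. a corner of the embedded graph. It is
encoded by a dart `d`: the vertex `s` is the one which `d` leaves, the face `p` is the one to the
left of `d`, so that the corner lies between `d` and `rot d`.
This is the list of darts leaving `s`, in counterclockwise order around `s` starting from `p`. -/
noncomputable def starAt (Γ : SurfaceGraph E) (d : E × Bool) : List (E × Bool) :=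
  cycleFrom Γ.rot (Γ.rot d)

/-- The list of darts with `p` to their left, in clockwise order around `p` starting from `s`,
for the site `(s, p)` encoded by `d`. -/
noncomputable def loopAt (Γ : SurfaceGraph E) (d : E × Bool) : List (E × Bool) :=
  (cycleFrom Γ.faceNext d).reverse

end SurfaceGraph

namespace QuantumDouble

section Hopf

variable {H : Type v} [NormedRing H] [HopfAlgebra ℂ H]

/-- The Haar integral: the normalized two-sided integral of `H`. -/
structure IsHaarIntegral (h : H) : Prop where
  mul_left : ∀ x : H, x * h = counit (R := ℂ) x • h
  mul_right : ∀ x : H, h * x = counit (R := ℂ) x • h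
  counit_eq_one : counit (R := ℂ) h = 1

/-- The Haar functional: the normalized two-sided integral of the dual Hopf algebra, i.e.
`∑ x' φ(x'') = ∑ φ(x') x'' = φ(x) 1` and `φ(1) = 1`. -/
structure IsHaarFunctional (φ : Module.Dual ℂ H) : Prop where
  left : ∀ x : H, TensorProduct.rid ℂ H (φ.lTensor H (comul x)) = φ x • (1 : H)
  right : ∀ x : H, TensorProduct.lid ℂ H (φ.rTensor H (comul x)) = φ x • (1 : H)
  map_one : φ 1 = 1

variable (H) in
/-- The inverse `S⁻¹` of the antipode, as an inverse in the ring of endomorphisms. -/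
noncomputable def antipodeInv : H →ₗ[ℂ] H :=
  Ring.inverse (antipode ℂ (A := H) : Module.End ℂ H)

variable (H) in
/-- `L₊^a (x) = a x`. -/
noncomputable def actLPlus : H →ₗ[ℂ] Module.End ℂ H :=
  LinearMap.mul ℂ H

variable (H) in
/-- `L₋^a (x) = x S(a)`. -/
noncomputable def actLMinus : H →ₗ[ℂ] Module.End ℂ H :=
  (LinearMap.mul ℂ H).flip ∘ₗ antipode ℂ

variable (H) in
/-- `T₊^f (x) = ∑ f(x'') x'`. -/
noncomputable def actTPlus : Module.Dual ℂ H →ₗ[ℂ] Module.End ℂ H where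
  toFun f := (TensorProduct.rid ℂ H).toLinearMap ∘ₗ f.lTensor H ∘ₗ comul
  map_add' f g := by ext; simp [LinearMap.lTensor_add]
  map_smul' c f := by ext; simp [LinearMap.lTensor_smul]

variable (H) in
/-- `T₋^f (x) = ∑ f(S⁻¹(x')) x''`. -/
noncomputable def actTMinus : Module.Dual ℂ H →ₗ[ℂ] Module.End ℂ H where
  toFun f := (TensorProduct.lid ℂ H).toLinearMap ∘ₗ (f ∘ₗ antipodeInv H).rTensor H ∘ₗ comul
  map_add' f g := by ext; simp [LinearMap.add_comp, LinearMap.rTensor_add]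
  map_smul' c f := by ext; simp [LinearMap.smul_comp, LinearMap.rTensor_smul]

variable [FiniteDimensional ℂ H]

variable (H) in
/-- The comultiplication of `X = (H^op)^*`: `∑ f'(x) f''(y) = f(y x)`. -/
noncomputable def comulX :
    Module.Dual ℂ H →ₗ[ℂ] Module.Dual ℂ H ⊗[ℂ] Module.Dual ℂ H :=
  (TensorProduct.dualDistribEquiv ℂ H H).symm.toLinearMap ∘ₗ
    (LinearMap.mul' ℂ H ∘ₗ (TensorProduct.comm ℂ H H).toLinearMap).dualMap

variable (H) in
/-- The counit of `X = (H^op)^*`: `f ↦ f(1)`. -/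
noncomputable def counitX : Module.Dual ℂ H →ₗ[ℂ] ℂ :=
  Module.Dual.eval ℂ H 1

/-- `∑ T₁(c^{(1)}) T₂(c^{(2)}) ⋯ T_r(c^{(r)})` as a function of `c`, for a list of linear maps
`T₁, …, T_r` from a coalgebra with comultiplication `Δ` and counit `ε` to an algebra. -/
noncomputable def sweedlerProd {C A : Type*} [AddCommGroup C] [Module ℂ C] [Ring A] [Algebra ℂ A]
    (Δ : C →ₗ[ℂ] C ⊗[ℂ] C) (ε : C →ₗ[ℂ] ℂ) : List (C →ₗ[ℂ] A) → (C →ₗ[ℂ] A)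
  | [] => Algebra.linearMap ℂ A ∘ₗ ε
  | T :: Ts => LinearMap.mul' ℂ A ∘ₗ TensorProduct.map T (sweedlerProd Δ ε Ts) ∘ₗ Δ

end Hopf

section Lattice

variable (E : Type u) (H : Type v) [NormedRing H] [HopfAlgebra ℂ H]

/-- The space of states: one copy of `H` for each edge. -/
abbrev StateSpace : Type (max u v) := ⨂[ℂ] _ : E, H

variable {E H} [DecidableEq E]

/-- An operator on `H`, acting on the tensor factor of the edge `e`. -/
noncomputable def onEdge (e : E) : Module.End ℂ H →ₗ[ℂ] Module.End ℂ (StateSpace E H) :=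
  (PiTensorProduct.mapMultilinear ℂ (fun _ : E => H) (fun _ : E => H)).toLinearMap
    (fun _ => LinearMap.id) e

/-- Action of `H` on the edge of a dart, for the vertex which the dart leaves: `L₋` if this is the
origin of the edge, `L₊` if it is the end. -/
noncomputable def dartL : E × Bool → H →ₗ[ℂ] Module.End ℂ (StateSpace E H)
  | (e, true) => onEdge e ∘ₗ actLMinus H
  | (e, false) => onEdge e ∘ₗ actLPlus H

/-- Action of `X` on the edge of a dart, for the face to the left of the dart: `T₋` if this face
is to the left of the edge, `T₊` if it is to the right. -/
noncomputable def dartT : E × Bool → Module.Dual ℂ H →ₗ[ℂ] Module.End ℂ (StateSpace E H)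
  | (e, true) => onEdge e ∘ₗ actTMinus H
  | (e, false) => onEdge e ∘ₗ actTPlus H

/-- The vertex operator `a ↦ A_a(s,p)`: the coproduct of `a ∈ H` is applied to the edges of `s` in
counterclockwise order starting from `p`. -/
noncomputable def vertexOp (Γ : SurfaceGraph E) (d : E × Bool) :
    H →ₗ[ℂ] Module.End ℂ (StateSpace E H) :=
  sweedlerProd comul counit ((Γ.starAt d).map dartL)

variable [FiniteDimensional ℂ H]

/-- The face operator `f ↦ B_f(s,p)`: the coproduct of `f ∈ X` is applied to the edges of `p` in
clockwise order starting from `s`. -/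
noncomputable def faceOp (Γ : SurfaceGraph E) (d : E × Bool) :
    Module.Dual ℂ H →ₗ[ℂ] Module.End ℂ (StateSpace E H) :=
  sweedlerProd (comulX H) (counitX H) ((Γ.loopAt d).map dartT)

/-- The operators by which `D(H) = X ⋈ H`, with underlying space `X ⊗ H`, acts at a site:
`f ⊗ a ↦ B_f(s,p) A_a(s,p)`. -/
noncomputable def siteOp (Γ : SurfaceGraph E) (d : E × Bool) :
    Module.Dual ℂ H ⊗[ℂ] H →ₗ[ℂ] Module.End ℂ (StateSpace E H) :=
  LinearMap.mul' ℂ (Module.End ℂ (StateSpace E H)) ∘ₗ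
    TensorProduct.map (faceOp Γ d) (vertexOp Γ d)

variable (H) in
/-- The counit (trivial representation) of `D(H)`: `f ⊗ a ↦ f(1) ε(a)`. -/
noncomputable def doubleCounit : Module.Dual ℂ H ⊗[ℂ] H →ₗ[ℂ] ℂ :=
  LinearMap.mul' ℂ ℂ ∘ₗ TensorProduct.map (counitX H) counit

variable [Fintype E]

/-- The Hamiltonian `-∑ A(s) - ∑ B(p)` of the `D(H)`-model, with `A(s) = A_h(s,p)` and
`B(p) = B_φ(s,p)`, where `siteV`, `siteF` give a site at each vertex and at each face. -/
noncomputable def hamiltonian (Γ : SurfaceGraph E) (h : H) (φ : Module.Dual ℂ H)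
    (siteV : Γ.Vertex → E × Bool) (siteF : Γ.Face → E × Bool) :
    Module.End ℂ (StateSpace E H) :=
  -(∑ s, vertexOp Γ (siteV s) h) - ∑ p, faceOp Γ (siteF p) φ

/-- The linear functional `⊗ y_e ↦ ∏ φ(x_e^* y_e)`. -/
noncomputable def bra [StarRing H] (φ : Module.Dual ℂ H) (x : E → H) :
    StateSpace E H →ₗ[ℂ] ℂ :=
  PiTensorProduct.lift ((MultilinearMap.mkPiAlgebra ℂ E ℂ).compLinearMap
    fun e => φ ∘ₗ LinearMap.mulLeft ℂ (star (x e)))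

set_option linter.unusedSectionVars false in
theorem bra_tprod [StarRing H] (φ : Module.Dual ℂ H) (x y : E → H) :
    bra φ x (⨂ₜ[ℂ] e, y e) = ∏ e, φ (star (x e) * y e) := by
  simp [bra]

set_option linter.unusedSectionVars false in
theorem bra_update [StarRing H] (φ : Module.Dual ℂ H) (x y : E → H) (e : E) (a : H) :
    bra φ (Function.update x e a) (⨂ₜ[ℂ] e, y e) =
      φ (star a * y e) * ∏ e' ∈ Finset.univ.erase e, φ (star (x e') * y e') := by
  rw [bra_tprod, ← Finset.mul_prod_erase _ _ (Finset.mem_univ e), Function.update_self]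
  congr 1
  refine Finset.prod_congr rfl fun e' he' => ?_
  rw [Function.update_of_ne (Finset.ne_of_mem_erase he')]

/-- The sesquilinear form `v, w ↦ conj ⟨v, w⟩`, see `stateInner`. -/
noncomputable def innerForm [StarRing H] [StarModule ℂ H] (φ : Module.Dual ℂ H) :
    StateSpace E H →ₗ[ℂ] StateSpace E H →ₗ⋆[ℂ] ℂ :=
  PiTensorProduct.lift
    { toFun := fun x => (starLinearEquiv ℂ (A := ℂ)).toLinearMap.comp (bra φ x)
      map_update_add' := by
        intro inst x e a b
        rw [← LinearMap.comp_add]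
        congr 1
        refine PiTensorProduct.ext (MultilinearMap.ext fun y => ?_)
        simp [bra_update, add_mul]
      map_update_smul' := by
        intro inst x e c a
        have hb : bra φ (Function.update x e (c • a)) = star c • bra φ (Function.update x e a) := by
          refine PiTensorProduct.ext (MultilinearMap.ext fun y => ?_)
          simp [bra_update, mul_assoc]
        rw [hb]
        ext v
        simp }

/-- The inner product `⟨v, w⟩` on the space of states, conjugate-linear in `v` : the tensor product
of the inner products `(x, y) = φ(x^* y)` on the edges. -/
noncomputable def stateInner [StarRing H] [StarModule ℂ H] (φ : Module.Dual ℂ H)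
    (v w : StateSpace E H) : ℂ :=
  star (innerForm φ v w)

set_option linter.unusedSectionVars false in
theorem stateInner_tprod [StarRing H] [StarModule ℂ H] (φ : Module.Dual ℂ H) (x y : E → H) :
    stateInner φ (⨂ₜ[ℂ] e, x e) (⨂ₜ[ℂ] e, y e) = ∏ e, φ (star (x e) * y e) := by
  simp [stateInner, innerForm, bra_tprod]

/-- `ψ` is a ground state of `K` : a non-zero eigenvector whose eigenvalue `E₀` is the least energy,
i.e. `⟨v, K v⟩` is real and at least `E₀ ⟨v, v⟩` for every vector `v`. -/
def IsGroundState [StarRing H] [StarModule ℂ H] (φ : Module.Dual ℂ H)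
    (K : Module.End ℂ (StateSpace E H)) (ψ : StateSpace E H) : Prop :=
  ψ ≠ 0 ∧ ∃ E₀ : ℝ, K ψ = (E₀ : ℂ) • ψ ∧
    ∀ v : StateSpace E H, (stateInner φ v (K v)).im = 0 ∧
      E₀ * (stateInner φ v v).re ≤ (stateInner φ v (K v)).re

/-- The element which a dart contributes to the loop in the face to its left, when the coproduct
of the edge elements `x_e` is split into `x_e' ⊗ x_e''`: the face to the left of the edge `e`
receives `x_e''`, the face to the right of it `S(x_e')`. -/
noncomputable def loopPiece (x' x'' : E → H) : E × Bool → H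
  | (e, true) => x'' e
  | (e, false) => antipode ℂ (x' e)

/-- The Hopf tensor trace
`ttr({x_e}; {f_p}) = ∑_{(x_e)} ∏_p f_p(clockwise product around p of the pieces of the edges)`.
`o p` is the site from which the loop in `p` starts (irrelevant if `f_p` is cocommutative).
The sum runs over a decomposition `Δ(x_e) = ∑ x_e' ⊗ x_e''` for each edge; as the summands are
linear in each piece, its choice does not matter. -/
noncomputable def tensorTrace (Γ : SurfaceGraph E) (o : Γ.Face → E × Bool) (x : E → H)
    (f : Γ.Face → Module.Dual ℂ H) : ℂ :=
  ∑ i ∈ Fintype.piFinset fun e => (ℛ ℂ (x e)).index,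
    ∏ p, f p ((Γ.loopAt (o p)).map
      (loopPiece (fun e => (ℛ ℂ (x e)).left (i e)) fun e => (ℛ ℂ (x e)).right (i e))).prod

/-- The Hopf tensor network state `∑_{(x_e)} ttr({x_e''}; {f_p}) ⊗ x_e'`. -/
noncomputable def networkState (Γ : SurfaceGraph E) (o : Γ.Face → E × Bool) (x : E → H)
    (f : Γ.Face → Module.Dual ℂ H) : StateSpace E H :=
  ∑ i ∈ Fintype.piFinset fun e => (ℛ ℂ (x e)).index,
    tensorTrace Γ o (fun e => (ℛ ℂ (x e)).right (i e)) f •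
      ⨂ₜ[ℂ] e, (ℛ ℂ (x e)).left (i e)

end Lattice

end QuantumDouble

/-!
The state `|ψ⟩` is written as the image of one fixed tensor under a contraction. Each edge carries
the tensor `h' ⊗ S(h'') ⊗ h'''` (`edgeTensor`): the first leg is the state of the edge, the other
two are the pieces it gives to the face on its right and on its left. `contraction` evaluates `φ` on
the product of the pieces around every face (`networkState_eq_contraction`).

*Hopf algebra.* On a finite-dimensional Hopf `C*`-algebra the normalized trace of the regular
representation is positive and faithful, and it is idempotent for the convolution product, which
forces its invariance; hence it is the Haar functional (`IsHaarFunctional.eq_regularTrace`). So `φ`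
is a faithful positive trace. Invariance of `φ` gives the formulas `antipode_rightSlice` and
`antipode_leftSlice`, from which follow `S² = 1`, `S(x^*) = S(x)^*`, `φ ∘ S = φ` and the
cocommutativity of `h`. Sweedler computations are made on the entries of matrices with
`Δ(U i j) = ∑ U i k ⊗ U k j` (`IsCoefficientMatrix`), which span every finite-dimensional
coalgebra.

*Vertices.* By the integral property of `h`, acting with `a` on the state of an edge amounts to
multiplying one of its pieces by `a''` and the other one by `S(a')` (`stateL_edgeTensor`). Two
consecutive edges at a vertex have neighbouring pieces in the face between them, so that the factor
`a''` of the first edge meets the factor `S(a')` of the second one and they cancel; going around the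
vertex only `ε(a)` remains (`sweedlerProd_pieceL`, `contraction_vertex`).

*Faces.* By cocommutativity of `h`, acting with `f` on the state of an edge amounts to acting with
`f` on one of its pieces (`stateT_edgeTensor`). This action is multiplicative, so on a whole face
`f` acts on the product of the pieces (`sweedlerProd_pieceT`), and the invariance of `φ` turns it
into the scalar `f(1)` (`contraction_face`).

*Ground state.* The vertex and face operators are products of commuting `*`-representations of `H`
and of its dual on the edges around a vertex or face; as `h` and `φ` are self-adjoint idempotents,
`A_h` and `B_φ` are orthogonal projections (`isProjection_vertexOp`, `isProjection_faceOp`). The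
Hamiltonian is therefore bounded below by minus the number of its terms, a bound attained by every
non-zero vector which all projections fix. The state is non-zero, since applying `x ↦ φ(x) 1` to
each edge gives `φ(h)^|E|` times `1 ⊗ ⋯ ⊗ 1` (`networkState_ne_zero`).
-/

set_option linter.unusedSectionVars false

namespace QuantumDouble

/-! ### Coefficient matrices of a coalgebra -/

section Coefficients

/-- A tensor is recovered from its slices along a basis of the left factor. -/
theorem sum_basis_tmul_slice {ι M N : Type*} [Fintype ι] [AddCommGroup M] [Module ℂ M]
    [AddCommGroup N] [Module ℂ N] (b : Module.Basis ι ℂ M) (t : M ⊗[ℂ] N) :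
    ∑ i, b i ⊗ₜ[ℂ] TensorProduct.lid ℂ N ((b.coord i).rTensor N t) = t := by
  induction t with
  | zero => simp
  | tmul x y =>
    simp only [LinearMap.rTensor_tmul, TensorProduct.lid_tmul, ← TensorProduct.smul_tmul,
      ← TensorProduct.sum_tmul]
    simp only [Module.Basis.coord_apply, b.sum_repr]
  | add x y hx hy => simp only [map_add, TensorProduct.tmul_add, Finset.sum_add_distrib, hx, hy]

variable {C : Type v} [AddCommGroup C] [Module ℂ C] [Coalgebra ℂ C]

/-- A square matrix over a coalgebra whose entries behave like the matrix coefficients of a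
comodule: `Δ U_ij = ∑ U_ik ⊗ U_kj` and `ε U_ij = δ_ij`. On such entries, iterated coproducts are
matrix products. -/
structure IsCoefficientMatrix {n : ℕ} (U : Matrix (Fin n) (Fin n) C) : Prop where
  comul_eq : ∀ i j, comul (R := ℂ) (U i j) = ∑ k, U i k ⊗ₜ[ℂ] U k j
  counit_eq : ∀ i j, counit (R := ℂ) (U i j) = if i = j then 1 else 0

/-- The regular corepresentation in a basis `b j`, where `Δ(b j) = ∑ b i ⊗ U i j`. -/
theorem exists_coefficientMatrix (C : Type v) [AddCommGroup C] [Module ℂ C] [Coalgebra ℂ C]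
    [FiniteDimensional ℂ C] : ∃ (n : ℕ) (U : Matrix (Fin n) (Fin n) C),
      IsCoefficientMatrix U ∧
        Submodule.span ℂ (Set.range fun p : Fin n × Fin n => U p.1 p.2) = ⊤ := by
  let b := Module.finBasis ℂ C
  let U : Matrix (Fin (Module.finrank ℂ C)) (Fin (Module.finrank ℂ C)) C := fun i j =>
    TensorProduct.lid ℂ C ((b.coord i).rTensor C (comul (b j)))
  have hb : ∀ j, comul (R := ℂ) (b j) = ∑ i, b i ⊗ₜ[ℂ] U i j := fun j =>
    (sum_basis_tmul_slice b _).symm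
  refine ⟨_, U, ⟨fun i j => ?_, fun i j => ?_⟩, ?_⟩
  · have h1 := coassoc_apply (R := ℂ) (b j)
    rw [hb j] at h1
    simp only [map_sum, LinearMap.rTensor_tmul, LinearMap.lTensor_tmul, hb,
      TensorProduct.sum_tmul, TensorProduct.assoc_tmul] at h1
    have h2 := congrArg
      (fun t => TensorProduct.lid ℂ (C ⊗[ℂ] C) ((b.coord i).rTensor (C ⊗[ℂ] C) t)) h1
    simp only [map_sum, LinearMap.rTensor_tmul, TensorProduct.lid_tmul, Module.Basis.coord_apply,
      Module.Basis.repr_self, Finsupp.single_apply, ite_smul, one_smul, zero_smul,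
      Finset.sum_ite_eq', Finset.mem_univ, if_true] at h2
    exact h2.symm
  · have h1 := lTensor_counit_comul (R := ℂ) (b j)
    rw [hb j] at h1
    have h2 := congrArg (fun t => b.coord i (TensorProduct.rid ℂ C t)) h1
    simpa [Finsupp.single_apply, eq_comm] using h2
  · rw [eq_top_iff, ← b.span_eq, Submodule.span_le]
    rintro _ ⟨j, rfl⟩
    have h1 := rTensor_counit_comul (R := ℂ) (b j)
    rw [hb j] at h1
    have h2 := congrArg (fun t => TensorProduct.lid ℂ C t) h1
    simp only [map_sum, LinearMap.rTensor_tmul, TensorProduct.lid_tmul, one_smul] at h2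
    rw [SetLike.mem_coe, ← h2]
    exact Submodule.sum_mem _ fun i _ =>
      Submodule.smul_mem _ _ (Submodule.subset_span ⟨(i, j), rfl⟩)

/-- Linear maps which agree on the entries of all coefficient matrices are equal. -/
theorem linearMap_ext_coefficients [FiniteDimensional ℂ C] {M : Type*} [AddCommGroup M] [Module ℂ M]
    {f g : C →ₗ[ℂ] M} (hfg : ∀ (n : ℕ) (U : Matrix (Fin n) (Fin n) C), IsCoefficientMatrix U →
      ∀ i j, f (U i j) = g (U i j)) : f = g := by
  obtain ⟨n, U, hU, hs⟩ := exists_coefficientMatrix C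
  refine LinearMap.ext_on hs ?_
  rintro _ ⟨p, rfl⟩
  exact hfg n U hU p.1 p.2

end Coefficients

section Antipode

variable {H : Type v} [NormedRing H] [HopfAlgebra ℂ H] {n : ℕ} {U : Matrix (Fin n) (Fin n) H}

theorem IsCoefficientMatrix.antipode_mul (hU : IsCoefficientMatrix U) (i j : Fin n) :
    ∑ k, antipode ℂ (U i k) * U k j = if i = j then 1 else 0 := by
  have := mul_antipode_rTensor_comul_apply (R := ℂ) (U i j)
  simpa [hU.comul_eq, hU.counit_eq, apply_ite] using this

theorem IsCoefficientMatrix.mul_antipode (hU : IsCoefficientMatrix U) (i j : Fin n) :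
    ∑ k, U i k * antipode ℂ (U k j) = if i = j then 1 else 0 := by
  have := mul_antipode_lTensor_comul_apply (R := ℂ) (U i j)
  simpa [hU.comul_eq, hU.counit_eq, apply_ite] using this

end Antipode

/-! ### The normalized trace of the regular representation -/

section Trace

open scoped ComplexOrder

/-- An inner product on a finite-dimensional space has an orthonormal basis. -/
theorem exists_orthonormal_basis_of_core {V : Type*} [AddCommGroup V] [Module ℂ V]
    [FiniteDimensional ℂ V] (c : InnerProductSpace.Core ℂ V) :
    ∃ b : Module.Basis (Fin (Module.finrank ℂ V)) ℂ V,
      ∀ i j, c.inner (b i) (b j) = if i = j then 1 else 0 := by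
  let _ : NormedAddCommGroup V := @InnerProductSpace.Core.toNormedAddCommGroup ℂ V _ _ _ c
  let _ : InnerProductSpace ℂ V := InnerProductSpace.ofCore c.toCore
  let b := stdOrthonormalBasis ℂ V
  refine ⟨b.toBasis, fun i j => ?_⟩
  have := orthonormal_iff_ite.mp b.orthonormal i j
  rw [OrthonormalBasis.coe_toBasis]
  exact this

/-- The normalized trace of the left regular representation. -/
noncomputable def regularTrace (H : Type v) [NormedRing H] [Algebra ℂ H] : Module.Dual ℂ H :=
  (Module.finrank ℂ H : ℂ)⁻¹ • LinearMap.trace ℂ H ∘ₗ LinearMap.mul ℂ H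

variable {H : Type v} [NormedRing H] [Algebra ℂ H]

theorem regularTrace_apply (x : H) : regularTrace H x =
    (Module.finrank ℂ H : ℂ)⁻¹ * LinearMap.trace ℂ H (LinearMap.mulLeft ℂ x) := rfl

theorem regularTrace_mul_comm (x y : H) : regularTrace H (x * y) = regularTrace H (y * x) := by
  simp only [regularTrace_apply, LinearMap.mulLeft_mul]
  exact congrArg _ (LinearMap.trace_mul_comm ℂ _ _)

variable [StarRing H] [CStarRing H] [NormSMulClass ℂ H]
  [StarModule ℂ H] [FiniteDimensional ℂ H]

/-- The eigenvalues of left multiplication by `x^* x` are non-negative, and they all vanish only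
for `x = 0`. -/
theorem trace_mulLeft_star_mul_self (x : H) :
    0 ≤ LinearMap.trace ℂ H (LinearMap.mulLeft ℂ (star x * x)) ∧
      (LinearMap.trace ℂ H (LinearMap.mulLeft ℂ (star x * x)) = 0 → x = 0) := by
  let _ : NormedAlgebra ℂ H := { (inferInstance : Algebra ℂ H) with norm_smul_le := norm_smul_le }
  have _ : CompleteSpace H := FiniteDimensional.complete ℂ H
  let _ : CStarAlgebra H := { }
  set a := star x * x with ha
  -- The spectrum of `a` in the algebra is the set of eigenvalues of left multiplication by `a`.
  have hsa : IsSelfAdjoint a := IsSelfAdjoint.star_mul_self x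
  have hspec : ∀ z : ℂ, z ∈ spectrum ℂ a ↔ z ∈ spectrum ℂ (LinearMap.mulLeft ℂ a) := by
    intro z
    have e : algebraMap ℂ (Module.End ℂ H) z - LinearMap.mulLeft ℂ a =
        LinearMap.mulLeft ℂ (algebraMap ℂ H z - a) := by
      ext y; simp [sub_mul, Algebra.smul_def]
    rw [spectrum.mem_iff, spectrum.mem_iff, e, Module.End.isUnit_iff,
      IsUnit.isUnit_iff_mulLeft_bijective]
    rfl
  have hpos : ∀ z ∈ (LinearMap.mulLeft ℂ a).charpoly.roots, 0 ≤ z := by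
    intro z hz
    have h1 := (hspec z).2 ((Module.End.mem_spectrum_iff_isRoot_charpoly _ _).2
      (Polynomial.isRoot_of_mem_roots hz))
    have h2 : z = z.re := hsa.mem_spectrum_eq_re h1
    rw [h2] at h1 ⊢
    have h3 : z.re ∈ spectrum ℝ a := spectrum.of_algebraMap_mem ℂ h1
    exact_mod_cast spectrum_star_mul_self_nonneg _ h3
  rw [Module.End.trace_eq_sum_roots_charpoly_of_splits (IsAlgClosed.splits _)]
  refine ⟨Multiset.sum_nonneg hpos, fun h0 => ?_⟩
  have hz := Multiset.all_zero_of_le_zero_le_of_sum_eq_zero hpos h0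
  -- A self-adjoint element with spectral radius zero vanishes.
  have hr : spectralRadius ℂ a = 0 := by
    rw [spectralRadius]
    simp only [ENNReal.iSup_eq_zero]
    intro z hz'
    have h1 := (Module.End.mem_spectrum_iff_isRoot_charpoly _ _).1 ((hspec z).1 hz')
    rw [hz _ ((Polynomial.mem_roots (LinearMap.charpoly_monic _).ne_zero).2 h1)]
    simp
  rw [hsa.spectralRadius_eq_nnnorm] at hr
  have : a = 0 := by simpa using hr
  exact CStarRing.star_mul_self_eq_zero_iff x |>.1 this

theorem regularTrace_one [Nontrivial H] : regularTrace H 1 = 1 := by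
  have : (Module.finrank ℂ H : ℂ) ≠ 0 := by exact_mod_cast Module.finrank_pos.ne'
  rw [regularTrace_apply, LinearMap.mulLeft_one, LinearMap.trace_id, inv_mul_cancel₀ this]

theorem regularTrace_star_mul_self_nonneg (x : H) : 0 ≤ regularTrace H (star x * x) :=
  mul_nonneg (inv_nonneg.2 (by exact_mod_cast Nat.zero_le _)) (trace_mulLeft_star_mul_self x).1

theorem eq_zero_of_regularTrace_star_mul_self [Nontrivial H] {x : H}
    (hx : regularTrace H (star x * x) = 0) : x = 0 := by
  have : (Module.finrank ℂ H : ℂ) ≠ 0 := by exact_mod_cast Module.finrank_pos.ne'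
  exact (trace_mulLeft_star_mul_self x).2
    ((mul_eq_zero.1 hx).resolve_left (inv_ne_zero this))

/-- A linear functional with real values on all `x^* x` is hermitian, by polarization. -/
theorem regularTrace_star (x : H) : regularTrace H (star x) = star (regularTrace H x) := by
  have him : ∀ y : H, (regularTrace H (star y * y)).im = 0 := fun y =>
    (Complex.nonneg_iff.1 (regularTrace_star_mul_self_nonneg y)).2.symm
  have h0 := him 1
  have hx := him x
  have h1 := him (1 + x)
  have h2 := him (1 + Complex.I • x)
  simp only [star_add, star_one, star_smul, add_mul, mul_add, one_mul, mul_one, map_add,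
    Complex.add_im, smul_mul_assoc, mul_smul_comm, map_smul, smul_eq_mul, Complex.mul_im,
    Complex.star_def, Complex.conj_I, Complex.neg_re, Complex.neg_im, Complex.I_re, Complex.I_im,
    Complex.mul_re] at h0 hx h1 h2
  apply Complex.ext <;> simp only [Complex.star_def, Complex.conj_re, Complex.conj_im] <;> linarith

theorem exists_orthonormal_basis_regularTrace [Nontrivial H] :
    ∃ b : Module.Basis (Fin (Module.finrank ℂ H)) ℂ H,
      ∀ i j, regularTrace H (star (b i) * b j) = if i = j then 1 else 0 :=
  exists_orthonormal_basis_of_core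
    { inner := fun x y => regularTrace H (star x * y)
      conj_inner_symm := fun x y => by
        change star (regularTrace H (star y * x)) = _
        rw [← regularTrace_star, star_mul, star_star]
      re_inner_nonneg := fun x =>
        (Complex.nonneg_iff.1 (regularTrace_star_mul_self_nonneg x)).1
      add_left := fun x y z => by simp [add_mul]
      smul_left := fun x y r => by simp
      definite := fun x hx => eq_zero_of_regularTrace_star_mul_self hx }

end Trace

/-! ### The Haar functional is the normalized trace -/

section HaarTrace

variable {H : Type v} [NormedRing H] [HopfAlgebra ℂ H] [FiniteDimensional ℂ H]

/-- The trace of left multiplication on a tensor product of algebras is multiplicative. -/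
theorem trace_mulLeft_tensor (t : H ⊗[ℂ] H) :
    LinearMap.trace ℂ (H ⊗[ℂ] H) (LinearMap.mulLeft ℂ t) =
      LinearMap.mul' ℂ ℂ (TensorProduct.map (LinearMap.trace ℂ H ∘ₗ LinearMap.mul ℂ H)
        (LinearMap.trace ℂ H ∘ₗ LinearMap.mul ℂ H) t) := by
  induction t with
  | zero => simp
  | tmul x y =>
    have : LinearMap.mulLeft ℂ (x ⊗ₜ[ℂ] y) =
        TensorProduct.map (LinearMap.mulLeft ℂ x) (LinearMap.mulLeft ℂ y) := by
      ext; simp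
    rw [this, LinearMap.trace_tensorProduct']
    rfl
  | add x y hx hy =>
    have : LinearMap.mulLeft ℂ (x + y) = LinearMap.mulLeft ℂ x + LinearMap.mulLeft ℂ y := by
      ext; simp [add_mul]
    rw [this, map_add, hx, hy, map_add, map_add]

variable (H) in
/-- The Galois map `y ⊗ z ↦ Δ(y) (1 ⊗ z)`. -/
noncomputable def galoisMap : Module.End ℂ (H ⊗[ℂ] H) :=
  TensorProduct.lift ((LinearMap.mul ℂ (H ⊗[ℂ] H)).compl₁₂ comul (TensorProduct.mk ℂ H H 1))

variable (H) in
/-- The inverse `y ⊗ z ↦ ∑ y' ⊗ S(y'') z` of the Galois map. -/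
noncomputable def galoisInv : Module.End ℂ (H ⊗[ℂ] H) :=
  TensorProduct.lift ((LinearMap.mul ℂ (H ⊗[ℂ] H)).compl₁₂
    ((antipode ℂ).lTensor H ∘ₗ comul) (TensorProduct.mk ℂ H H 1))

@[simp]
theorem galoisMap_tmul (y z : H) : galoisMap H (y ⊗ₜ z) = comul (R := ℂ) y * (1 ⊗ₜ[ℂ] z) := rfl

@[simp]
theorem galoisInv_tmul (y z : H) :
    galoisInv H (y ⊗ₜ z) = (antipode ℂ).lTensor H (comul (R := ℂ) y) * (1 ⊗ₜ[ℂ] z) := rfl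

theorem galoisMap_mul_galoisInv : galoisMap H * galoisInv H = 1 := by
  refine TensorProduct.ext (linearMap_ext_coefficients fun n U hU i j => ?_)
  ext z
  simp only [LinearMap.compr₂ₛₗ_apply, TensorProduct.mk_apply, Module.End.mul_apply, galoisInv_tmul,
    hU.comul_eq, map_sum, LinearMap.lTensor_tmul, Finset.sum_mul,
    Algebra.TensorProduct.tmul_mul_tmul, mul_one, galoisMap_tmul, Module.End.one_apply]
  rw [Finset.sum_comm]
  simp only [← TensorProduct.tmul_sum, ← mul_assoc, ← Finset.sum_mul, hU.mul_antipode]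
  simp [ite_mul, TensorProduct.tmul_ite]

theorem galoisInv_mul_galoisMap : galoisInv H * galoisMap H = 1 :=
  mul_eq_one_comm.1 galoisMap_mul_galoisInv

/-- The normalized trace is an idempotent for convolution: left multiplication by `Δ(x)` is
conjugate to left multiplication by `x ⊗ 1` through the Galois map. -/
theorem regularTrace_convolution [Nontrivial H] (x : H) :
    LinearMap.mul' ℂ ℂ (TensorProduct.map (regularTrace H) (regularTrace H) (comul x)) =
      regularTrace H x := by
  have hW : LinearMap.mulLeft ℂ (comul (R := ℂ) x) * galoisMap H =
      galoisMap H * LinearMap.mulLeft ℂ (x ⊗ₜ[ℂ] (1 : H)) := by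
    ext y z
    simp [mul_assoc]
  have htr : LinearMap.trace ℂ (H ⊗[ℂ] H) (LinearMap.mulLeft ℂ (comul (R := ℂ) x)) =
      LinearMap.trace ℂ (H ⊗[ℂ] H) (LinearMap.mulLeft ℂ (x ⊗ₜ[ℂ] (1 : H))) := by
    calc _ = LinearMap.trace ℂ (H ⊗[ℂ] H)
          (galoisMap H * (LinearMap.mulLeft ℂ (x ⊗ₜ[ℂ] (1 : H)) * galoisInv H)) := by
            rw [← mul_assoc, ← hW, mul_assoc, galoisMap_mul_galoisInv, mul_one]
      _ = _ := by
            rw [LinearMap.trace_mul_comm, mul_assoc, galoisInv_mul_galoisMap, mul_one]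
  have hn : (Module.finrank ℂ H : ℂ) ≠ 0 := by exact_mod_cast Module.finrank_pos.ne'
  have h1 : LinearMap.trace ℂ H (LinearMap.mul ℂ H 1) = Module.finrank ℂ H := by
    rw [← LinearMap.trace_one]; congr 1; ext; simp
  rw [trace_mulLeft_tensor, trace_mulLeft_tensor] at htr
  simp only [TensorProduct.map_tmul, LinearMap.mul'_apply, LinearMap.comp_apply, h1] at htr
  simp only [regularTrace, TensorProduct.map_smul_left, TensorProduct.map_smul_right,
    LinearMap.smul_apply, map_smul, htr, LinearMap.comp_apply, smul_eq_mul]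
  field_simp

end HaarTrace

section HaarFunctional

open scoped ComplexOrder

/-- `x ⊗ y ↦ f(y) x`. -/
noncomputable def rightSlice {H : Type v} [AddCommGroup H] [Module ℂ H] (f : Module.Dual ℂ H) :
    H ⊗[ℂ] H →ₗ[ℂ] H :=
  (TensorProduct.rid ℂ H).toLinearMap ∘ₗ f.lTensor H

@[simp]
theorem rightSlice_tmul {H : Type v} [AddCommGroup H] [Module ℂ H] (f : Module.Dual ℂ H) (x y : H) :
    rightSlice f (x ⊗ₜ y) = f y • x := by
  simp [rightSlice]

/-- `x ⊗ y ↦ f(x) y`. -/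
noncomputable def leftSlice {H : Type v} [AddCommGroup H] [Module ℂ H] (f : Module.Dual ℂ H) :
    H ⊗[ℂ] H →ₗ[ℂ] H :=
  (TensorProduct.lid ℂ H).toLinearMap ∘ₗ f.rTensor H

@[simp]
theorem leftSlice_tmul {H : Type v} [AddCommGroup H] [Module ℂ H] (f : Module.Dual ℂ H) (x y : H) :
    leftSlice f (x ⊗ₜ y) = f x • y := by
  simp [leftSlice]

variable {H : Type v} [NormedRing H] [StarRing H] [CStarRing H]
  [HopfAlgebra ℂ H] [NormSMulClass ℂ H] [StarModule ℂ H] [FiniteDimensional ℂ H]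

/-- The functional `τ ⊗ τ` for the normalized trace `τ`. -/
noncomputable def regularTrace₂ (H : Type v) [NormedRing H] [Algebra ℂ H] :
    Module.Dual ℂ (H ⊗[ℂ] H) :=
  LinearMap.mul' ℂ ℂ ∘ₗ TensorProduct.map (regularTrace H) (regularTrace H)

@[simp]
theorem regularTrace₂_tmul (x y : H) :
    regularTrace₂ H (x ⊗ₜ y) = regularTrace H x * regularTrace H y := rfl

theorem regularTrace₂_mul_right (t : H ⊗[ℂ] H) (y : H) :
    regularTrace₂ H (t * (y ⊗ₜ 1)) = regularTrace H (rightSlice (regularTrace H) t * y) := by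
  induction t with
  | zero => simp
  | tmul a b => simp [mul_comm]
  | add a b ha hb => simp only [add_mul, map_add, ha, hb]

theorem regularTrace₂_mul_left (t : H ⊗[ℂ] H) (y : H) :
    regularTrace₂ H ((y ⊗ₜ 1) * t) = regularTrace H (y * rightSlice (regularTrace H) t) := by
  induction t with
  | zero => simp
  | tmul a b => simp [mul_comm]
  | add a b ha hb => simp only [mul_add, map_add, ha, hb]

theorem rightSlice_regularTrace_star (t : H ⊗[ℂ] H) :
    rightSlice (regularTrace H) (star t) = star (rightSlice (regularTrace H) t) := by
  induction t with
  | zero => simp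
  | tmul a b => simp [regularTrace_star]
  | add a b ha hb => simp only [star_add, map_add, ha, hb]

/-- Faithfulness of `τ ⊗ τ`: for `q = ∑ b i ⊗ y i` with an orthonormal basis `b`, the value at
`q^* q` is `∑ τ((y i)^* (y i))`. -/
theorem eq_zero_of_regularTrace₂_star_mul_self [Nontrivial H] {q : H ⊗[ℂ] H}
    (hq : regularTrace₂ H (star q * q) = 0) : q = 0 := by
  obtain ⟨b, hb⟩ := exists_orthonormal_basis_regularTrace (H := H)
  set y : Fin (Module.finrank ℂ H) → H := fun i =>
    TensorProduct.lid ℂ H ((b.coord i).rTensor H q) with hy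
  have hsum : ∑ i, b i ⊗ₜ[ℂ] y i = q := sum_basis_tmul_slice b q
  have h1 : regularTrace₂ H (star q * q) = ∑ i, regularTrace H (star (y i) * y i) := by
    rw [← hsum]
    simp [star_sum, Finset.sum_mul_sum, hb]
  rw [h1, Finset.sum_eq_zero_iff_of_nonneg fun i _ => regularTrace_star_mul_self_nonneg _] at hq
  rw [← hsum]
  refine Finset.sum_eq_zero fun i hi => ?_
  rw [eq_zero_of_regularTrace_star_mul_self (hq i hi), TensorProduct.tmul_zero]

/-- An idempotent faithful trace is invariant. With `y = ∑ x' τ(x'')` one has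
`(τ ⊗ τ)(q^* q) = 0` for `q = Δ(y) - y ⊗ 1`, hence `Δ(y) = y ⊗ 1` and `y` is a scalar. -/
theorem regularTrace_left_invariant [Nontrivial H]
    (hstar : ∀ x : H, comul (R := ℂ) (star x) = star (comul (R := ℂ) x)) (x : H) :
    rightSlice (regularTrace H) (comul x) = regularTrace H x • (1 : H) := by
  set τ := regularTrace H with hτ
  set A : H →ₗ[ℂ] H := rightSlice τ ∘ₗ comul with hA
  have hconv : ∀ z : H, regularTrace₂ H (comul z) = τ z := regularTrace_convolution
  have hτA : ∀ z, τ (A z) = τ z := fun z => by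
    have := regularTrace₂_mul_right (comul (R := ℂ) z) 1
    rw [← Algebra.TensorProduct.one_def, mul_one, mul_one, hconv] at this
    exact this.symm
  -- `A` is idempotent because `τ` is idempotent for convolution.
  have hAA : A ∘ₗ A = A := by
    refine linearMap_ext_coefficients fun n U hU i j => ?_
    have hU' : ∀ k l, τ (U k l) = ∑ m, τ (U k m) * τ (U m l) := fun k l => by
      rw [← hconv, hU.comul_eq, map_sum]; rfl
    simp only [hA, LinearMap.comp_apply, hU.comul_eq, map_sum, rightSlice_tmul, map_smul,
      Finset.smul_sum, smul_smul]
    rw [Finset.sum_comm]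
    simp only [← Finset.sum_smul]
    refine Finset.sum_congr rfl fun k _ => ?_
    rw [hU' k j]
    simp only [mul_comm]
  have hAs : ∀ z, A (star z) = star (A z) := fun z => by
    simp only [hA, LinearMap.comp_apply, hstar, rightSlice_regularTrace_star, hτ]
  set y := A x with hy
  have hAy : A y = y := LinearMap.congr_fun hAA x
  have hAy' : A (star y) = star y := by rw [hAs, hAy]
  have hq : comul (R := ℂ) y - y ⊗ₜ[ℂ] (1 : H) = 0 := by
    apply eq_zero_of_regularTrace₂_star_mul_self
    have e : star (comul (R := ℂ) y - y ⊗ₜ[ℂ] (1 : H)) * (comul (R := ℂ) y - y ⊗ₜ[ℂ] (1 : H)) =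
        comul (R := ℂ) (star y * y) - comul (R := ℂ) (star y) * (y ⊗ₜ 1)
          - (star y ⊗ₜ 1) * comul (R := ℂ) y + (star y * y) ⊗ₜ[ℂ] (1 : H) := by
      simp only [star_sub, ← hstar, Bialgebra.comul_mul, TensorProduct.star_tmul, star_one]
      rw [sub_mul, mul_sub, mul_sub, Algebra.TensorProduct.tmul_mul_tmul, mul_one]
      abel
    have h1 : rightSlice τ (comul y) = y := hAy
    have h2 : rightSlice τ (comul (star y)) = star y := hAy'
    rw [e, map_add, map_sub, map_sub, regularTrace₂_mul_right, regularTrace₂_mul_left, ← hτ, h1, h2,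
      hconv, regularTrace₂_tmul, regularTrace_one]
    ring
  -- Applying the counit to `Δ(y) = y ⊗ 1` shows that `y` is the scalar `ε(y)`.
  have h3 := rTensor_counit_comul (R := ℂ) y
  rw [sub_eq_zero.1 hq, LinearMap.rTensor_tmul] at h3
  have h4 : counit (R := ℂ) y • (1 : H) = y := by
    simpa using congrArg (TensorProduct.lid ℂ H) h3
  have h5 : counit (R := ℂ) y = τ x := by
    have h6 : τ (counit (R := ℂ) y • (1 : H)) = counit (R := ℂ) y := by
      rw [map_smul, hτ, regularTrace_one, smul_eq_mul, mul_one]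
    rw [← h6, h4, hy, hτA]
  change y = _
  rw [← h4, h5]

theorem IsHaarFunctional.nontrivial {φ : Module.Dual ℂ H} (hφ : IsHaarFunctional φ) :
    Nontrivial H := by
  by_contra hH
  rw [not_nontrivial_iff_subsingleton] at hH
  have := hφ.map_one
  rw [Subsingleton.elim (1 : H) 0, map_zero] at this
  exact zero_ne_one this

/-- A left and a right integral with value `1` at `1` agree, as is seen by evaluating `φ ⊗ τ` on
`Δ(x)` in the two possible orders. -/
theorem IsHaarFunctional.eq_regularTrace {φ : Module.Dual ℂ H} (hφ : IsHaarFunctional φ)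
    (hstar : ∀ x : H, comul (R := ℂ) (star x) = star (comul (R := ℂ) x)) :
    φ = regularTrace H := by
  have := hφ.nontrivial
  ext x
  have h1 : ∀ t : H ⊗[ℂ] H,
      φ (rightSlice (regularTrace H) t) = regularTrace H (leftSlice φ t) := by
    intro t
    induction t with
    | zero => simp
    | tmul a b => simp [mul_comm]
    | add a b ha hb => simp only [map_add, ha, hb]
  have h2 := h1 (comul x)
  have h3 : leftSlice φ (comul x) = φ x • (1 : H) := hφ.right x
  rw [regularTrace_left_invariant hstar, h3] at h2
  simpa [hφ.map_one, regularTrace_one] using h2.symm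

end HaarFunctional

/-! ### The antipode of a Hopf algebra with a tracial Haar functional -/

section AntipodeComul

variable {H : Type v} [NormedRing H] [HopfAlgebra ℂ H] [FiniteDimensional ℂ H]
  {n : ℕ} {U : Matrix (Fin n) (Fin n) H}

/-- The antipode is anti-comultiplicative: both sides, as matrices over `H ⊗ H`, are inverse to
the matrix `Δ(U)`. -/
theorem IsCoefficientMatrix.comul_antipode (hU : IsCoefficientMatrix U) (i j : Fin n) :
    comul (R := ℂ) (antipode ℂ (U i j)) =
      ∑ k, antipode ℂ (U k j) ⊗ₜ[ℂ] antipode ℂ (U i k) := by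
  let D : Matrix (Fin n) (Fin n) (H ⊗[ℂ] H) := .of fun i j => comul (R := ℂ) (U i j)
  let L : Matrix (Fin n) (Fin n) (H ⊗[ℂ] H) := .of fun i j => comul (R := ℂ) (antipode ℂ (U i j))
  let R : Matrix (Fin n) (Fin n) (H ⊗[ℂ] H) := .of fun i j =>
    ∑ k, antipode ℂ (U k j) ⊗ₜ[ℂ] antipode ℂ (U i k)
  have hL : L * D = 1 := by
    ext i j
    simp only [Matrix.mul_apply, Matrix.of_apply, L, D, ← Bialgebra.comul_mul, ← map_sum,
      hU.antipode_mul, Matrix.one_apply]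
    split_ifs <;> simp
  have hR : D * R = 1 := by
    ext i j
    simp only [Matrix.mul_apply, Matrix.of_apply, R, D, hU.comul_eq, Finset.sum_mul_sum,
      Algebra.TensorProduct.tmul_mul_tmul]
    rw [Finset.sum_comm]
    have h1 : ∀ m : Fin n, ∑ l, ∑ k, (U i m * antipode ℂ (U k j)) ⊗ₜ[ℂ] (U m l * antipode ℂ (U l k))
        = (U i m * antipode ℂ (U m j)) ⊗ₜ[ℂ] (1 : H) := by
      intro m
      rw [Finset.sum_comm]
      simp only [← TensorProduct.tmul_sum, hU.mul_antipode]
      simp [TensorProduct.tmul_ite]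
    simp only [h1, ← TensorProduct.sum_tmul, hU.mul_antipode, Matrix.one_apply]
    split_ifs <;> simp [Algebra.TensorProduct.one_def]
  exact congrArg (fun M : Matrix (Fin n) (Fin n) (H ⊗[ℂ] H) => M i j)
    (left_inv_eq_right_inv hL hR)

end AntipodeComul

section HaarSlice

variable {H : Type v} [NormedRing H] [HopfAlgebra ℂ H] [FiniteDimensional ℂ H]
  {φ : Module.Dual ℂ H}

theorem rightSlice_tmul_mul (x y : H) (t : H ⊗[ℂ] H) :
    rightSlice φ ((x ⊗ₜ y) * t) = x * rightSlice (φ ∘ₗ LinearMap.mulLeft ℂ y) t := by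
  induction t with
  | zero => simp
  | tmul a b => simp
  | add a b ha hb => simp only [mul_add, map_add, ha, hb]

theorem leftSlice_mul_tmul (x y : H) (t : H ⊗[ℂ] H) :
    leftSlice φ (t * (x ⊗ₜ y)) = leftSlice (φ ∘ₗ LinearMap.mulRight ℂ x) t * y := by
  induction t with
  | zero => simp
  | tmul a b => simp
  | add a b ha hb => simp only [add_mul, map_add, ha, hb]

/-- `∑ S(a') φ(a'' b) = ∑ b' φ(a b'')`, by invariance of `φ`. -/
theorem IsHaarFunctional.antipode_rightSlice (hφ : IsHaarFunctional φ) (a b : H) :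
    antipode ℂ (rightSlice (φ ∘ₗ LinearMap.mulRight ℂ b) (comul a)) =
      rightSlice (φ ∘ₗ LinearMap.mulLeft ℂ a) (comul b) := by
  let F : H →ₗ[ℂ] H := antipode ℂ ∘ₗ rightSlice (φ ∘ₗ LinearMap.mulRight ℂ b) ∘ₗ comul
  let G : H →ₗ[ℂ] H :=
    { toFun := fun a => rightSlice (φ ∘ₗ LinearMap.mulLeft ℂ a) (comul b)
      map_add' := fun x y => by
        have : φ ∘ₗ LinearMap.mulLeft ℂ (x + y) =
            φ ∘ₗ LinearMap.mulLeft ℂ x + φ ∘ₗ LinearMap.mulLeft ℂ y := by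
          ext; simp [add_mul]
        simp [rightSlice, this, LinearMap.lTensor_add]
      map_smul' := fun c x => by
        have : φ ∘ₗ LinearMap.mulLeft ℂ (c • x) = c • (φ ∘ₗ LinearMap.mulLeft ℂ x) := by
          ext; simp
        simp [rightSlice, this, LinearMap.lTensor_smul] }
  suffices F = G from LinearMap.congr_fun this a
  refine linearMap_ext_coefficients fun n U hU i j => ?_
  have hinv : ∀ m, φ (U m j * b) • (1 : H) =
      ∑ p, U m p * rightSlice (φ ∘ₗ LinearMap.mulLeft ℂ (U p j)) (comul b) := by
    intro m
    have : rightSlice φ (comul (U m j * b)) = φ (U m j * b) • (1 : H) := hφ.left _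
    rw [← this, Bialgebra.comul_mul, hU.comul_eq, Finset.sum_mul, map_sum]
    simp only [rightSlice_tmul_mul]
  calc F (U i j) = ∑ m, antipode ℂ (U i m) * (φ (U m j * b) • (1 : H)) := by
        simp [F, hU.comul_eq]
    _ = ∑ p, (∑ m, antipode ℂ (U i m) * U m p) *
          rightSlice (φ ∘ₗ LinearMap.mulLeft ℂ (U p j)) (comul b) := by
        simp only [hinv, Finset.mul_sum, Finset.sum_mul, mul_assoc]
        rw [Finset.sum_comm]
    _ = G (U i j) := by
        simp only [hU.antipode_mul, ite_mul, one_mul, zero_mul, Finset.sum_ite_eq, Finset.mem_univ,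
          if_true]
        rfl

/-- `∑ φ(b a') S(a'') = ∑ φ(b' a) b''`, by invariance of `φ`. -/
theorem IsHaarFunctional.antipode_leftSlice (hφ : IsHaarFunctional φ) (a b : H) :
    antipode ℂ (leftSlice (φ ∘ₗ LinearMap.mulLeft ℂ b) (comul a)) =
      leftSlice (φ ∘ₗ LinearMap.mulRight ℂ a) (comul b) := by
  let F : H →ₗ[ℂ] H := antipode ℂ ∘ₗ leftSlice (φ ∘ₗ LinearMap.mulLeft ℂ b) ∘ₗ comul
  let G : H →ₗ[ℂ] H :=
    { toFun := fun a => leftSlice (φ ∘ₗ LinearMap.mulRight ℂ a) (comul b)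
      map_add' := fun x y => by
        have : φ ∘ₗ LinearMap.mulRight ℂ (x + y) =
            φ ∘ₗ LinearMap.mulRight ℂ x + φ ∘ₗ LinearMap.mulRight ℂ y := by
          ext; simp [mul_add]
        simp [leftSlice, this, LinearMap.rTensor_add]
      map_smul' := fun c x => by
        have : φ ∘ₗ LinearMap.mulRight ℂ (c • x) = c • (φ ∘ₗ LinearMap.mulRight ℂ x) := by
          ext; simp
        simp [leftSlice, this, LinearMap.rTensor_smul] }
  suffices F = G from LinearMap.congr_fun this a
  refine linearMap_ext_coefficients fun n U hU i j => ?_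
  have hinv : ∀ m, φ (b * U i m) • (1 : H) =
      ∑ p, leftSlice (φ ∘ₗ LinearMap.mulRight ℂ (U i p)) (comul b) * U p m := by
    intro m
    have : leftSlice φ (comul (b * U i m)) = φ (b * U i m) • (1 : H) := hφ.right _
    rw [← this, Bialgebra.comul_mul, hU.comul_eq, Finset.mul_sum, map_sum]
    simp only [leftSlice_mul_tmul]
  calc F (U i j) = ∑ m, (φ (b * U i m) • (1 : H)) * antipode ℂ (U m j) := by
        simp [F, hU.comul_eq]
    _ = ∑ p, leftSlice (φ ∘ₗ LinearMap.mulRight ℂ (U i p)) (comul b) *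
          (∑ m, U p m * antipode ℂ (U m j)) := by
        simp only [hinv, Finset.mul_sum, Finset.sum_mul, mul_assoc]
        rw [Finset.sum_comm]
    _ = G (U i j) := by
        simp only [hU.mul_antipode, mul_ite, mul_one, mul_zero, Finset.sum_ite_eq', Finset.mem_univ,
          if_true]
        rfl

/-- Slices `∑ a' φ(a'' b)` exhaust `H`, as the Galois map is surjective. -/
theorem IsHaarFunctional.induction_on_slices (hφ : IsHaarFunctional φ) {P : H → Prop}
    (slice : ∀ a b, P (rightSlice (φ ∘ₗ LinearMap.mulRight ℂ b) (comul a)))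
    (zero : P 0) (add : ∀ x y, P x → P y → P (x + y)) (x : H) : P x := by
  have h1 : ∀ t, P (rightSlice φ (galoisMap H t)) := by
    intro t
    induction t with
    | zero => simpa using zero
    | tmul a b =>
      have h2 : ∀ t : H ⊗[ℂ] H, rightSlice φ (t * (1 ⊗ₜ b)) =
          rightSlice (φ ∘ₗ LinearMap.mulRight ℂ b) t := by
        intro t
        induction t with
        | zero => simp
        | tmul a b => simp
        | add a b ha hb => simp only [add_mul, map_add, ha, hb]
      rw [galoisMap_tmul, h2]
      exact slice a b
    | add a b ha hb => simpa only [map_add] using add _ _ ha hb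
  have h3 := h1 (galoisInv H (x ⊗ₜ 1))
  rw [← Module.End.mul_apply, galoisMap_mul_galoisInv] at h3
  simpa [hφ.map_one] using h3

/-- A Haar functional which is a trace. -/
structure IsHaarTrace (φ : Module.Dual ℂ H) : Prop extends IsHaarFunctional φ where
  mul_comm : ∀ x y, φ (x * y) = φ (y * x)

namespace IsHaarTrace

variable (hφ : IsHaarTrace φ)

include hφ

theorem mulLeft_eq_mulRight (a : H) :
    φ ∘ₗ LinearMap.mulLeft ℂ a = φ ∘ₗ LinearMap.mulRight ℂ a := by
  ext x; simp [hφ.mul_comm]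

/-- The antipode exchanges the arguments of the slice `∑ a' φ(a'' b)`. -/
theorem antipode_slice (a b : H) :
    antipode ℂ (rightSlice (φ ∘ₗ LinearMap.mulRight ℂ b) (comul a)) =
      rightSlice (φ ∘ₗ LinearMap.mulRight ℂ a) (comul b) := by
  rw [hφ.antipode_rightSlice, hφ.mulLeft_eq_mulRight]

theorem antipode_antipode (x : H) : antipode ℂ (antipode ℂ x) = x := by
  induction x using hφ.induction_on_slices with
  | slice a b => rw [hφ.antipode_slice, hφ.antipode_slice]
  | zero => simp
  | add x y hx hy => simp only [map_add, hx, hy]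

theorem antipodeInv_eq : antipodeInv H = antipode ℂ (A := H) := by
  have h1 : (antipode ℂ (A := H) : Module.End ℂ H) * antipode ℂ (A := H) = 1 :=
    LinearMap.ext hφ.antipode_antipode
  exact Ring.inverse_unit (⟨_, _, h1, h1⟩ : (Module.End ℂ H)ˣ)

/-- On a slice `∑ a' φ(a'' b)` the value of `φ` is `φ(a) φ(b)`, and `S` exchanges `a` and `b`. -/
theorem apply_antipode (x : H) : φ (antipode ℂ x) = φ x := by
  induction x using hφ.induction_on_slices with
  | slice a b =>
    have h1 : ∀ a b, φ (rightSlice (φ ∘ₗ LinearMap.mulRight ℂ b) (comul a)) = φ a * φ b := by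
      intro a b
      have h2 : ∀ t : H ⊗[ℂ] H, φ (rightSlice (φ ∘ₗ LinearMap.mulRight ℂ b) t) =
          φ (leftSlice φ t * b) := by
        intro t
        induction t with
        | zero => simp
        | tmul x y => simp [_root_.mul_comm]
        | add x y hx hy => simp only [map_add, add_mul, hx, hy]
      have h3 : leftSlice φ (comul a) = φ a • (1 : H) := hφ.right a
      rw [h2, h3, smul_mul_assoc, one_mul, map_smul, smul_eq_mul]
    rw [hφ.antipode_slice, h1, h1, _root_.mul_comm]
  | zero => simp
  | add x y hx hy => simp only [map_add, hx, hy]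

theorem sum_mul_antipode_swap {n : ℕ} {U : Matrix (Fin n) (Fin n) H} (hU : IsCoefficientMatrix U)
    (i j : Fin n) : ∑ k, U k j * antipode ℂ (U i k) = if i = j then 1 else 0 := by
  have := congrArg (antipode ℂ) (hU.mul_antipode i j)
  simpa [antipode_mul_antidistrib, hφ.antipode_antipode, apply_ite, antipode_one] using this

end IsHaarTrace

end HaarSlice

section Star

variable {H : Type v} [NormedRing H] [StarRing H] [HopfAlgebra ℂ H] [StarModule ℂ H]
  [FiniteDimensional ℂ H] {φ : Module.Dual ℂ H}
  (hstar : ∀ x : H, comul (R := ℂ) (star x) = star (comul (R := ℂ) x))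

include hstar

theorem IsHaarTrace.antipode_star (hφ : IsHaarTrace φ) (hs : ∀ x, φ (star x) = star (φ x)) (x : H) :
    antipode ℂ (star x) = star (antipode ℂ x) := by
  have h1 : ∀ a b, star (rightSlice (φ ∘ₗ LinearMap.mulRight ℂ b) (comul a)) =
      rightSlice (φ ∘ₗ LinearMap.mulRight ℂ (star b)) (comul (star a)) := by
    intro a b
    rw [hstar]
    induction (comul (R := ℂ) a) with
    | zero => simp
    | tmul x y => simp [← hs, hφ.mul_comm]
    | add x y hx hy => simp only [map_add, star_add, hx, hy]
  induction x using hφ.induction_on_slices with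
  | slice a b => rw [h1, hφ.antipode_slice, hφ.antipode_slice, h1]
  | zero => simp
  | add x y hx hy => simp only [map_add, star_add, hx, hy]

theorem counit_star (x : H) : counit (R := ℂ) (star x) = star (counit (R := ℂ) x) := by
  -- `x ↦ conj ε(x^*)` is a left counit as well, and counits are unique.
  let e : Module.Dual ℂ H :=
    { toFun := fun x => star (counit (R := ℂ) (star x))
      map_add' := fun x y => by simp
      map_smul' := fun c x => by simp }
  have h1 : ∀ t : H ⊗[ℂ] H, leftSlice e t = star (leftSlice (counit (R := ℂ)) (star t)) := by
    intro t
    induction t with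
    | zero => simp
    | tmul x y => simp [e]
    | add x y hx hy => simp only [map_add, star_add, hx, hy]
  have h2 : ∀ t : H ⊗[ℂ] H, counit (R := ℂ) (leftSlice e t) =
      e (rightSlice (counit (R := ℂ)) t) := by
    intro t
    induction t with
    | zero => simp
    | tmul x y => simp [mul_comm]
    | add x y hx hy => simp only [map_add, hx, hy]
  have h3 := h2 (comul (R := ℂ) x)
  have h4 : ∀ y : H, leftSlice (counit (R := ℂ)) (comul y) = y := fun y => by simp [leftSlice]
  have h5 : ∀ y : H, rightSlice (counit (R := ℂ)) (comul y) = y := fun y => by simp [rightSlice]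
  rw [h1, ← hstar, h4, h5, star_star] at h3
  rw [h3]
  simp [e]

theorem IsHaarIntegral.star_eq {h : H} (hh : IsHaarIntegral h) : star h = h := by
  have h1 : star h * h = h := by
    rw [hh.mul_left, counit_star hstar, hh.counit_eq_one, star_one, one_smul]
  rw [← h1, star_mul, star_star]

end Star

/-! ### The Haar integral -/

section HaarIntegral

variable {H : Type v} [NormedRing H] [HopfAlgebra ℂ H] [FiniteDimensional ℂ H]
  {φ : Module.Dual ℂ H} {h : H}

/-- The Haar integral is cocommutative: `∑ φ(b h') S(h'')` and `∑ φ(h'' b) S(h')` are both equal to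
`φ(h) b`. -/
theorem IsHaarIntegral.comm_comul (hh : IsHaarIntegral h) (hφ : IsHaarTrace φ)
    (hfaithful : ∀ x, (∀ y, φ (x * y) = 0) → x = 0) :
    TensorProduct.comm ℂ H H (comul h) = comul (R := ℂ) h := by
  have hl : φ ∘ₗ LinearMap.mulLeft ℂ h = φ h • counit := by
    ext x; simp [hh.mul_right, mul_comm]
  have h1 : ∀ b, leftSlice (φ ∘ₗ LinearMap.mulLeft ℂ b) (comul h) =
      rightSlice (φ ∘ₗ LinearMap.mulLeft ℂ b) (comul h) := by
    intro b
    have e1 := hφ.antipode_leftSlice h b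
    have e2 := hφ.antipode_rightSlice h b
    rw [← hφ.mulLeft_eq_mulRight, hl] at e1
    rw [← hφ.mulLeft_eq_mulRight, hl] at e2
    rw [← hφ.antipode_antipode (leftSlice _ _), e1, ← hφ.antipode_antipode (rightSlice _ _), e2]
    simp [leftSlice, rightSlice, LinearMap.lTensor_smul, LinearMap.rTensor_smul]
  -- Every functional has the form `x ↦ φ(b x)`, as `φ` is faithful.
  let B : H →ₗ[ℂ] Module.Dual ℂ H := (LinearMap.mul ℂ H).compr₂ φ
  have hB : Function.Surjective B := by
    rw [← LinearMap.injective_iff_surjective_of_finrank_eq_finrank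
      (Subspace.dual_finrank_eq (K := ℂ) (V := H)).symm, injective_iff_map_eq_zero]
    exact fun x hx => hfaithful x fun y => LinearMap.congr_fun hx y
  have h2 : ∀ f : Module.Dual ℂ H, leftSlice f (TensorProduct.comm ℂ H H (comul h)) =
      leftSlice f (comul h) := by
    intro f
    obtain ⟨b, rfl⟩ := hB f
    refine Eq.trans ?_ (h1 b).symm
    generalize comul (R := ℂ) h = t
    induction t with
    | zero => simp
    | tmul x y => simp [B]
    | add x y hx hy => simp only [map_add, hx, hy]
  let c := Module.finBasis ℂ H
  rw [← sum_basis_tmul_slice c (comul h), ← sum_basis_tmul_slice c (TensorProduct.comm ℂ H H _)]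
  refine Finset.sum_congr rfl fun i _ => ?_
  rw [sum_basis_tmul_slice c (comul h)]
  exact congrArg _ (h2 (c.coord i))

theorem IsHaarIntegral.comul_mul_comul (hh : IsHaarIntegral h) (a : H) :
    comul (R := ℂ) h * comul a = counit (R := ℂ) a • comul (R := ℂ) h := by
  rw [← Bialgebra.comul_mul, hh.mul_right, map_smul]

theorem IsHaarIntegral.comul_mul_comul' (hh : IsHaarIntegral h) (a : H) :
    comul (R := ℂ) a * comul h = counit (R := ℂ) a • comul (R := ℂ) h := by
  rw [← Bialgebra.comul_mul, hh.mul_left, map_smul]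

/-- Compute `∑ Δ(h a') (1 ⊗ S(a''))` by the integral property of `h` and by the antipode axiom. -/
theorem IsHaarIntegral.comul_mul_tmul (hh : IsHaarIntegral h) (hφ : IsHaarTrace φ) (a : H) :
    comul (R := ℂ) h * (antipode ℂ a ⊗ₜ[ℂ] 1) = comul (R := ℂ) h * (1 ⊗ₜ[ℂ] a) := by
  have key : LinearMap.mulLeft ℂ (comul (R := ℂ) h) ∘ₗ (TensorProduct.mk ℂ H H).flip 1 =
      LinearMap.mulLeft ℂ (comul (R := ℂ) h) ∘ₗ TensorProduct.mk ℂ H H 1 ∘ₗ antipode ℂ := by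
    refine linearMap_ext_coefficients fun n U hU i j => ?_
    have e1 : ∑ k, comul (R := ℂ) h * comul (U i k) * ((1 : H) ⊗ₜ[ℂ] antipode ℂ (U k j)) =
        comul (R := ℂ) h * ((1 : H) ⊗ₜ[ℂ] antipode ℂ (U i j)) := by
      simp [hh.comul_mul_comul, hU.counit_eq]
    have e2 : ∑ k, comul (R := ℂ) (U i k) * ((1 : H) ⊗ₜ[ℂ] antipode ℂ (U k j)) =
        U i j ⊗ₜ[ℂ] (1 : H) := by
      simp only [hU.comul_eq, Finset.sum_mul, Algebra.TensorProduct.tmul_mul_tmul, mul_one]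
      rw [Finset.sum_comm]
      simp only [← TensorProduct.tmul_sum, hU.mul_antipode]
      simp [TensorProduct.tmul_ite]
    simp only [mul_assoc, ← Finset.mul_sum, e2] at e1
    exact e1
  have := LinearMap.congr_fun key (antipode ℂ a)
  simpa [hφ.antipode_antipode] using this

/-- Compute `∑ (S(a') ⊗ 1) Δ(a'' h)` by the integral property of `h` and by the antipode axiom. -/
theorem IsHaarIntegral.tmul_mul_comul (hh : IsHaarIntegral h) (hφ : IsHaarTrace φ) (a : H) :
    (a ⊗ₜ[ℂ] 1) * comul (R := ℂ) h = (1 ⊗ₜ[ℂ] antipode ℂ a) * comul (R := ℂ) h := by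
  have key : LinearMap.mulRight ℂ (comul (R := ℂ) h) ∘ₗ TensorProduct.mk ℂ H H 1 =
      LinearMap.mulRight ℂ (comul (R := ℂ) h) ∘ₗ (TensorProduct.mk ℂ H H).flip 1 ∘ₗ antipode ℂ := by
    refine linearMap_ext_coefficients fun n U hU i j => ?_
    have e1 : ∑ k, (antipode ℂ (U i k) ⊗ₜ[ℂ] (1 : H)) * (comul (R := ℂ) (U k j) * comul h) =
        (antipode ℂ (U i j) ⊗ₜ[ℂ] (1 : H)) * comul (R := ℂ) h := by
      simp [hh.comul_mul_comul', hU.counit_eq]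
    have e2 : ∑ k, (antipode ℂ (U i k) ⊗ₜ[ℂ] (1 : H)) * comul (R := ℂ) (U k j) =
        (1 : H) ⊗ₜ[ℂ] U i j := by
      simp only [hU.comul_eq, Finset.mul_sum, Algebra.TensorProduct.tmul_mul_tmul, one_mul]
      rw [Finset.sum_comm]
      simp only [← TensorProduct.sum_tmul, hU.antipode_mul]
      simp [TensorProduct.ite_tmul]
    simp only [← mul_assoc, ← Finset.sum_mul, e2] at e1
    exact e1
  have := LinearMap.congr_fun key (antipode ℂ a)
  simpa [hφ.antipode_antipode] using this.symm

end HaarIntegral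

end QuantumDouble

/-! ### Cycles of darts -/

namespace SurfaceGraph

variable {E : Type u} [Finite E]

section Cycle

variable (p : Equiv.Perm (E × Bool)) (d : E × Bool)

theorem mem_periodicPts : d ∈ Function.periodicPts p := by
  refine Function.mk_mem_periodicPts (orderOf_pos p) ?_
  rw [Function.IsPeriodicPt, Function.IsFixedPt, ← Equiv.Perm.coe_pow, pow_orderOf_eq_one]
  rfl

theorem minimalPeriod_pos : 0 < Function.minimalPeriod p d :=
  Function.minimalPeriod_pos_of_mem_periodicPts (mem_periodicPts p d)

theorem nodup_cycleFrom : (cycleFrom p d).Nodup :=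
  Function.nodup_periodicOrbit (f := p) (x := d)

variable {p d} in
theorem mem_cycleFrom {d' : E × Bool} : d' ∈ cycleFrom p d ↔ p.SameCycle d d' := by
  have h1 : d' ∈ cycleFrom p d ↔ ∃ n, p^[n] d = d' :=
    Function.mem_periodicOrbit_iff (mem_periodicPts p d)
  rw [h1]
  constructor
  · rintro ⟨n, rfl⟩
    exact ⟨n, by rw [zpow_natCast, ← Equiv.Perm.coe_pow]⟩
  · intro h
    obtain ⟨n, -, hn⟩ := h.exists_pow_eq'
    exact ⟨n, by rw [← hn, Equiv.Perm.coe_pow]⟩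

variable {p d} in
theorem isRotated_cycleFrom {d' : E × Bool} (h : p.SameCycle d d') :
    cycleFrom p d ~r cycleFrom p d' := by
  obtain ⟨n, -, hn⟩ := h.exists_pow_eq'
  rw [← Cycle.coe_eq_coe, ← hn, Equiv.Perm.coe_pow]
  exact (Function.periodicOrbit_apply_iterate_eq (mem_periodicPts p d) n).symm

theorem cycleFrom_eq_cons : ∃ l, cycleFrom p d = d :: l := by
  obtain ⟨n, hn⟩ := Nat.exists_eq_succ_of_ne_zero (minimalPeriod_pos p d).ne'
  exact ⟨_, by rw [cycleFrom, hn, List.range_succ_eq_map, List.map_cons]; rfl⟩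

theorem cycleFrom_eq_concat : ∃ l, cycleFrom p d = l ++ [p.symm d] := by
  obtain ⟨n, hn⟩ := Nat.exists_eq_succ_of_ne_zero (minimalPeriod_pos p d).ne'
  have h1 : p^[n] d = p.symm d := by
    rw [Equiv.eq_symm_apply, ← Function.iterate_succ_apply' p, ← hn]
    exact Function.iterate_minimalPeriod
  exact ⟨_, by rw [cycleFrom, hn, List.range_succ, List.map_append, List.map_singleton, h1]⟩

theorem isChain_cycleFrom : (cycleFrom p d).IsChain fun a b => b = p a := by
  rw [cycleFrom, List.isChain_map, List.isChain_range]
  exact fun m _ => Function.iterate_succ_apply' p m d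

end Cycle

variable (Γ : SurfaceGraph E)

theorem nodup_loopAt (d : E × Bool) : (Γ.loopAt d).Nodup :=
  List.nodup_reverse.2 (nodup_cycleFrom _ _)

variable {Γ} in
theorem mem_loopAt {d d' : E × Bool} : d' ∈ Γ.loopAt d ↔ Γ.faceOf d = Γ.faceOf d' := by
  rw [loopAt, List.mem_reverse, mem_cycleFrom]
  exact (Quotient.eq (r := Equiv.Perm.SameCycle.setoid Γ.faceNext)).symm

variable {Γ} in
theorem isRotated_loopAt {d d' : E × Bool} (h : Γ.faceOf d = Γ.faceOf d') :
    Γ.loopAt d ~r Γ.loopAt d' :=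
  (isRotated_cycleFrom (Quotient.exact h)).reverse

theorem loopAt_eq_concat (d : E × Bool) : ∃ l, Γ.loopAt d = l ++ [d] := by
  obtain ⟨l, hl⟩ := cycleFrom_eq_cons Γ.faceNext d
  exact ⟨l.reverse, by rw [loopAt, hl, List.reverse_cons]⟩

/-- The loop which ends with `d` starts with the reverse of the next dart at the same vertex. -/
theorem loopAt_eq_cons (d : E × Bool) : ∃ l, Γ.loopAt d = flip (Γ.rot d) :: l := by
  obtain ⟨l, hl⟩ := cycleFrom_eq_concat Γ.faceNext d
  refine ⟨l.reverse, by rw [loopAt, hl, List.reverse_append]; rfl⟩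

end SurfaceGraph

namespace QuantumDouble

open SurfaceGraph hiding flip

/-! ### Weights of loops -/

section FaceWeight

variable {E : Type u} [Finite E] {H : Type v} [Ring H] [Algebra ℂ H]

/-- `∏_p φ(∏ y_d)`, where `y_d` runs over the darts of the loop of `p`, starting at `o p`. -/
noncomputable def faceWeight (Γ : SurfaceGraph E) (o : Γ.Face → E × Bool) (φ : Module.Dual ℂ H)
    (y : E × Bool → H) : ℂ :=
  ∏ p, φ ((Γ.loopAt (o p)).map y).prod

variable {Γ : SurfaceGraph E} {o : Γ.Face → E × Bool} {φ : Module.Dual ℂ H}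

theorem apply_prod_of_isRotated (hc : ∀ x y, φ (x * y) = φ (y * x)) {l l' : List H}
    (h : l ~r l') : φ l.prod = φ l'.prod := by
  obtain ⟨n, hn, rfl⟩ := List.isRotated_iff_mod.1 h
  rw [List.rotate_eq_drop_append_take hn, List.prod_append, hc, List.prod_take_mul_prod_drop]

/-- The loop of a chosen face may start at any of its corners `d`; the other faces contribute a
factor which does not depend on the darts of this loop. -/
theorem exists_faceWeight_eq (ho : ∀ p, Γ.faceOf (o p) = p) (hc : ∀ x y, φ (x * y) = φ (y * x))
    (d : E × Bool) (y : E × Bool → H) :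
    ∃ c : ℂ, ∀ y', (∀ d', d' ∉ Γ.loopAt d → y' d' = y d') →
      faceWeight Γ o φ y' = c * φ ((Γ.loopAt d).map y').prod := by
  classical
  refine ⟨∏ p ∈ Finset.univ.erase (Γ.faceOf d), φ ((Γ.loopAt (o p)).map y).prod, fun y' hy' => ?_⟩
  rw [faceWeight, ← Finset.prod_erase_mul _ _ (Finset.mem_univ (Γ.faceOf d))]
  congr 1
  · refine Finset.prod_congr rfl fun p hp => ?_
    congr 2
    refine List.map_congr_left fun d' hd' => hy' d' fun h => Finset.ne_of_mem_erase hp ?_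
    rw [mem_loopAt] at hd' h
    rw [← ho p, hd', h]
  · exact apply_prod_of_isRotated hc ((isRotated_loopAt (ho _)).map y')

variable [DecidableEq E]

theorem map_update_of_notMem {α β : Type*} [DecidableEq α] {l : List α} {a : α} (ha : a ∉ l)
    (f : α → β) (b : β) : l.map (Function.update f a b) = l.map f :=
  List.map_congr_left fun x hx => Function.update_of_ne (fun h : x = a => ha (h ▸ hx)) _ _

theorem exists_faceWeight_update (ho : ∀ p, Γ.faceOf (o p) = p)
    (hc : ∀ x y, φ (x * y) = φ (y * x)) (d : E × Bool) (y : E × Bool → H) :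
    ∃ f : H →ₗ[ℂ] ℂ, ∀ x, faceWeight Γ o φ (Function.update y d x) = f x := by
  obtain ⟨c, hc'⟩ := exists_faceWeight_eq ho hc d y
  obtain ⟨l, hl⟩ := Γ.loopAt_eq_concat d
  have hd : d ∉ l := by
    have := Γ.nodup_loopAt d
    rw [hl, List.nodup_append] at this
    exact fun h => this.2.2 d h d (by simp) rfl
  refine ⟨c • φ ∘ₗ LinearMap.mulLeft ℂ (l.map y).prod, fun x => ?_⟩
  rw [hc' _ fun d' hd' => Function.update_of_ne (fun h => hd' (by simp [hl, h])) _ _, hl]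
  simp [map_update_of_notMem hd]

/-- A factor at the right end of the piece of `d` may be moved to the left end of the piece which
follows it in clockwise order around the face to the left of `d`. -/
theorem faceWeight_slide (ho : ∀ p, Γ.faceOf (o p) = p) (hc : ∀ x y, φ (x * y) = φ (y * x))
    (d : E × Bool) (y : E × Bool → H) (b : H) :
    faceWeight Γ o φ (Function.update y d (y d * b)) =
      faceWeight Γ o φ (Function.update y (SurfaceGraph.flip (Γ.rot d))
        (b * y (SurfaceGraph.flip (Γ.rot d)))) := by
  obtain ⟨c, hc'⟩ := exists_faceWeight_eq ho hc d y
  have hnd := Γ.nodup_loopAt d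
  obtain ⟨l, hl⟩ := Γ.loopAt_eq_concat d
  obtain ⟨l', hl'⟩ := Γ.loopAt_eq_cons d
  have h1 : ((Γ.loopAt d).map (Function.update y d (y d * b))).prod =
      ((Γ.loopAt d).map y).prod * b := by
    have hd : d ∉ l := by
      rw [hl, List.nodup_append] at hnd
      exact fun h => hnd.2.2 d h d (by simp) rfl
    rw [hl]
    simp [map_update_of_notMem hd, mul_assoc]
  have h2 : ((Γ.loopAt d).map (Function.update y (SurfaceGraph.flip (Γ.rot d))
      (b * y (SurfaceGraph.flip (Γ.rot d))))).prod =
      b * ((Γ.loopAt d).map y).prod := by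
    have hd : SurfaceGraph.flip (Γ.rot d) ∉ l' := by
      rw [hl', List.nodup_cons] at hnd
      exact hnd.1
    rw [hl']
    simp [map_update_of_notMem hd, mul_assoc]
  rw [hc' _ fun d' hd' => Function.update_of_ne (fun h => hd' (by simp [hl, h])) _ _,
    hc' _ fun d' hd' => Function.update_of_ne (fun h => hd' (by simp [hl', h])) _ _, h1, h2, hc]

end FaceWeight

/-! ### Edges with three tensor legs -/

section Legs

variable (H : Type v) [Ring H] [Algebra ℂ H]

/-- The space of an edge which carries, besides its state (leg `none`), the pieces it contributes
to the face to its right (leg `some false`) and to its left (leg `some true`). -/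
abbrev TripleSpace : Type v := H ⊗[ℂ] (H ⊗[ℂ] H)

variable (E : Type u)

/-- One copy of `TripleSpace H` for each edge. The legs are indexed by `E × Option Bool`. -/
def LegSpace : Type (max u v) := ⨂[ℂ] _ : E, TripleSpace H

noncomputable instance : AddCommGroup (LegSpace H E) :=
  inferInstanceAs (AddCommGroup (⨂[ℂ] _ : E, TripleSpace H))

noncomputable instance : Module ℂ (LegSpace H E) :=
  inferInstanceAs (Module ℂ (⨂[ℂ] _ : E, TripleSpace H))

variable {H}

/-- A pure tensor on the legs of one edge. -/
def triple (x : Option Bool → H) : TripleSpace H := x none ⊗ₜ (x (some false) ⊗ₜ x (some true))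

/-- An operator on `H`, acting on one leg of an edge. -/
noncomputable def tripleMap : Option Bool → Module.End ℂ H →ₗ[ℂ] Module.End ℂ (TripleSpace H)
  | none => LinearMap.rTensorHom _
  | some false => LinearMap.lTensorHom _ ∘ₗ LinearMap.rTensorHom _
  | some true => LinearMap.lTensorHom _ ∘ₗ LinearMap.lTensorHom _

theorem tripleMap_triple (o : Option Bool) (R : Module.End ℂ H) (x : Option Bool → H) :
    tripleMap o R (triple x) = triple (Function.update x o (R (x o))) := by
  rcases o with _ | _ | _ <;> simp [tripleMap, triple]

variable {E}

variable (H E) in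
/-- The universal multilinear map from families of elements of `TripleSpace H`. -/
noncomputable def legTensor : MultilinearMap ℂ (fun _ : E => TripleSpace H) (LegSpace H E) :=
  PiTensorProduct.tprod ℂ

/-- A pure tensor on all legs. -/
noncomputable def pureLegs (z : E × Option Bool → H) : LegSpace H E :=
  legTensor H E fun e => triple fun o => z (e, o)

variable [DecidableEq E]

/-- An operator on `H`, acting on one leg. -/
noncomputable def onLeg (i : E × Option Bool) :
    Module.End ℂ H →ₗ[ℂ] Module.End ℂ (LegSpace H E) :=
  (PiTensorProduct.mapMultilinear ℂ (fun _ : E => TripleSpace H)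
    (fun _ : E => TripleSpace H)).toLinearMap (fun _ => LinearMap.id) i.1 ∘ₗ tripleMap i.2

theorem onLeg_tprod (i : E × Option Bool) (R : Module.End ℂ H) (t : E → TripleSpace H) :
    onLeg i R (legTensor H E t) =
      legTensor H E (Function.update t i.1 (tripleMap i.2 R (t i.1))) := by
  refine (PiTensorProduct.map_tprod (R := ℂ) _ _).trans (congrArg (legTensor H E) ?_)
  funext e
  by_cases he : e = i.1
  · subst he; simp
  · simp [he]

theorem update_triple (z : E × Option Bool → H) (i : E × Option Bool) (x : H) :
    (Function.update (fun e => triple fun o => z (e, o)) i.1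
      (triple (Function.update (fun o => z (i.1, o)) i.2 x))) =
    fun e => triple fun o => Function.update z i x (e, o) := by
  funext e
  by_cases he : e = i.1
  · subst he
    rw [Function.update_self]
    congr 1
    funext o
    by_cases ho : o = i.2
    · subst ho; simp
    · rw [Function.update_of_ne ho, Function.update_of_ne]
      exact fun h => ho (congrArg Prod.snd h)
  · rw [Function.update_of_ne he]
    congr 1
    funext o
    rw [Function.update_of_ne]
    exact fun h => he (congrArg Prod.fst h)

@[simp]
theorem onLeg_pureLegs (i : E × Option Bool) (R : Module.End ℂ H) (z : E × Option Bool → H) :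
    onLeg i R (pureLegs z) = pureLegs (Function.update z i (R (z i))) := by
  rw [pureLegs, onLeg_tprod, tripleMap_triple, update_triple]
  rfl

/-- `triple` is linear in each leg. -/
noncomputable def tripleLinear (x : Option Bool → H) : Option Bool → H →ₗ[ℂ] TripleSpace H
  | none => (TensorProduct.mk ℂ H (H ⊗[ℂ] H)).flip (x (some false) ⊗ₜ x (some true))
  | some false => TensorProduct.mk ℂ H (H ⊗[ℂ] H) (x none) ∘ₗ
      (TensorProduct.mk ℂ H H).flip (x (some true))
  | some true => TensorProduct.mk ℂ H (H ⊗[ℂ] H) (x none) ∘ₗ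
      TensorProduct.mk ℂ H H (x (some false))

theorem triple_update (x : Option Bool → H) (o : Option Bool) (a : H) :
    triple (Function.update x o a) = tripleLinear x o a := by
  rcases o with _ | _ | _ <;> simp [triple, tripleLinear]

theorem pureLegs_update (z : E × Option Bool → H) (i : E × Option Bool) (a : H) :
    pureLegs (Function.update z i a) = (legTensor H E).toLinearMap
      (fun e => triple fun o => z (e, o)) i.1 (tripleLinear (fun o => z (i.1, o)) i.2 a) := by
  rw [MultilinearMap.toLinearMap_apply, ← triple_update, update_triple]
  rfl

/-- `pureLegs` as a multilinear map. -/
noncomputable def pureLegsMultilinear :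
    MultilinearMap ℂ (fun _ : E × Option Bool => H) (LegSpace H E) :=
  MultilinearMap.mk' pureLegs
    (fun m i x y => by simp only [pureLegs_update, map_add])
    (fun m i c x => by simp only [pureLegs_update, map_smul])

section Extension

variable [Fintype E] [FiniteDimensional ℂ H] {P : Type*} [AddCommGroup P] [Module ℂ P]

/-- A basis of the space of legs which consists of pure tensors. -/
noncomputable def legsBasis (H : Type v) [Ring H] [Algebra ℂ H] [FiniteDimensional ℂ H]
    (E : Type u) [Fintype E] :
    Module.Basis (E → Fin (Module.finrank ℂ H) × Fin (Module.finrank ℂ H) ×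
      Fin (Module.finrank ℂ H)) ℂ (LegSpace H E) :=
  Basis.piTensorProduct fun _ => (Module.finBasis ℂ H).tensorProduct
    ((Module.finBasis ℂ H).tensorProduct (Module.finBasis ℂ H))

/-- The basis vectors of `H` on the legs of a vector of `legsBasis`. -/
noncomputable def legsBasisVector
    (j : E → Fin (Module.finrank ℂ H) × Fin (Module.finrank ℂ H) × Fin (Module.finrank ℂ H)) :
    E × Option Bool → H
  | (e, none) => Module.finBasis ℂ H (j e).1
  | (e, some false) => Module.finBasis ℂ H (j e).2.1
  | (e, some true) => Module.finBasis ℂ H (j e).2.2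

theorem legsBasis_apply
    (j : E → Fin (Module.finrank ℂ H) × Fin (Module.finrank ℂ H) × Fin (Module.finrank ℂ H)) :
    legsBasis H E j = pureLegs (legsBasisVector j) := by
  refine (Basis.piTensorProduct_apply _ _).trans (congrArg (legTensor H E) ?_)
  funext e
  rw [Module.Basis.tensorProduct_apply', Module.Basis.tensorProduct_apply']
  rfl

/-- Linear maps on the space of legs are determined by their values on pure tensors. -/
theorem legSpace_ext {f g : LegSpace H E →ₗ[ℂ] P} (h : ∀ z, f (pureLegs z) = g (pureLegs z)) :
    f = g :=
  (legsBasis H E).ext fun j => by rw [legsBasis_apply, h]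

theorem legEnd_ext {f g : Module.End ℂ (LegSpace H E)} (h : ∀ z, f (pureLegs z) = g (pureLegs z)) :
    f = g :=
  (legsBasis H E).ext fun j => by rw [legsBasis_apply, h]

/-- The linear map on the space of legs given by a multilinear map in the legs. -/
noncomputable def legsLift (F : MultilinearMap ℂ (fun _ : E × Option Bool => H) P) :
    LegSpace H E →ₗ[ℂ] P :=
  (legsBasis H E).constr ℂ fun j => F (legsBasisVector j)

theorem legsLift_pureLegs (F : MultilinearMap ℂ (fun _ : E × Option Bool => H) P)
    (z : E × Option Bool → H) : legsLift F (pureLegs z) = F z := by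
  have h : (legsLift F).compMultilinearMap pureLegsMultilinear = F := by
    refine Module.Basis.ext_multilinear (fun _ => Module.finBasis ℂ H) fun w => ?_
    let j : E → Fin (Module.finrank ℂ H) × Fin (Module.finrank ℂ H) × Fin (Module.finrank ℂ H) :=
      fun e => (w (e, none), w (e, some false), w (e, some true))
    have hj : (fun i => Module.finBasis ℂ H (w i)) = legsBasisVector j := by
      funext ⟨e, o⟩
      rcases o with _ | _ | _ <;> rfl
    rw [hj]
    change legsLift F (pureLegs _) = _
    rw [← legsBasis_apply, legsLift, Module.Basis.constr_basis]
  exact congrArg (fun G : MultilinearMap ℂ (fun _ : E × Option Bool => H) P => G z) h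

theorem onLeg_mul (i : E × Option Bool) (R S : Module.End ℂ H) :
    onLeg i R * onLeg i S = onLeg i (R * S) :=
  legEnd_ext fun z => by simp

theorem onLeg_one (i : E × Option Bool) : onLeg i (1 : Module.End ℂ H) = 1 :=
  legEnd_ext fun z => by simp

theorem commute_onLeg {i j : E × Option Bool} {R S : Module.End ℂ H}
    (h : i = j → Commute R S) : Commute (onLeg i R) (onLeg j S) := by
  by_cases hij : i = j
  · subst hij
    rw [commute_iff_eq, onLeg_mul, onLeg_mul, (h rfl).eq]
  · refine legEnd_ext fun z => ?_
    simp [Function.update_of_ne hij, Function.update_of_ne (Ne.symm hij), Function.update_comm hij]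

end Extension

end Legs

/-! ### The contraction of the pieces -/

section Contraction

variable {E : Type u} [Fintype E] [DecidableEq E] {H : Type v} [NormedRing H] [HopfAlgebra ℂ H]
  [FiniteDimensional ℂ H]

/-- The leg which holds the piece of a dart. -/
def pieceLeg (d : E × Bool) : E × Option Bool := (d.1, some d.2)

theorem pieceLeg_injective : Function.Injective (pieceLeg : E × Bool → E × Option Bool) := by
  rintro ⟨e, b⟩ ⟨e', b'⟩ h
  simpa [pieceLeg] using h

theorem update_comp_pieceLeg (z : E × Option Bool → H) (d : E × Bool) (x : H) :
    Function.update z (pieceLeg d) x ∘ pieceLeg = Function.update (z ∘ pieceLeg) d x :=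
  Function.update_comp_eq_of_injective z pieceLeg_injective d x

theorem update_state_comp_pieceLeg (z : E × Option Bool → H) (e : E) (x : H) :
    Function.update z (e, none) x ∘ pieceLeg = z ∘ pieceLeg :=
  Function.update_comp_eq_of_forall_ne z x (by simp [pieceLeg])

theorem update_pieceLeg_state (z : E × Option Bool → H) (d : E × Bool) (x : H) :
    (fun e => Function.update z (pieceLeg d) x (e, none)) = fun e => z (e, none) :=
  funext fun e => Function.update_of_ne (by simp [pieceLeg]) _ _

theorem update_state_state (z : E × Option Bool → H) (e : E) (x : H) :
    (fun e' => Function.update z (e, none) x (e', none)) =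
      Function.update (fun e' => z (e', none)) e x :=
  Function.update_comp_eq_of_injective z (Prod.mk_left_injective none) e x

variable (Γ : SurfaceGraph E) (o : Γ.Face → E × Bool) (φ : Module.Dual ℂ H)
  (ho : ∀ p, Γ.faceOf (o p) = p) (hc : ∀ x y, φ (x * y) = φ (y * x))

/-- The pieces are contracted to the weights of the loops, the states remain. -/
noncomputable def contractionMultilinear :
    MultilinearMap ℂ (fun _ : E × Option Bool => H) (StateSpace E H) :=
  have key : ∀ (z : E × Option Bool → H) (i : E × Option Bool), ∃ f : H →ₗ[ℂ] StateSpace E H,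
      ∀ x, (faceWeight Γ o φ (Function.update z i x ∘ pieceLeg) •
        ⨂ₜ[ℂ] e, Function.update z i x (e, none)) = f x := by
    rintro z ⟨e, _ | b⟩
    · refine ⟨faceWeight Γ o φ (z ∘ pieceLeg) •
        (PiTensorProduct.tprod ℂ).toLinearMap (fun e' => z (e', none)) e, fun x => ?_⟩
      rw [update_state_comp_pieceLeg, update_state_state]
      rfl
    · obtain ⟨f, hf⟩ := exists_faceWeight_update ho hc (e, b) (z ∘ pieceLeg)
      refine ⟨f.smulRight (⨂ₜ[ℂ] e, z (e, none)), fun x => ?_⟩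
      change (faceWeight Γ o φ (Function.update z (pieceLeg (e, b)) x ∘ pieceLeg) •
        ⨂ₜ[ℂ] e', Function.update z (pieceLeg (e, b)) x (e', none)) = _
      rw [update_comp_pieceLeg, update_pieceLeg_state, hf]
      rfl
  MultilinearMap.mk' (fun z => faceWeight Γ o φ (z ∘ pieceLeg) • ⨂ₜ[ℂ] e, z (e, none))
    (fun z i x y => by
      obtain ⟨f, hf⟩ := key z i
      simp only [hf, map_add])
    (fun z i c x => by
      obtain ⟨f, hf⟩ := key z i
      simp only [hf, map_smul])

/-- The linear map given by `contractionMultilinear`. -/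
noncomputable def contraction : LegSpace H E →ₗ[ℂ] StateSpace E H :=
  legsLift (contractionMultilinear Γ o φ ho hc)

theorem contraction_pureLegs (z : E × Option Bool → H) :
    contraction Γ o φ ho hc (pureLegs z) =
      faceWeight Γ o φ (z ∘ pieceLeg) • ⨂ₜ[ℂ] e, z (e, none) :=
  legsLift_pureLegs _ _

theorem onEdge_tprod (e : E) (R : Module.End ℂ H) (x : E → H) :
    onEdge e R (⨂ₜ[ℂ] e', x e') = ⨂ₜ[ℂ] e', Function.update x e (R (x e)) e' := by
  rw [onEdge, MultilinearMap.toLinearMap_apply,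
    PiTensorProduct.mapMultilinear_apply, PiTensorProduct.map_tprod]
  congr 1
  funext e'
  by_cases he : e' = e
  · subst he; simp
  · simp [he]

theorem contraction_onLeg_state (e : E) (R : Module.End ℂ H) :
    contraction Γ o φ ho hc ∘ₗ onLeg (e, none) R = onEdge e R ∘ₗ contraction Γ o φ ho hc :=
  legSpace_ext fun z => by
    simp only [LinearMap.comp_apply, onLeg_pureLegs, contraction_pureLegs, map_smul, onEdge_tprod,
      update_state_comp_pieceLeg]
    rw [update_state_state]

/-- Left multiplication by `b` of the piece of the dart `d`. -/
noncomputable def pieceMulLeft (d : E × Bool) : H →ₗ[ℂ] Module.End ℂ (LegSpace H E) :=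
  onLeg (pieceLeg d) ∘ₗ LinearMap.mul ℂ H

/-- Right multiplication by `b` of the piece of the dart `d`. -/
noncomputable def pieceMulRight (d : E × Bool) : H →ₗ[ℂ] Module.End ℂ (LegSpace H E) :=
  onLeg (pieceLeg d) ∘ₗ (LinearMap.mul ℂ H).flip

theorem contraction_slide (d : E × Bool) (b : H) :
    contraction Γ o φ ho hc ∘ₗ pieceMulRight d b =
      contraction Γ o φ ho hc ∘ₗ pieceMulLeft (SurfaceGraph.flip (Γ.rot d)) b :=
  legSpace_ext fun z => by
    simp only [LinearMap.comp_apply, pieceMulRight, pieceMulLeft, onLeg_pureLegs,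
      contraction_pureLegs, update_comp_pieceLeg]
    rw [update_pieceLeg_state, update_pieceLeg_state]
    congr 1
    exact faceWeight_slide ho hc d (z ∘ pieceLeg) b

end Contraction

/-! ### Products over iterated coproducts -/

section SweedlerProd

variable {C A : Type*} [AddCommGroup C] [Module ℂ C] [Ring A] [Algebra ℂ A]
  {Δ : C →ₗ[ℂ] C ⊗[ℂ] C} {ε : C →ₗ[ℂ] ℂ}

theorem sweedlerProd_cons_apply (T : C →ₗ[ℂ] A) (Ts : List (C →ₗ[ℂ] A)) (c : C) :
    sweedlerProd Δ ε (T :: Ts) c =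
      LinearMap.mul' ℂ A (TensorProduct.map T (sweedlerProd Δ ε Ts) (Δ c)) := rfl

theorem commute_mul'_map {B : Type*} [AddCommGroup B] [Module ℂ B] {a : A} {T : C →ₗ[ℂ] A}
    {S : B →ₗ[ℂ] A} (hT : ∀ c, Commute a (T c)) (hS : ∀ b, Commute a (S b)) (t : C ⊗[ℂ] B) :
    Commute a (LinearMap.mul' ℂ A (TensorProduct.map T S t)) := by
  induction t with
  | zero => simp
  | tmul x y => exact (hT x).mul_right (hS y)
  | add x y hx hy =>
    rw [map_add, map_add]
    exact hx.add_right hy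

theorem commute_sweedlerProd {a : A} {Ts : List (C →ₗ[ℂ] A)}
    (h : ∀ T ∈ Ts, ∀ c, Commute a (T c)) (c : C) : Commute a (sweedlerProd Δ ε Ts c) := by
  induction Ts generalizing c with
  | nil => exact Algebra.commute_algebraMap_right _ _
  | cons T Ts ih =>
    exact commute_mul'_map (h T (by simp)) (ih fun T hT => h T (by simp [hT])) _

variable {V W D : Type*} [AddCommGroup V] [Module ℂ V] [AddCommGroup W] [Module ℂ W]

/-- An intertwiner of the factors intertwines the products. -/
theorem sweedlerProd_intertwine {G : V →ₗ[ℂ] W} {T : D → C →ₗ[ℂ] Module.End ℂ V}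
    {T' : D → C →ₗ[ℂ] Module.End ℂ W} (h : ∀ d c v, G (T d c v) = T' d c (G v)) (l : List D)
    (c : C) (v : V) :
    G (sweedlerProd Δ ε (l.map T) c v) = sweedlerProd Δ ε (l.map T') c (G v) := by
  induction l generalizing c with
  | nil => simp [sweedlerProd]
  | cons d l ih =>
    rw [List.map_cons, List.map_cons, sweedlerProd_cons_apply, sweedlerProd_cons_apply]
    induction Δ c with
    | zero => simp
    | tmul x y => simp [h, ih]
    | add x y hx hy => simp only [map_add, LinearMap.add_apply, hx, hy]

/-- Operators which agree on a vector may be replaced in a product applied to this vector, if the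
replacements commute with each other and with the original operators. -/
theorem sweedlerProd_transfer {v : V} {T T' : D → C →ₗ[ℂ] Module.End ℂ V}
    (h : ∀ d c, T d c v = T' d c v) (hc : ∀ d d' c c', Commute (T d c) (T' d' c'))
    (hc' : ∀ d d' c c', d ≠ d' → Commute (T' d c) (T' d' c')) {l : List D} (hl : l.Nodup) (c : C) :
    sweedlerProd Δ ε (l.map T) c v = sweedlerProd Δ ε (l.map T') c v := by
  induction l generalizing c with
  | nil => rfl
  | cons d l ih =>
    rw [List.nodup_cons] at hl
    rw [List.map_cons, List.map_cons, sweedlerProd_cons_apply, sweedlerProd_cons_apply]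
    induction Δ c with
    | zero => simp
    | tmul x y =>
      have h1 : Commute (T d x) (sweedlerProd Δ ε (l.map T') y) := by
        refine commute_sweedlerProd (fun S hS c => ?_) y
        obtain ⟨d', -, rfl⟩ := List.mem_map.1 hS
        exact hc _ _ _ _
      have h2 : Commute (T' d x) (sweedlerProd Δ ε (l.map T') y) := by
        refine commute_sweedlerProd (fun S hS c => ?_) y
        obtain ⟨d', hd', rfl⟩ := List.mem_map.1 hS
        exact hc' _ _ _ _ fun hdd => hl.1 (hdd ▸ hd')
      simp only [TensorProduct.map_tmul, LinearMap.mul'_apply, Module.End.mul_apply, ih hl.2 y]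
      rw [← Module.End.mul_apply, h1.eq, Module.End.mul_apply, h, ← Module.End.mul_apply, ← h2.eq,
        Module.End.mul_apply]
    | add x y hx hy => simp only [map_add, LinearMap.add_apply, hx, hy]

/-- A product of representations with commuting images is a representation. The algebra structure
on the coalgebra is given as a bilinear map `m`. -/
theorem sweedlerProd_mul {m : C →ₗ[ℂ] C →ₗ[ℂ] C}
    (hΔ : ∀ c d, Δ (m c d) = TensorProduct.map₂ m m (Δ c) (Δ d)) (hε : ∀ c d, ε (m c d) = ε c * ε d)
    {T : D → C →ₗ[ℂ] A} (hT : ∀ d a b, T d (m a b) = T d a * T d b)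
    (hc : ∀ d d' a b, d ≠ d' → Commute (T d a) (T d' b)) {l : List D} (hl : l.Nodup) (a b : C) :
    sweedlerProd Δ ε (l.map T) (m a b) =
      sweedlerProd Δ ε (l.map T) a * sweedlerProd Δ ε (l.map T) b := by
  induction l generalizing a b with
  | nil => simp [sweedlerProd, hε]
  | cons d l ih =>
    rw [List.nodup_cons] at hl
    simp only [List.map_cons, sweedlerProd_cons_apply, hΔ]
    generalize Δ a = s, Δ b = t
    induction s with
    | zero => simp
    | tmul x y =>
      induction t with
      | zero => simp
      | tmul x' y' =>
        have h1 : Commute (T d x') (sweedlerProd Δ ε (l.map T) y) := by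
          refine commute_sweedlerProd (fun S hS c => ?_) y
          obtain ⟨d', hd', rfl⟩ := List.mem_map.1 hS
          exact hc _ _ _ _ fun hdd => hl.1 (hdd ▸ hd')
        simp only [TensorProduct.map₂_apply_tmul, TensorProduct.map_tmul, LinearMap.mul'_apply, hT,
          ih hl.2, mul_assoc]
        rw [← mul_assoc (T d x'), h1.eq, mul_assoc]
      | add x' y' hx hy => simp only [map_add, mul_add, hx, hy]
    | add x y hx hy => simp only [map_add, LinearMap.add_apply, add_mul, hx, hy]

/-- A product of commuting `*`-representations is a `*`-representation. The involution of the
coalgebra is a map `σ` compatible with the comultiplication, and `Adj X Y` says that `Y` is an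
adjoint of `X`. -/
theorem sweedlerProd_adjoint {σ : C → C} {Adj : A → A → Prop}
    (hΔ : ∀ (c : C) (s : Finset (C × C)), Δ c = ∑ p ∈ s, p.1 ⊗ₜ p.2 →
      Δ (σ c) = ∑ p ∈ s, σ p.1 ⊗ₜ σ p.2)
    (hε : ∀ c, ε (σ c) = star (ε c))
    (hscalar : ∀ z : ℂ, Adj (algebraMap ℂ A z) (algebraMap ℂ A (star z)))
    (hadd : ∀ X X' Y Y', Adj X Y → Adj X' Y' → Adj (X + X') (Y + Y'))
    (hmul : ∀ X X' Y Y', Adj X Y → Adj X' Y' → Adj (X * X') (Y' * Y))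
    {T : D → C →ₗ[ℂ] A} (hT : ∀ d c, Adj (T d c) (T d (σ c)))
    (hc : ∀ d d' a b, d ≠ d' → Commute (T d a) (T d' b)) {l : List D} (hl : l.Nodup) (c : C) :
    Adj (sweedlerProd Δ ε (l.map T) c) (sweedlerProd Δ ε (l.map T) (σ c)) := by
  classical
  induction l generalizing c with
  | nil => simpa [sweedlerProd, hε] using hscalar (ε c)
  | cons d l ih =>
    rw [List.nodup_cons] at hl
    obtain ⟨s, hs⟩ := TensorProduct.exists_finset (Δ c)
    simp only [List.map_cons, sweedlerProd_cons_apply]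
    rw [hΔ c s hs, hs]
    clear hs
    induction s using Finset.induction_on with
    | empty => simpa using hscalar 0
    | insert p s hp ihs =>
      simp only [Finset.sum_insert hp, map_add]
      refine hadd _ _ _ _ ?_ ihs
      have h1 : Commute (T d (σ p.1)) (sweedlerProd Δ ε (l.map T) (σ p.2)) := by
        refine commute_sweedlerProd (fun S hS c => ?_) _
        obtain ⟨d', hd', rfl⟩ := List.mem_map.1 hS
        exact hc _ _ _ _ fun hdd => hl.1 (hdd ▸ hd')
      simp only [TensorProduct.map_tmul, LinearMap.mul'_apply, h1.eq]
      exact hmul _ _ _ _ (hT _ _) (ih hl.2 _)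

theorem sweedlerProd_coefficient {C : Type v} [AddCommGroup C] [Module ℂ C] [Coalgebra ℂ C]
    {n : ℕ} {U : Matrix (Fin n) (Fin n) C} (hU : IsCoefficientMatrix U) (T : C →ₗ[ℂ] A)
    (Ts : List (C →ₗ[ℂ] A)) (i j : Fin n) :
    sweedlerProd comul counit (T :: Ts) (U i j) =
      ∑ k, T (U i k) * sweedlerProd comul counit Ts (U k j) := by
  simp [sweedlerProd_cons_apply, hU.comul_eq]

end SweedlerProd

/-! ### Vertex operators act trivially after contraction -/

section Telescope

variable {E : Type u} [Fintype E] [DecidableEq E] {H : Type v} [NormedRing H] [HopfAlgebra ℂ H]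
  [FiniteDimensional ℂ H]

theorem commute_pieceMulLeft_pieceMulRight (d d' : E × Bool) (a b : H) :
    Commute (pieceMulLeft d a) (pieceMulRight d' b) :=
  commute_onLeg fun _ => LinearMap.ext fun x => by simp [mul_assoc]

theorem commute_pieceMulLeft {d d' : E × Bool} (h : d ≠ d') (a b : H) :
    Commute (pieceMulLeft d a) (pieceMulLeft d' b) :=
  commute_onLeg fun hd => absurd (pieceLeg_injective hd) h

theorem commute_pieceMulRight {d d' : E × Bool} (h : d ≠ d') (a b : H) :
    Commute (pieceMulRight d a) (pieceMulRight d' b) :=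
  commute_onLeg fun hd => absurd (pieceLeg_injective hd) h

theorem pieceMulLeft_mul (d : E × Bool) (a b : H) :
    pieceMulLeft d a * pieceMulLeft d b = pieceMulLeft d (a * b) := by
  simp only [pieceMulLeft, LinearMap.comp_apply, onLeg_mul]
  congr 1
  ext x
  simp [mul_assoc]

theorem pieceMulLeft_one (d : E × Bool) : pieceMulLeft d (1 : H) = 1 := by
  rw [pieceMulLeft, LinearMap.comp_apply, ← onLeg_one (pieceLeg d)]
  congr 1
  ext x
  simp

/-- The action of the vertex which a dart leaves, moved to the pieces: `y_d ↦ y_d a''` and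
`y ↦ S(a') y` for the piece `y` of the reversed dart. -/
noncomputable def pieceL (d : E × Bool) : H →ₗ[ℂ] Module.End ℂ (LegSpace H E) :=
  LinearMap.mul' ℂ _ ∘ₗ
    TensorProduct.map (pieceMulLeft (SurfaceGraph.flip d) ∘ₗ antipode ℂ) (pieceMulRight d) ∘ₗ comul

variable {n : ℕ} {U : Matrix (Fin n) (Fin n) H}

theorem pieceL_apply (d : E × Bool) (a : H) :
    pieceL d a = LinearMap.mul' ℂ (Module.End ℂ (LegSpace H E))
      (TensorProduct.map (pieceMulLeft (SurfaceGraph.flip d) ∘ₗ antipode ℂ) (pieceMulRight d)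
        (comul a)) := rfl

theorem pieceL_coefficient (hU : IsCoefficientMatrix U) (d : E × Bool) (i j : Fin n) :
    pieceL d (U i j) =
      ∑ k, pieceMulLeft (SurfaceGraph.flip d) (antipode ℂ (U i k)) * pieceMulRight d (U k j) := by
  simp [pieceL, hU.comul_eq]

/-- The coproduct of an element of `H`, distributed over a list of darts. -/
noncomputable def piecesL (l : List (E × Bool)) : H →ₗ[ℂ] Module.End ℂ (LegSpace H E) :=
  sweedlerProd comul counit (l.map pieceL)

theorem commute_pieceL {d d' : E × Bool} (h : d ≠ d') (a b : H) :
    Commute (pieceL d a) (pieceL d' b) := by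
  have h' : SurfaceGraph.flip d ≠ SurfaceGraph.flip d' :=
    fun hf => h (SurfaceGraph.flip.injective hf)
  have key : ∀ (X : Module.End ℂ (LegSpace H E)) (d : E × Bool) (a : H),
      (∀ y, Commute X (pieceMulLeft (SurfaceGraph.flip d) y)) →
      (∀ y, Commute X (pieceMulRight d y)) → Commute X (pieceL d a) := by
    intro X d a hl hr
    rw [pieceL_apply]
    exact commute_mul'_map (fun y => by rw [LinearMap.comp_apply]; exact hl _) hr _
  refine key _ d' b (fun y => (key _ d a (fun x => ?_) (fun x => ?_)).symm)
    (fun y => (key _ d a (fun x => ?_) (fun x => ?_)).symm)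
  · exact commute_pieceMulLeft h'.symm _ _
  · exact commute_pieceMulLeft_pieceMulRight _ _ _ _
  · exact (commute_pieceMulLeft_pieceMulRight _ _ _ _).symm
  · exact commute_pieceMulRight h.symm _ _

variable {P : Type*} [AddCommGroup P] [Module ℂ P]

/-- Along a sequence of darts with the sliding property, the factor `a''` at one dart cancels
against the factor `S(a')` at the next one; only the first and the last factor remain. -/
theorem sweedlerProd_pieceL (hU : IsCoefficientMatrix U) (G : LegSpace H E →ₗ[ℂ] P)
    (d : E × Bool) (l : List (E × Bool)) (hl : (d :: l).Nodup)
    (hG : (d :: l).IsChain fun a b =>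
      ∀ c v, G (pieceMulRight a c v) = G (pieceMulLeft (SurfaceGraph.flip b) c v))
    (i j : Fin n) (v : LegSpace H E) :
    G (piecesL (d :: l) (U i j) v) =
      ∑ k, G (pieceMulLeft (SurfaceGraph.flip d) (antipode ℂ (U i k))
        (pieceMulRight ((d :: l).getLast (by simp)) (U k j) v)) := by
  induction l generalizing d G i j with
  | nil =>
    rw [piecesL, List.map_singleton, sweedlerProd_coefficient hU]
    have h1 : ∑ k, pieceL (E := E) d (U i k) *
        sweedlerProd (A := Module.End ℂ (LegSpace H E)) comul counit [] (U k j) =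
          pieceL d (U i j) := by
      simp [sweedlerProd, hU.counit_eq, apply_ite]
    rw [h1, pieceL_coefficient hU]
    simp
  | cons d₂ l ih =>
    rw [List.isChain_cons_cons] at hG
    have hd : d ∉ d₂ :: l := (List.nodup_cons.1 hl).1
    have hd₂ : SurfaceGraph.flip d ≠ SurfaceGraph.flip d₂ :=
      fun h => hd (by simp [SurfaceGraph.flip.injective h])
    -- The induction hypothesis, composed with the two operators at `d`; the right multiplication at
    -- `d` is then moved to the next dart `d₂`.
    have step : ∀ k m, G (pieceMulLeft (SurfaceGraph.flip d) (antipode ℂ (U i m))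
        (pieceMulRight d (U m k) (piecesL (d₂ :: l) (U k j) v))) =
        ∑ q, G (pieceMulLeft (SurfaceGraph.flip d) (antipode ℂ (U i m))
          (pieceMulLeft (SurfaceGraph.flip d₂) (U m k * antipode ℂ (U k q))
            (pieceMulRight ((d₂ :: l).getLast (by simp)) (U q j) v))) := by
      intro k m
      have h1 := ih (G ∘ₗ (pieceMulLeft (SurfaceGraph.flip d) (antipode ℂ (U i m)) *
        pieceMulRight d (U m k) : Module.End ℂ (LegSpace H E))) d₂ (List.nodup_cons.1 hl).2 ?_ k j
      · refine h1.trans (Finset.sum_congr rfl fun q _ => ?_)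
        simp only [LinearMap.comp_apply, Module.End.mul_apply]
        rw [← Module.End.mul_apply, (commute_pieceMulLeft_pieceMulRight _ _ _ _).eq,
          Module.End.mul_apply, hG.1, ← pieceMulLeft_mul, Module.End.mul_apply,
          ← Module.End.mul_apply (pieceMulLeft (SurfaceGraph.flip d₂) _),
          (commute_pieceMulLeft hd₂.symm _ _).eq,
          Module.End.mul_apply]
      · refine List.IsChain.imp_of_mem_imp (fun a b ha hb h c w => ?_) hG.2
        have ha' : d ≠ a := fun h => hd (h ▸ ha)
        have hb' : SurfaceGraph.flip d ≠ SurfaceGraph.flip b :=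
          fun h => hd (SurfaceGraph.flip.injective h ▸ hb)
        simp only [LinearMap.comp_apply, Module.End.mul_apply]
        rw [← Module.End.mul_apply (pieceMulRight d _), (commute_pieceMulRight ha' _ _).eq,
          Module.End.mul_apply, ← Module.End.mul_apply (pieceMulLeft _ _),
          (commute_pieceMulLeft_pieceMulRight _ _ _ _).eq, Module.End.mul_apply, h,
          ← Module.End.mul_apply (pieceMulLeft (SurfaceGraph.flip b) _),
          (commute_pieceMulLeft hb'.symm _ _).eq,
          Module.End.mul_apply, ← Module.End.mul_apply (pieceMulLeft (SurfaceGraph.flip b) _),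
          (commute_pieceMulLeft_pieceMulRight _ _ _ _).eq, Module.End.mul_apply]
    rw [piecesL, List.map_cons, sweedlerProd_coefficient hU, ← piecesL]
    simp only [pieceL_coefficient hU, LinearMap.sum_apply, Module.End.mul_apply, map_sum, step]
    rw [Finset.sum_comm]
    refine Finset.sum_congr rfl fun m _ => ?_
    rw [Finset.sum_comm]
    have h2 : ∀ q, ∑ k, G (pieceMulLeft (SurfaceGraph.flip d) (antipode ℂ (U i m))
          (pieceMulLeft (SurfaceGraph.flip d₂) (U m k * antipode ℂ (U k q))
            (pieceMulRight ((d₂ :: l).getLast (by simp)) (U q j) v))) =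
        if m = q then G (pieceMulLeft (SurfaceGraph.flip d) (antipode ℂ (U i m))
          (pieceMulRight ((d₂ :: l).getLast (by simp)) (U q j) v)) else 0 := by
      intro q
      simp only [← map_sum, ← LinearMap.sum_apply, hU.mul_antipode]
      split_ifs
      · rw [pieceMulLeft_one, Module.End.one_apply]
      · simp
    simp only [h2, Finset.sum_ite_eq, Finset.mem_univ, if_true]
    rfl

/-- Around a whole vertex also the first and the last factor cancel. -/
theorem contraction_vertex {φ : Module.Dual ℂ H} (hφ : IsHaarTrace φ) (Γ : SurfaceGraph E)
    (o : Γ.Face → E × Bool) (ho : ∀ p, Γ.faceOf (o p) = p) (d : E × Bool) (a : H)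
    (v : LegSpace H E) :
    contraction Γ o φ ho hφ.mul_comm (piecesL (Γ.starAt d) a v) =
      counit (R := ℂ) a • contraction Γ o φ ho hφ.mul_comm v := by
  set G := contraction Γ o φ ho hφ.mul_comm with hGdef
  have hslide : ∀ d c v, G (pieceMulRight d c v) =
      G (pieceMulLeft (SurfaceGraph.flip (Γ.rot d)) c v) :=
    fun d c v => LinearMap.congr_fun (contraction_slide Γ o φ ho hφ.mul_comm d c) v
  let F₁ : H →ₗ[ℂ] StateSpace E H :=
    G ∘ₗ (LinearMap.applyₗ v) ∘ₗ piecesL (Γ.starAt d)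
  let F₂ : H →ₗ[ℂ] StateSpace E H := (counit (R := ℂ) (A := H)).smulRight (G v)
  suffices F₁ = F₂ from LinearMap.congr_fun this a
  refine linearMap_ext_coefficients fun n U hU i j => ?_
  obtain ⟨l, hl⟩ := cycleFrom_eq_cons Γ.rot (Γ.rot d)
  obtain ⟨l', hl'⟩ := cycleFrom_eq_concat Γ.rot (Γ.rot d)
  have hlast : (Γ.rot d :: l).getLast (by simp) = d := by
    have : Γ.rot d :: l = l' ++ [d] := by rw [← hl, hl', Equiv.symm_apply_apply]
    simp [this]
  have hchain : (Γ.rot d :: l).IsChain fun a b =>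
      ∀ c v, G (pieceMulRight a c v) = G (pieceMulLeft (SurfaceGraph.flip b) c v) := by
    rw [← hl]
    refine (isChain_cycleFrom Γ.rot (Γ.rot d)).imp fun a b hab c v => ?_
    rw [hslide, hab]
  have hnd : (Γ.rot d :: l).Nodup := hl ▸ nodup_cycleFrom Γ.rot (Γ.rot d)
  change G (piecesL (Γ.starAt d) (U i j) v) = _
  rw [starAt, hl, sweedlerProd_pieceL hU G (Γ.rot d) l hnd hchain, hlast]
  have h1 : ∀ k, G (pieceMulLeft (SurfaceGraph.flip (Γ.rot d)) (antipode ℂ (U i k))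
      (pieceMulRight d (U k j) v)) =
      G (pieceMulLeft (SurfaceGraph.flip (Γ.rot d)) (U k j * antipode ℂ (U i k)) v) := by
    intro k
    rw [← Module.End.mul_apply, (commute_pieceMulLeft_pieceMulRight _ _ _ _).eq,
      Module.End.mul_apply, hslide, ← Module.End.mul_apply, pieceMulLeft_mul]
  simp only [h1, ← map_sum, ← LinearMap.sum_apply, hφ.sum_mul_antipode_swap hU]
  change _ = counit (R := ℂ) (U i j) • G v
  rw [hU.counit_eq]
  split_ifs
  · rw [pieceMulLeft_one, Module.End.one_apply, one_smul]
  · simp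

end Telescope

/-! ### The network state as a contraction -/

section EdgeTensor

variable {H : Type v} [NormedRing H] [HopfAlgebra ℂ H] [FiniteDimensional ℂ H]

variable (H) in
/-- `x ⊗ y ↦ x ⊗ S(y') ⊗ y''`. -/
noncomputable def splitPieces : H ⊗[ℂ] H →ₗ[ℂ] TripleSpace H :=
  ((antipode ℂ).rTensor H ∘ₗ comul).lTensor H

/-- The tensor `x' ⊗ S(x'') ⊗ x'''` of an edge. -/
noncomputable def edgeTensor (x : H) : TripleSpace H := splitPieces H (comul x)

theorem splitPieces_mul_tmul_left (t : H ⊗[ℂ] H) (a : H) :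
    splitPieces H (t * (antipode ℂ a ⊗ₜ 1)) = tripleMap none (actLMinus H a) (splitPieces H t) := by
  induction t with
  | zero => simp
  | tmul x y => simp [splitPieces, tripleMap, actLMinus]
  | add x y hx hy => simp only [add_mul, map_add, hx, hy]

theorem splitPieces_tmul_mul_left (t : H ⊗[ℂ] H) (a : H) :
    splitPieces H ((a ⊗ₜ 1) * t) = tripleMap none (actLPlus H a) (splitPieces H t) := by
  induction t with
  | zero => simp
  | tmul x y => simp [splitPieces, tripleMap, actLPlus]
  | add x y hx hy => simp only [mul_add, map_add, hx, hy]

variable {n : ℕ} {U : Matrix (Fin n) (Fin n) H}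

theorem splitPieces_mul_tmul_right (hU : IsCoefficientMatrix U) (t : H ⊗[ℂ] H) (i j : Fin n) :
    splitPieces H (t * (1 ⊗ₜ U i j)) = ∑ k, tripleMap (some false)
      (LinearMap.mulLeft ℂ (antipode ℂ (U i k))) (tripleMap (some true)
        (LinearMap.mulRight ℂ (U k j)) (splitPieces H t)) := by
  have h1 : ∀ (s : H ⊗[ℂ] H) (u v : H), (antipode ℂ).rTensor H (s * (u ⊗ₜ v)) =
      (LinearMap.mulLeft ℂ (antipode ℂ u)).rTensor H ((LinearMap.mulRight ℂ v).lTensor H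
        ((antipode ℂ).rTensor H s)) := by
    intro s u v
    induction s with
    | zero => simp
    | tmul x y => simp [antipode_mul_antidistrib]
    | add x y hx hy => simp only [add_mul, map_add, hx, hy]
  induction t with
  | zero => simp
  | tmul x y =>
    simp only [splitPieces, tripleMap, Algebra.TensorProduct.tmul_mul_tmul, mul_one,
      LinearMap.lTensor_tmul, LinearMap.comp_apply, Bialgebra.comul_mul, hU.comul_eq,
      Finset.mul_sum, map_sum, h1, TensorProduct.tmul_sum]
    rfl
  | add x y hx hy => simp only [add_mul, map_add, hx, hy, Finset.sum_add_distrib]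

theorem splitPieces_tmul_mul_right (hU : IsCoefficientMatrix U)
    (hS : ∀ x : H, antipode ℂ (antipode ℂ x) = x) (t : H ⊗[ℂ] H) (i j : Fin n) :
    splitPieces H ((1 ⊗ₜ antipode ℂ (U i j)) * t) = ∑ k, tripleMap (some true)
      (LinearMap.mulLeft ℂ (antipode ℂ (U i k))) (tripleMap (some false)
        (LinearMap.mulRight ℂ (U k j)) (splitPieces H t)) := by
  have h1 : ∀ (s : H ⊗[ℂ] H) (u v : H), (antipode ℂ).rTensor H ((antipode ℂ u ⊗ₜ v) * s) =
      (LinearMap.mulLeft ℂ v).lTensor H ((LinearMap.mulRight ℂ u).rTensor H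
        ((antipode ℂ).rTensor H s)) := by
    intro s u v
    induction s with
    | zero => simp
    | tmul x y => simp [antipode_mul_antidistrib, hS]
    | add x y hx hy => simp only [mul_add, map_add, hx, hy]
  induction t with
  | zero => simp
  | tmul x y =>
    simp only [splitPieces, tripleMap, Algebra.TensorProduct.tmul_mul_tmul, one_mul,
      LinearMap.lTensor_tmul, LinearMap.comp_apply, Bialgebra.comul_mul, hU.comul_antipode,
      Finset.sum_mul, map_sum, h1, TensorProduct.tmul_sum]
    rfl
  | add x y hx hy => simp only [mul_add, map_add, hx, hy, Finset.sum_add_distrib]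

variable {φ : Module.Dual ℂ H} {h : H}

theorem IsHaarIntegral.actLMinus_edgeTensor (hh : IsHaarIntegral h) (hφ : IsHaarTrace φ)
    (hU : IsCoefficientMatrix U) (i j : Fin n) :
    tripleMap none (actLMinus H (U i j)) (edgeTensor h) = ∑ k, tripleMap (some false)
      (LinearMap.mulLeft ℂ (antipode ℂ (U i k))) (tripleMap (some true)
        (LinearMap.mulRight ℂ (U k j)) (edgeTensor h)) := by
  rw [edgeTensor, ← splitPieces_mul_tmul_left, hh.comul_mul_tmul hφ, splitPieces_mul_tmul_right hU]

theorem IsHaarIntegral.actLPlus_edgeTensor (hh : IsHaarIntegral h) (hφ : IsHaarTrace φ)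
    (hU : IsCoefficientMatrix U) (i j : Fin n) :
    tripleMap none (actLPlus H (U i j)) (edgeTensor h) = ∑ k, tripleMap (some true)
      (LinearMap.mulLeft ℂ (antipode ℂ (U i k))) (tripleMap (some false)
        (LinearMap.mulRight ℂ (U k j)) (edgeTensor h)) := by
  rw [edgeTensor, ← splitPieces_tmul_mul_left, hh.tmul_mul_comul hφ,
    splitPieces_tmul_mul_right hU hφ.antipode_antipode]

end EdgeTensor

section NetworkState

variable {E : Type u} [Fintype E] [DecidableEq E] {H : Type v} [NormedRing H] [HopfAlgebra ℂ H]
  [FiniteDimensional ℂ H] {φ : Module.Dual ℂ H} {h : H}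

theorem onLeg_legTensor_edge (e : E) (o : Option Bool) (R : Module.End ℂ H)
    (t : E → TripleSpace H) (x : TripleSpace H) :
    onLeg (e, o) R ((legTensor H E).toLinearMap t e x) =
      (legTensor H E).toLinearMap t e (tripleMap o R x) := by
  rw [MultilinearMap.toLinearMap_apply, onLeg_tprod, MultilinearMap.toLinearMap_apply]
  simp

theorem networkState_eq_contraction (Γ : SurfaceGraph E) (o : Γ.Face → E × Bool)
    (ho : ∀ p, Γ.faceOf (o p) = p) (hc : ∀ x y, φ (x * y) = φ (y * x)) :
    networkState Γ o (fun _ => h) (fun _ => φ) =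
      contraction Γ o φ ho hc (legTensor H E fun _ => edgeTensor h) := by
  have h1 : ∀ x : H, (antipode ℂ).rTensor H (comul (R := ℂ) x) =
      ∑ j ∈ (ℛ ℂ x).index, antipode ℂ ((ℛ ℂ x).left j) ⊗ₜ[ℂ] (ℛ ℂ x).right j := by
    intro x
    rw [← (ℛ ℂ x).eq, map_sum]
    rfl
  have h2 : edgeTensor h = ∑ i ∈ (ℛ ℂ h).index, (ℛ ℂ h).left i ⊗ₜ[ℂ]
      ((antipode ℂ).rTensor H (comul (R := ℂ) ((ℛ ℂ h).right i))) := by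
    rw [edgeTensor, ← (ℛ ℂ h).eq, map_sum]
    rfl
  have h3 : ∀ i : E → H × H, legTensor H E (fun e => (ℛ ℂ h).left (i e) ⊗ₜ[ℂ]
      ((antipode ℂ).rTensor H (comul (R := ℂ) ((ℛ ℂ h).right (i e))))) =
      ∑ j ∈ Fintype.piFinset fun e => (ℛ ℂ ((ℛ ℂ h).right (i e))).index,
        legTensor H E fun e => (ℛ ℂ h).left (i e) ⊗ₜ[ℂ]
          (antipode ℂ ((ℛ ℂ ((ℛ ℂ h).right (i e))).left (j e)) ⊗ₜ[ℂ]
            (ℛ ℂ ((ℛ ℂ h).right (i e))).right (j e)) := by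
    intro i
    simp only [h1, TensorProduct.tmul_sum]
    exact MultilinearMap.map_sum_finset (legTensor H E) _ _
  rw [h2, MultilinearMap.map_sum_finset, map_sum, networkState]
  refine Finset.sum_congr rfl fun i _ => ?_
  rw [h3, map_sum, tensorTrace, Finset.sum_smul]
  refine Finset.sum_congr rfl fun j _ => ?_
  let z : E × Option Bool → H
    | (e, none) => (ℛ ℂ h).left (i e)
    | (e, some false) => antipode ℂ ((ℛ ℂ ((ℛ ℂ h).right (i e))).left (j e))
    | (e, some true) => (ℛ ℂ ((ℛ ℂ h).right (i e))).right (j e)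
  refine Eq.trans ?_ (contraction_pureLegs Γ o φ ho hc z).symm
  have hz : z ∘ pieceLeg = loopPiece (fun e => (ℛ ℂ ((ℛ ℂ h).right (i e))).left (j e))
      (fun e => (ℛ ℂ ((ℛ ℂ h).right (i e))).right (j e)) := by
    funext ⟨e, b⟩
    cases b <;> rfl
  rw [hz]
  rfl

/-- The action of `dartL` on the state legs. -/
noncomputable def stateL : E × Bool → H →ₗ[ℂ] Module.End ℂ (LegSpace H E)
  | (e, true) => onLeg (e, none) ∘ₗ actLMinus H
  | (e, false) => onLeg (e, none) ∘ₗ actLPlus H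

/-- The edge tensors turn the action on the states into the action on the pieces. -/
theorem stateL_edgeTensor (hh : IsHaarIntegral h) (hφ : IsHaarTrace φ) (d : E × Bool) (a : H) :
    stateL d a (legTensor H E fun _ => edgeTensor h) =
      pieceL d a (legTensor H E fun _ => edgeTensor h) := by
  let v := legTensor H E fun _ => edgeTensor h
  have hv : v = (legTensor H E).toLinearMap (fun _ => edgeTensor h) d.1 (edgeTensor h) := by
    rw [MultilinearMap.toLinearMap_apply, Function.update_eq_self]
  suffices LinearMap.applyₗ v ∘ₗ stateL d = LinearMap.applyₗ v ∘ₗ pieceL d from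
    LinearMap.congr_fun this a
  refine linearMap_ext_coefficients fun n U hU i j => ?_
  change stateL d (U i j) v = pieceL d (U i j) v
  rw [pieceL_coefficient hU, LinearMap.sum_apply, hv]
  rcases d with ⟨e, _ | _⟩
  · have h1 := congrArg ((legTensor H E).toLinearMap (fun _ => edgeTensor h) e)
      (hh.actLPlus_edgeTensor hφ hU i j)
    rw [map_sum, ← onLeg_legTensor_edge] at h1
    simp only [← onLeg_legTensor_edge] at h1
    exact h1
  · have h1 := congrArg ((legTensor H E).toLinearMap (fun _ => edgeTensor h) e)
      (hh.actLMinus_edgeTensor hφ hU i j)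
    rw [map_sum, ← onLeg_legTensor_edge] at h1
    simp only [← onLeg_legTensor_edge] at h1
    exact h1

theorem commute_stateL_pieceL (d d' : E × Bool) (a b : H) :
    Commute (stateL d a) (pieceL d' b) := by
  have key : ∀ (R : Module.End ℂ H), Commute (onLeg (d.1, none) R) (pieceL d' b) := by
    intro R
    rw [pieceL_apply]
    refine commute_mul'_map (fun y => ?_) (fun y => ?_) _
    · rw [LinearMap.comp_apply]
      exact commute_onLeg fun h => by simp [pieceLeg] at h
    · exact commute_onLeg fun h => by simp [pieceLeg] at h
  rcases d with ⟨e, _ | _⟩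
  · exact key (actLPlus H a)
  · exact key (actLMinus H a)

theorem contraction_stateL (Γ : SurfaceGraph E) (o : Γ.Face → E × Bool)
    (ho : ∀ p, Γ.faceOf (o p) = p) (hc : ∀ x y, φ (x * y) = φ (y * x)) (d : E × Bool) (a : H)
    (v : LegSpace H E) :
    contraction Γ o φ ho hc (stateL d a v) = dartL d a (contraction Γ o φ ho hc v) := by
  rcases d with ⟨e, _ | _⟩
  · exact LinearMap.congr_fun (contraction_onLeg_state Γ o φ ho hc e (actLPlus H a)) v
  · exact LinearMap.congr_fun (contraction_onLeg_state Γ o φ ho hc e (actLMinus H a)) v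

/-- The network state carries the trivial representation of `H` at each site. -/
theorem vertexOp_networkState (hh : IsHaarIntegral h) (hφ : IsHaarTrace φ) (Γ : SurfaceGraph E)
    (o : Γ.Face → E × Bool) (ho : ∀ p, Γ.faceOf (o p) = p) (d : E × Bool) (a : H) :
    vertexOp Γ d a (networkState Γ o (fun _ => h) (fun _ => φ)) =
      counit (R := ℂ) a • networkState Γ o (fun _ => h) (fun _ => φ) := by
  have h1 := sweedlerProd_intertwine (Δ := comul (R := ℂ)) (ε := counit)
    (contraction_stateL Γ o ho hφ.mul_comm) (Γ.starAt d) a (legTensor H E fun _ => edgeTensor h)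
  have h2 := sweedlerProd_transfer (Δ := comul (R := ℂ)) (ε := counit)
    (stateL_edgeTensor (E := E) hh hφ) commute_stateL_pieceL
    (fun d d' a b hd => commute_pieceL hd a b)
    (l := Γ.starAt d) (nodup_cycleFrom _ _) a
  rw [networkState_eq_contraction Γ o ho hφ.mul_comm, vertexOp, ← h1, h2]
  exact contraction_vertex hφ Γ o ho d a _

end NetworkState

/-! ### Face operators act trivially after contraction -/

section PieceAction

variable {H : Type v} [NormedRing H] [HopfAlgebra ℂ H]

variable {n : ℕ} {U : Matrix (Fin n) (Fin n) H}

theorem IsCoefficientMatrix.actTPlus_apply (hU : IsCoefficientMatrix U) (f : Module.Dual ℂ H)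
    (i j : Fin n) : actTPlus H f (U i j) = ∑ k, f (U k j) • U i k := by
  simp [actTPlus, hU.comul_eq]

theorem IsCoefficientMatrix.actTMinus_apply (hU : IsCoefficientMatrix U) (f : Module.Dual ℂ H)
    (i j : Fin n) : actTMinus H f (U i j) = ∑ k, f (antipodeInv H (U i k)) • U k j := by
  simp [actTMinus, hU.comul_eq]

variable (H) in
/-- The action `y ↦ ∑ y' f(S(y''))` of the dual of `H` on the piece of a face. -/
noncomputable def actPiece : Module.Dual ℂ H →ₗ[ℂ] Module.End ℂ H :=
  actTPlus H ∘ₗ (antipode ℂ).dualMap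

theorem actPiece_apply (f : Module.Dual ℂ H) : actPiece H f = actTPlus H (f ∘ₗ antipode ℂ) := rfl

theorem IsCoefficientMatrix.actPiece_apply (hU : IsCoefficientMatrix U) (f : Module.Dual ℂ H)
    (i j : Fin n) : actPiece H f (U i j) = ∑ k, f (antipode ℂ (U k j)) • U i k := by
  rw [QuantumDouble.actPiece_apply, hU.actTPlus_apply]
  rfl

theorem actPiece_one (f : Module.Dual ℂ H) : actPiece H f 1 = f 1 • (1 : H) := by
  simp [actPiece_apply, actTPlus, Algebra.TensorProduct.one_def]

variable {φ : Module.Dual ℂ H} {h : H}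

theorem IsHaarFunctional.actPiece (hφ : IsHaarFunctional φ) (f : Module.Dual ℂ H) (y : H) :
    φ (actPiece H f y) = f 1 * φ y := by
  have h1 : ∀ (g : Module.Dual ℂ H) (t : H ⊗[ℂ] H), φ (TensorProduct.rid ℂ H (g.lTensor H t)) =
      g (TensorProduct.lid ℂ H (φ.rTensor H t)) := by
    intro g t
    induction t with
    | zero => simp
    | tmul x y => simp [mul_comm]
    | add x y hx hy => simp only [map_add, hx, hy]
  refine (h1 (f ∘ₗ antipode ℂ) (comul y)).trans ?_
  rw [hφ.right]
  simp [mul_comm]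

variable [FiniteDimensional ℂ H]

theorem dualDistrib_comulX (f : Module.Dual ℂ H) (x y : H) :
    TensorProduct.dualDistrib ℂ H H (comulX H f) (x ⊗ₜ y) = f (y * x) := by
  have h1 : TensorProduct.dualDistribEquiv ℂ H H (comulX H f) =
      f ∘ₗ (LinearMap.mul' ℂ H ∘ₗ (TensorProduct.comm ℂ H H).toLinearMap) := by
    rw [comulX, LinearMap.comp_apply, LinearEquiv.coe_coe, LinearEquiv.apply_symm_apply]
    rfl
  exact LinearMap.congr_fun h1 (x ⊗ₜ y)

/-- The action on a product of pieces distributes the comultiplication `comulX` over the factors. -/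
theorem actPiece_mul (f : Module.Dual ℂ H) (x y : H) :
    actPiece H f (x * y) = LinearMap.mul' ℂ H (TensorProduct.map ((actPiece H).flip x)
      ((actPiece H).flip y) (comulX H f)) := by
  have key : ∀ {m n : ℕ} {U : Matrix (Fin m) (Fin m) H} {V : Matrix (Fin n) (Fin n) H},
      IsCoefficientMatrix U → IsCoefficientMatrix V → ∀ i j k l,
      actPiece H f (U i j * V k l) = LinearMap.mul' ℂ H (TensorProduct.map
        ((actPiece H).flip (U i j)) ((actPiece H).flip (V k l)) (comulX H f)) := by
    intro m n U V hU hV i j k l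
    have h1 : ∀ t : Module.Dual ℂ H ⊗[ℂ] Module.Dual ℂ H,
        LinearMap.mul' ℂ H (TensorProduct.map
          ((actPiece H).flip (U i j)) ((actPiece H).flip (V k l)) t) =
        ∑ p, ∑ q, TensorProduct.dualDistrib ℂ H H t
          (antipode ℂ (U p j) ⊗ₜ antipode ℂ (V q l)) • (U i p * V k q) := by
      intro t
      induction t with
      | zero => simp
      | tmul a b =>
        simp only [TensorProduct.map_tmul, LinearMap.mul'_apply, LinearMap.flip_apply,
          hU.actPiece_apply, hV.actPiece_apply, Finset.sum_mul_sum,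
          TensorProduct.dualDistrib_apply, smul_mul_smul_comm]
      | add a b ha hb => simp only [map_add, ha, hb, LinearMap.add_apply, add_smul,
          Finset.sum_add_distrib]
    rw [h1]
    simp only [dualDistrib_comulX, ← antipode_mul_antidistrib]
    simp [QuantumDouble.actPiece_apply, actTPlus, hU.comul_eq, hV.comul_eq, Finset.sum_mul_sum]
  let F₁ : H →ₗ[ℂ] H →ₗ[ℂ] H := (LinearMap.mul ℂ H).compr₂ (actPiece H f)
  let F₂ : H →ₗ[ℂ] H →ₗ[ℂ] H := LinearMap.mk₂ ℂ (fun x y => LinearMap.mul' ℂ H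
      (TensorProduct.map ((actPiece H).flip x) ((actPiece H).flip y) (comulX H f)))
    (fun x x' y => by simp [TensorProduct.map_add_left])
    (fun c x y => by simp [TensorProduct.map_smul_left])
    (fun x y y' => by simp [TensorProduct.map_add_right])
    (fun c x y => by simp [TensorProduct.map_smul_right])
  suffices F₁ = F₂ from LinearMap.congr_fun (LinearMap.congr_fun this x) y
  refine linearMap_ext_coefficients fun m U hU i j => ?_
  refine linearMap_ext_coefficients fun n V hV k l => ?_
  exact key hU hV i j k l

theorem IsCoefficientMatrix.edgeTensor_apply (hU : IsCoefficientMatrix U) (i j : Fin n) :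
    edgeTensor (U i j) = ∑ k, ∑ l, U i k ⊗ₜ (antipode ℂ (U k l) ⊗ₜ U l j) := by
  simp [edgeTensor, splitPieces, hU.comul_eq, TensorProduct.tmul_sum]

theorem edgeTensor_actTMinus (f : Module.Dual ℂ H) (x : H) :
    tripleMap none (actTMinus H f) (edgeTensor x) = edgeTensor (actTMinus H f x) := by
  suffices tripleMap none (actTMinus H f) ∘ₗ splitPieces H ∘ₗ comul =
      splitPieces H ∘ₗ comul ∘ₗ actTMinus H f from LinearMap.congr_fun this x
  refine linearMap_ext_coefficients fun n U hU i j => ?_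
  change tripleMap none (actTMinus H f) (edgeTensor (U i j)) =
    (splitPieces H ∘ₗ comul) (actTMinus H f (U i j))
  rw [hU.actTMinus_apply, hU.edgeTensor_apply, map_sum]
  have h1 : ∀ k, (splitPieces H ∘ₗ comul) (f (antipodeInv H (U i k)) • U k j) =
      f (antipodeInv H (U i k)) • edgeTensor (U k j) := fun k => map_smul _ _ _
  simp only [map_sum, h1, hU.edgeTensor_apply, Finset.smul_sum]
  simp only [tripleMap, LinearMap.coe_rTensorHom, LinearMap.rTensor_tmul, hU.actTMinus_apply,
    TensorProduct.sum_tmul, TensorProduct.smul_tmul']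
  exact (Finset.sum_congr rfl fun k _ => Finset.sum_comm).trans Finset.sum_comm

theorem edgeTensor_actPiece (f : Module.Dual ℂ H) (x : H) :
    tripleMap (some true) (actPiece H f) (edgeTensor x) = edgeTensor (actPiece H f x) := by
  suffices tripleMap (some true) (actPiece H f) ∘ₗ splitPieces H ∘ₗ comul =
      splitPieces H ∘ₗ comul ∘ₗ actPiece H f from LinearMap.congr_fun this x
  refine linearMap_ext_coefficients fun n U hU i j => ?_
  change tripleMap (some true) (actPiece H f) (edgeTensor (U i j)) =
    (splitPieces H ∘ₗ comul) (actPiece H f (U i j))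
  rw [hU.actPiece_apply, hU.edgeTensor_apply, map_sum]
  have h1 : ∀ k, (splitPieces H ∘ₗ comul) (f (antipode ℂ (U k j)) • U i k) =
      f (antipode ℂ (U k j)) • edgeTensor (U i k) := fun k => map_smul _ _ _
  simp only [map_sum, h1, hU.edgeTensor_apply, Finset.smul_sum]
  simp only [tripleMap, LinearMap.comp_apply, LinearMap.coe_lTensorHom, LinearMap.lTensor_tmul,
    hU.actPiece_apply, TensorProduct.tmul_sum, TensorProduct.tmul_smul]
  exact (Finset.sum_congr rfl fun k _ => Finset.sum_comm).trans Finset.sum_comm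

/-- The action `T₊` on the state of an edge equals the action on the piece of its right face. -/
theorem actTPlus_edgeTensor (hS : ∀ x : H, antipode ℂ (antipode ℂ x) = x) (f : Module.Dual ℂ H)
    (x : H) : tripleMap none (actTPlus H f) (edgeTensor x) =
      tripleMap (some false) (actPiece H f) (edgeTensor x) := by
  suffices tripleMap none (actTPlus H f) ∘ₗ splitPieces H ∘ₗ comul =
      tripleMap (some false) (actPiece H f) ∘ₗ splitPieces H ∘ₗ comul from
    LinearMap.congr_fun this x
  refine linearMap_ext_coefficients fun n U hU i j => ?_
  change tripleMap none (actTPlus H f) (edgeTensor (U i j)) =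
    tripleMap (some false) (actPiece H f) (edgeTensor (U i j))
  have h1 : ∀ k l, actPiece H f (antipode ℂ (U k l)) = ∑ m, f (U k m) • antipode ℂ (U m l) := by
    intro k l
    simp [actPiece_apply, actTPlus, hU.comul_antipode, hS]
  simp only [hU.edgeTensor_apply, map_sum, tripleMap, LinearMap.comp_apply,
    LinearMap.coe_rTensorHom, LinearMap.coe_lTensorHom, LinearMap.rTensor_tmul,
    LinearMap.lTensor_tmul, hU.actTPlus_apply, h1, TensorProduct.tmul_sum, TensorProduct.sum_tmul,
    TensorProduct.tmul_smul, ← TensorProduct.smul_tmul']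
  rw [Finset.sum_congr rfl fun k _ => Finset.sum_comm, Finset.sum_comm]
  exact Finset.sum_congr rfl fun k _ => Finset.sum_comm

/-- As the Haar integral is cocommutative, the action `T₋` on the state of an edge equals the action
on the piece of its left face. -/
theorem actTMinus_edgeTensor (hφ : IsHaarTrace φ)
    (hc : TensorProduct.comm ℂ H H (comul h) = comul (R := ℂ) h) (f : Module.Dual ℂ H) :
    tripleMap none (actTMinus H f) (edgeTensor h) =
      tripleMap (some true) (actPiece H f) (edgeTensor h) := by
  rw [edgeTensor_actTMinus, edgeTensor_actPiece]
  congr 1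
  have h1 : ∀ (g : Module.Dual ℂ H) (t : H ⊗[ℂ] H), TensorProduct.lid ℂ H (g.rTensor H t) =
      TensorProduct.rid ℂ H (g.lTensor H (TensorProduct.comm ℂ H H t)) := by
    intro g t
    induction t with
    | zero => simp
    | tmul x y => simp
    | add x y hx hy => simp only [map_add, hx, hy]
  refine (h1 (f ∘ₗ antipodeInv H) (comul h)).trans ?_
  rw [hc, hφ.antipodeInv_eq]
  rfl

end PieceAction

section FaceOperators

variable {E : Type u} [Fintype E] [DecidableEq E] {H : Type v} [NormedRing H] [HopfAlgebra ℂ H]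
  [FiniteDimensional ℂ H] {φ : Module.Dual ℂ H} {h : H}

/-- The action of `dartT` on the state legs. -/
noncomputable def stateT : E × Bool → Module.Dual ℂ H →ₗ[ℂ] Module.End ℂ (LegSpace H E)
  | (e, true) => onLeg (e, none) ∘ₗ actTMinus H
  | (e, false) => onLeg (e, none) ∘ₗ actTPlus H

/-- The action of the dual of `H` on the piece of a dart. -/
noncomputable def pieceT (d : E × Bool) : Module.Dual ℂ H →ₗ[ℂ] Module.End ℂ (LegSpace H E) :=
  onLeg (pieceLeg d) ∘ₗ actPiece H

theorem pieceT_pureLegs (d : E × Bool) (f : Module.Dual ℂ H) (z : E × Option Bool → H) :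
    pieceT d f (pureLegs z) =
      pureLegs (Function.update z (pieceLeg d) (actPiece H f (z (pieceLeg d)))) :=
  onLeg_pureLegs _ _ _

/-- The edge tensors turn the action on the states into the action on the pieces. -/
theorem stateT_edgeTensor (hφ : IsHaarTrace φ)
    (hc : TensorProduct.comm ℂ H H (comul h) = comul (R := ℂ) h) (d : E × Bool)
    (f : Module.Dual ℂ H) :
    stateT d f (legTensor H E fun _ => edgeTensor h) =
      pieceT d f (legTensor H E fun _ => edgeTensor h) := by
  have hv : legTensor H E (fun _ => edgeTensor h) =
      (legTensor H E).toLinearMap (fun _ => edgeTensor h) d.1 (edgeTensor h) := by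
    rw [MultilinearMap.toLinearMap_apply, Function.update_eq_self]
  rw [hv]
  rcases d with ⟨e, _ | _⟩
  · have h1 := congrArg ((legTensor H E).toLinearMap (fun _ => edgeTensor h) e)
      (actTPlus_edgeTensor hφ.antipode_antipode f h)
    rw [← onLeg_legTensor_edge, ← onLeg_legTensor_edge] at h1
    exact h1
  · have h1 := congrArg ((legTensor H E).toLinearMap (fun _ => edgeTensor h) e)
      (actTMinus_edgeTensor hφ hc f)
    rw [← onLeg_legTensor_edge, ← onLeg_legTensor_edge] at h1
    exact h1

theorem commute_stateT_pieceT (d d' : E × Bool) (f g : Module.Dual ℂ H) :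
    Commute (stateT d f) (pieceT d' g) := by
  rcases d with ⟨e, _ | _⟩
  · exact commute_onLeg fun h => by simp [pieceLeg] at h
  · exact commute_onLeg fun h => by simp [pieceLeg] at h

theorem commute_pieceT {d d' : E × Bool} (h : d ≠ d') (f g : Module.Dual ℂ H) :
    Commute (pieceT d f) (pieceT d' g) :=
  commute_onLeg fun hd => absurd (pieceLeg_injective hd) h

theorem contraction_stateT (Γ : SurfaceGraph E) (o : Γ.Face → E × Bool)
    (ho : ∀ p, Γ.faceOf (o p) = p) (hc : ∀ x y, φ (x * y) = φ (y * x)) (d : E × Bool)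
    (f : Module.Dual ℂ H) (v : LegSpace H E) :
    contraction Γ o φ ho hc (stateT d f v) = dartT d f (contraction Γ o φ ho hc v) := by
  rcases d with ⟨e, _ | _⟩
  · exact LinearMap.congr_fun (contraction_onLeg_state Γ o φ ho hc e (actTPlus H f)) v
  · exact LinearMap.congr_fun (contraction_onLeg_state Γ o φ ho hc e (actTMinus H f)) v

/-- Acting on the pieces of a list of darts through the iterated coproduct amounts to acting on the
product of these pieces, in every functional `G` which depends on them only through the product. -/
theorem sweedlerProd_pieceT {P : Type*} [AddCommGroup P] [Module ℂ P] {l : List (E × Bool)}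
    (hl : l.Nodup) (z : E × Option Bool → H) (G : LegSpace H E →ₗ[ℂ] P) (κ : H →ₗ[ℂ] P)
    (hG : ∀ z' : E × Option Bool → H, (∀ i ∉ l.map pieceLeg, z' i = z i) →
      G (pureLegs z') = κ (l.map (z' ∘ pieceLeg)).prod) (f : Module.Dual ℂ H) :
    G (sweedlerProd (comulX H) (counitX H) (l.map pieceT) f (pureLegs z)) =
      κ (actPiece H f (l.map (z ∘ pieceLeg)).prod) := by
  induction l generalizing G κ f with
  | nil =>
    have h1 := hG z fun _ _ => rfl
    rw [List.map_nil, List.prod_nil] at h1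
    simp [sweedlerProd, counitX, actPiece_one, h1]
  | cons d l ih =>
    rw [List.nodup_cons] at hl
    rw [List.map_cons, List.map_cons, sweedlerProd_cons_apply, List.prod_cons, actPiece_mul]
    induction comulX H f with
    | zero => simp
    | add s t hs ht => simp only [map_add, LinearMap.add_apply, hs, ht]
    | tmul a b =>
      rw [TensorProduct.map_tmul, LinearMap.mul'_apply, Module.End.mul_apply,
        TensorProduct.map_tmul, LinearMap.mul'_apply, LinearMap.flip_apply, LinearMap.flip_apply]
      refine ih hl.2 (G ∘ₗ pieceT d a)
        (κ ∘ₗ LinearMap.mulLeft ℂ (actPiece H a (z (pieceLeg d)))) (fun z' hz' => ?_) b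
      have hd : pieceLeg d ∉ l.map pieceLeg := fun hm => by
        obtain ⟨d', hd', h'⟩ := List.mem_map.1 hm
        exact hl.1 (pieceLeg_injective h' ▸ hd')
      rw [LinearMap.comp_apply, pieceT_pureLegs, hG, List.map_cons, update_comp_pieceLeg,
        map_update_of_notMem hl.1, List.prod_cons, Function.update_self, hz' _ hd]
      · rfl
      · intro i hi
        rw [List.map_cons, List.mem_cons, not_or] at hi
        rw [Function.update_of_ne hi.1, hz' i hi.2]

/-- By the invariance of the Haar functional the action on the pieces of a face is trivial. -/
theorem contraction_face (hφ : IsHaarTrace φ) (Γ : SurfaceGraph E) (o : Γ.Face → E × Bool)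
    (ho : ∀ p, Γ.faceOf (o p) = p) (d : E × Bool) (f : Module.Dual ℂ H) (v : LegSpace H E) :
    contraction Γ o φ ho hφ.mul_comm
        (sweedlerProd (comulX H) (counitX H) ((Γ.loopAt d).map pieceT) f v) =
      f 1 • contraction Γ o φ ho hφ.mul_comm v := by
  set G := contraction Γ o φ ho hφ.mul_comm with hGdef
  suffices G ∘ₗ sweedlerProd (comulX H) (counitX H) ((Γ.loopAt d).map pieceT) f = f 1 • G from
    LinearMap.congr_fun this v
  refine legSpace_ext fun z => ?_
  obtain ⟨c, hcz⟩ := exists_faceWeight_eq ho hφ.mul_comm d (z ∘ pieceLeg)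
  have hG : ∀ z' : E × Option Bool → H, (∀ i ∉ (Γ.loopAt d).map pieceLeg, z' i = z i) →
      G (pureLegs z') = φ.smulRight (c • ⨂ₜ[ℂ] e, z (e, none))
        ((Γ.loopAt d).map (z' ∘ pieceLeg)).prod := by
    intro z' hz'
    have hstate : (fun e => z' (e, none)) = fun e => z (e, none) :=
      funext fun e => hz' _ (by simp [pieceLeg])
    rw [hGdef, contraction_pureLegs, hcz, hstate, LinearMap.smulRight_apply, smul_smul, mul_comm]
    intro d' hd'
    refine hz' _ fun hm => hd' ?_
    obtain ⟨d'', hd'', h'⟩ := List.mem_map.1 hm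
    exact pieceLeg_injective h' ▸ hd''
  rw [LinearMap.comp_apply, sweedlerProd_pieceT (nodup_loopAt Γ d) z G _ hG, LinearMap.smul_apply,
    hG z fun _ _ => rfl, LinearMap.smulRight_apply, LinearMap.smulRight_apply,
    hφ.toIsHaarFunctional.actPiece, mul_smul]

/-- The network state carries the trivial representation of the dual of `H` at each site. -/
theorem faceOp_networkState (hφ : IsHaarTrace φ)
    (hc : TensorProduct.comm ℂ H H (comul h) = comul (R := ℂ) h) (Γ : SurfaceGraph E)
    (o : Γ.Face → E × Bool) (ho : ∀ p, Γ.faceOf (o p) = p) (d : E × Bool)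
    (f : Module.Dual ℂ H) :
    faceOp Γ d f (networkState Γ o (fun _ => h) (fun _ => φ)) =
      f 1 • networkState Γ o (fun _ => h) (fun _ => φ) := by
  have h1 := sweedlerProd_intertwine (Δ := comulX H) (ε := counitX H)
    (contraction_stateT Γ o ho hφ.mul_comm) (Γ.loopAt d) f (legTensor H E fun _ => edgeTensor h)
  have h2 := sweedlerProd_transfer (Δ := comulX H) (ε := counitX H)
    (stateT_edgeTensor (E := E) hφ hc) commute_stateT_pieceT
    (fun d d' f g hd => commute_pieceT hd f g) (nodup_loopAt Γ d) f
  rw [networkState_eq_contraction Γ o ho hφ.mul_comm, faceOp, ← h1, h2]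
  exact contraction_face hφ Γ o ho d f _

end FaceOperators

/-! ### Vertex and face operators as representations -/

section Convolution

variable {H : Type v} [NormedRing H] [HopfAlgebra ℂ H] {n : ℕ} {U : Matrix (Fin n) (Fin n) H}

variable (H) in
/-- The product `(f g)(x) = ∑ f(x') g(x'')` of the dual of `H`. -/
noncomputable def convolution : Module.Dual ℂ H →ₗ[ℂ] Module.Dual ℂ H →ₗ[ℂ] Module.Dual ℂ H :=
  (TensorProduct.mk ℂ _ _).compr₂ (comul.dualMap ∘ₗ TensorProduct.dualDistrib ℂ H H)

theorem convolution_apply (f g : Module.Dual ℂ H) (x : H) :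
    convolution H f g x = TensorProduct.dualDistrib ℂ H H (f ⊗ₜ g) (comul x) := rfl

theorem IsCoefficientMatrix.convolution_apply (hU : IsCoefficientMatrix U) (f g : Module.Dual ℂ H)
    (i j : Fin n) : convolution H f g (U i j) = ∑ k, f (U i k) * g (U k j) := by
  simp [QuantumDouble.convolution_apply, hU.comul_eq]

theorem counitX_convolution [FiniteDimensional ℂ H] (f g : Module.Dual ℂ H) :
    counitX H (convolution H f g) = counitX H f * counitX H g := by
  simp [counitX, convolution_apply, Algebra.TensorProduct.one_def]

theorem IsHaarFunctional.convolution_self {φ : Module.Dual ℂ H} (hφ : IsHaarFunctional φ) :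
    convolution H φ φ = φ := by
  have h1 : ∀ t : H ⊗[ℂ] H, TensorProduct.dualDistrib ℂ H H (φ ⊗ₜ φ) t =
      φ (TensorProduct.lid ℂ H (φ.rTensor H t)) := by
    intro t
    induction t with
    | zero => simp
    | tmul x y => simp
    | add x y hx hy => simp only [map_add, hx, hy]
  ext x
  rw [convolution_apply, h1, hφ.right]
  simp [hφ.map_one]

variable [FiniteDimensional ℂ H]

/-- The dual of `H` is a bialgebra. -/
theorem comulX_convolution (f g : Module.Dual ℂ H) :
    comulX H (convolution H f g) =
      TensorProduct.map₂ (convolution H) (convolution H) (comulX H f) (comulX H g) := by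
  apply (TensorProduct.dualDistribEquiv ℂ H H).injective
  change TensorProduct.dualDistrib ℂ H H _ = TensorProduct.dualDistrib ℂ H H _
  refine TensorProduct.ext (linearMap_ext_coefficients fun m U hU i j => ?_)
  refine linearMap_ext_coefficients fun n V hV k l => ?_
  change TensorProduct.dualDistrib ℂ H H _ (U i j ⊗ₜ V k l) =
    TensorProduct.dualDistrib ℂ H H _ (U i j ⊗ₜ V k l)
  have h1 : ∀ s t : Module.Dual ℂ H ⊗[ℂ] Module.Dual ℂ H, TensorProduct.dualDistrib ℂ H H
      (TensorProduct.map₂ (convolution H) (convolution H) s t) (U i j ⊗ₜ V k l) =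
      ∑ p, ∑ q, TensorProduct.dualDistrib ℂ H H s (U i p ⊗ₜ V k q) *
        TensorProduct.dualDistrib ℂ H H t (U p j ⊗ₜ V q l) := by
    intro s t
    induction s with
    | zero => simp
    | add s s' hs hs' => simp only [map_add, LinearMap.add_apply, hs, hs', add_mul,
        Finset.sum_add_distrib]
    | tmul a b =>
      induction t with
      | zero => simp
      | add t t' ht ht' => simp only [map_add, LinearMap.add_apply, ht, ht', mul_add,
          Finset.sum_add_distrib]
      | tmul c d =>
        simp only [TensorProduct.map₂_apply_tmul, TensorProduct.map_tmul,
          TensorProduct.dualDistrib_apply, hU.convolution_apply, hV.convolution_apply,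
          Finset.sum_mul_sum, mul_mul_mul_comm]
  rw [h1, dualDistrib_comulX, convolution_apply, Bialgebra.comul_mul, hU.comul_eq, hV.comul_eq,
    Finset.sum_mul_sum, Finset.sum_comm]
  simp [dualDistrib_comulX]

theorem actTPlus_convolution (f g : Module.Dual ℂ H) :
    actTPlus H (convolution H f g) = actTPlus H f * actTPlus H g := by
  refine linearMap_ext_coefficients fun n U hU i j => ?_
  simp only [Module.End.mul_apply, hU.actTPlus_apply, map_sum, map_smul, hU.convolution_apply,
    Finset.sum_smul, Finset.smul_sum, smul_smul]
  rw [Finset.sum_comm]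
  exact Finset.sum_congr rfl fun k _ => Finset.sum_congr rfl fun l _ => by rw [mul_comm]

theorem actTMinus_convolution (hS : antipodeInv H = antipode ℂ (A := H))
    (f g : Module.Dual ℂ H) :
    actTMinus H (convolution H f g) = actTMinus H f * actTMinus H g := by
  refine linearMap_ext_coefficients fun n U hU i j => ?_
  have h1 : ∀ k, convolution H f g (antipode ℂ (U i k)) =
      ∑ l, f (antipode ℂ (U l k)) * g (antipode ℂ (U i l)) := fun k => by
    simp [QuantumDouble.convolution_apply, hU.comul_antipode]
  simp only [Module.End.mul_apply, hU.actTMinus_apply, map_sum, map_smul, hS, h1,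
    Finset.sum_smul, Finset.smul_sum, smul_smul]
  rw [Finset.sum_comm]
  exact Finset.sum_congr rfl fun k _ => Finset.sum_congr rfl fun l _ => by rw [mul_comm]

theorem commute_actTPlus_actTMinus (f g : Module.Dual ℂ H) :
    Commute (actTPlus H f) (actTMinus H g) := by
  refine linearMap_ext_coefficients fun n U hU i j => ?_
  simp only [Module.End.mul_apply, hU.actTMinus_apply, hU.actTPlus_apply, map_sum, map_smul,
    Finset.smul_sum, smul_smul]
  rw [Finset.sum_comm]
  exact Finset.sum_congr rfl fun k _ => Finset.sum_congr rfl fun l _ => by rw [mul_comm]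

end Convolution

section Representation

variable {E : Type u} [Fintype E] [DecidableEq E] {H : Type v} [NormedRing H] [HopfAlgebra ℂ H]
  [FiniteDimensional ℂ H]

theorem onEdge_mul (e : E) (R S : Module.End ℂ H) :
    onEdge e R * onEdge e S = onEdge e (R * S) := by
  refine PiTensorProduct.ext (MultilinearMap.ext fun x => ?_)
  simp [onEdge_tprod]

theorem commute_onEdge {e e' : E} {R S : Module.End ℂ H} (h : e = e' → Commute R S) :
    Commute (onEdge e R) (onEdge e' S) := by
  by_cases he : e = e'
  · subst he
    rw [commute_iff_eq, onEdge_mul, onEdge_mul, (h rfl).eq]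
  · refine PiTensorProduct.ext (MultilinearMap.ext fun x => ?_)
    simp [onEdge_tprod, Function.update_of_ne he, Function.update_of_ne (Ne.symm he),
      Function.update_comm he]

theorem commute_actLPlus_actLMinus (a b : H) : Commute (actLPlus H a) (actLMinus H b) :=
  LinearMap.ext fun x => by simp [actLPlus, actLMinus, mul_assoc]

theorem dartL_mul (d : E × Bool) (a b : H) :
    dartL (E := E) d (a * b) = dartL d a * dartL d b := by
  rcases d with ⟨e, _ | _⟩
  · refine Eq.trans (congrArg (onEdge e) ?_) (onEdge_mul e (actLPlus H a) (actLPlus H b)).symm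
    exact LinearMap.ext fun x => by simp [actLPlus, mul_assoc]
  · refine Eq.trans (congrArg (onEdge e) ?_) (onEdge_mul e (actLMinus H a) (actLMinus H b)).symm
    exact LinearMap.ext fun x => by simp [actLMinus, mul_assoc, antipode_mul_antidistrib]

theorem commute_dartL (d d' : E × Bool) (a b : H) (h : d ≠ d') :
    Commute (dartL d a) (dartL d' b) := by
  rcases d with ⟨e, _ | _⟩ <;> rcases d' with ⟨e', _ | _⟩
  · exact commute_onEdge fun he => absurd (congrArg (·, false) he) h
  · exact commute_onEdge fun _ => commute_actLPlus_actLMinus a b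
  · exact commute_onEdge fun _ => (commute_actLPlus_actLMinus b a).symm
  · exact commute_onEdge fun he => absurd (congrArg (·, true) he) h

theorem vertexOp_mul (Γ : SurfaceGraph E) (d : E × Bool) (a b : H) :
    vertexOp Γ d (a * b) = vertexOp Γ d a * vertexOp Γ d b := by
  refine sweedlerProd_mul (m := LinearMap.mul ℂ H) (fun x y => ?_) (fun x y => ?_)
    dartL_mul commute_dartL (nodup_cycleFrom _ _) a b
  · rw [LinearMap.mul_apply', Bialgebra.comul_mul]
    generalize comul (R := ℂ) x = s, comul (R := ℂ) y = t
    induction s with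
    | zero => simp
    | add s s' hs hs' => simp only [map_add, LinearMap.add_apply, hs, hs', add_mul]
    | tmul a b =>
      induction t with
      | zero => simp
      | add t t' ht ht' => simp only [map_add, ht, ht', mul_add]
      | tmul c d => simp
  · exact Bialgebra.counit_mul x y

theorem dartT_convolution (hS : antipodeInv H = antipode ℂ (A := H)) (d : E × Bool)
    (f g : Module.Dual ℂ H) :
    dartT (E := E) d (convolution H f g) = dartT d f * dartT d g := by
  rcases d with ⟨e, _ | _⟩
  · exact Eq.trans (congrArg (onEdge e) (actTPlus_convolution f g)) (onEdge_mul e _ _).symm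
  · exact Eq.trans (congrArg (onEdge e) (actTMinus_convolution hS f g)) (onEdge_mul e _ _).symm

theorem commute_dartT (d d' : E × Bool) (f g : Module.Dual ℂ H) (h : d ≠ d') :
    Commute (dartT d f) (dartT d' g) := by
  rcases d with ⟨e, _ | _⟩ <;> rcases d' with ⟨e', _ | _⟩
  · exact commute_onEdge fun he => absurd (congrArg (·, false) he) h
  · exact commute_onEdge fun _ => commute_actTPlus_actTMinus f g
  · exact commute_onEdge fun _ => (commute_actTPlus_actTMinus g f).symm
  · exact commute_onEdge fun he => absurd (congrArg (·, true) he) h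

theorem faceOp_convolution (hS : antipodeInv H = antipode ℂ (A := H)) (Γ : SurfaceGraph E)
    (d : E × Bool) (f g : Module.Dual ℂ H) :
    faceOp Γ d (convolution H f g) = faceOp Γ d f * faceOp Γ d g :=
  sweedlerProd_mul comulX_convolution counitX_convolution (dartT_convolution hS) commute_dartT
    (nodup_loopAt Γ d) f g

end Representation

/-! ### Adjoints of the edge operators -/

section EdgeAdjoint

variable {H : Type v} [NormedRing H] [StarRing H] [HopfAlgebra ℂ H] [StarModule ℂ H]

/-- `S` is adjoint to `R` for the inner product `φ(x^* y)` on `H`. -/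
def IsEdgeAdjoint (φ : Module.Dual ℂ H) (R S : Module.End ℂ H) : Prop :=
  ∀ x y, φ (star (R x) * y) = φ (star x * S y)

/-- The functional `x ↦ conj f(x^*)`. -/
noncomputable def conjDual (f : Module.Dual ℂ H) : Module.Dual ℂ H where
  toFun x := star (f (star x))
  map_add' x y := by simp
  map_smul' c x := by simp

theorem conjDual_apply (f : Module.Dual ℂ H) (x : H) : conjDual f x = star (f (star x)) := rfl

/-- The involution `f^*(x) = conj f(S(x)^*)` of the dual of `H`. -/
noncomputable def dualStar (f : Module.Dual ℂ H) : Module.Dual ℂ H := conjDual f ∘ₗ antipode ℂ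

theorem dualStar_apply (f : Module.Dual ℂ H) (x : H) :
    dualStar f x = star (f (star (antipode ℂ x))) := rfl

theorem actTPlus_apply (f : Module.Dual ℂ H) (x : H) :
    actTPlus H f x = rightSlice f (comul x) := rfl

theorem actTMinus_apply (f : Module.Dual ℂ H) (x : H) :
    actTMinus H f x = leftSlice (f ∘ₗ antipodeInv H) (comul x) := rfl

theorem star_rightSlice (f : Module.Dual ℂ H) (t : H ⊗[ℂ] H) :
    star (rightSlice f t) = rightSlice (conjDual f) (star t) := by
  induction t with
  | zero => simp
  | tmul x y => simp [conjDual_apply]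
  | add x y hx hy => simp only [map_add, star_add, hx, hy]

theorem star_leftSlice (f : Module.Dual ℂ H) (t : H ⊗[ℂ] H) :
    star (leftSlice f t) = leftSlice (conjDual f) (star t) := by
  induction t with
  | zero => simp
  | tmul x y => simp [conjDual_apply]
  | add x y hx hy => simp only [map_add, star_add, hx, hy]

variable {φ : Module.Dual ℂ H}

theorem isEdgeAdjoint_actLPlus (a : H) :
    IsEdgeAdjoint φ (actLPlus H a) (actLPlus H (star a)) := fun x y => by
  simp [actLPlus, mul_assoc]

variable [FiniteDimensional ℂ H]
  (hstar : ∀ x : H, comul (R := ℂ) (star x) = star (comul (R := ℂ) x))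
  (hφ : IsHaarTrace φ) (hs : ∀ x, φ (star x) = star (φ x))

include hstar hφ

theorem isEdgeAdjoint_actTPlus (f : Module.Dual ℂ H) :
    IsEdgeAdjoint φ (actTPlus H f) (actTPlus H (dualStar f)) := fun x y => by
  have h1 : ∀ (g : Module.Dual ℂ H) (t : H ⊗[ℂ] H), φ (rightSlice g t * y) =
      g (leftSlice (φ ∘ₗ LinearMap.mulRight ℂ y) t) := by
    intro g t
    induction t with
    | zero => simp
    | tmul x z => simp [mul_comm]
    | add x z hx hz => simp only [map_add, add_mul, hx, hz]
  have h2 : ∀ (g : Module.Dual ℂ H) (a : H) (t : H ⊗[ℂ] H), φ (a * rightSlice g t) =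
      g (leftSlice (φ ∘ₗ LinearMap.mulLeft ℂ a) t) := by
    intro g a t
    induction t with
    | zero => simp
    | tmul x z => simp [mul_comm]
    | add x z hx hz => simp only [map_add, mul_add, hx, hz]
  rw [actTPlus_apply, actTPlus_apply, star_rightSlice, ← hstar, h1, h2, dualStar,
    LinearMap.comp_apply, hφ.mulLeft_eq_mulRight, ← hφ.antipode_leftSlice,
    hφ.mulLeft_eq_mulRight]

include hs

theorem isEdgeAdjoint_actLMinus (a : H) :
    IsEdgeAdjoint φ (actLMinus H a) (actLMinus H (star a)) := fun x y => by
  have h1 : φ (star (antipode ℂ a) * (star x * y)) = φ (star x * y * star (antipode ℂ a)) :=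
    hφ.mul_comm _ _
  simpa [actLMinus, hφ.antipode_star hstar hs, mul_assoc] using h1

theorem isEdgeAdjoint_actTMinus (f : Module.Dual ℂ H) :
    IsEdgeAdjoint φ (actTMinus H f) (actTMinus H (dualStar f)) := fun x y => by
  have h1 : ∀ (g : Module.Dual ℂ H) (t : H ⊗[ℂ] H), φ (leftSlice g t * y) =
      g (rightSlice (φ ∘ₗ LinearMap.mulRight ℂ y) t) := by
    intro g t
    induction t with
    | zero => simp
    | tmul x z => simp [mul_comm]
    | add x z hx hz => simp only [map_add, add_mul, hx, hz]
  have h2 : ∀ (g : Module.Dual ℂ H) (a : H) (t : H ⊗[ℂ] H), φ (a * leftSlice g t) =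
      g (rightSlice (φ ∘ₗ LinearMap.mulLeft ℂ a) t) := by
    intro g a t
    induction t with
    | zero => simp
    | tmul x z => simp [mul_comm]
    | add x z hx hz => simp only [map_add, mul_add, hx, hz]
  have h3 : conjDual (f ∘ₗ antipode ℂ) = conjDual f ∘ₗ antipode ℂ := by
    ext z
    simp [conjDual_apply, hφ.antipode_star hstar hs]
  rw [actTMinus_apply, actTMinus_apply, star_leftSlice, ← hstar, h1, h2, hφ.antipodeInv_eq, h3,
    dualStar, LinearMap.comp_apply, LinearMap.comp_apply, LinearMap.comp_apply,
    hφ.antipode_antipode, ← hφ.antipode_rightSlice]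

theorem dualStar_eq_self : dualStar φ = φ := by
  ext x
  rw [dualStar_apply, hs, star_star, hφ.apply_antipode]

omit hφ hs in
theorem comul_star_sum (c : H) (s : Finset (H × H))
    (hs : comul (R := ℂ) c = ∑ p ∈ s, p.1 ⊗ₜ p.2) :
    comul (R := ℂ) (star c) = ∑ p ∈ s, star p.1 ⊗ₜ star p.2 := by
  rw [hstar, hs, star_sum]
  simp

theorem comulX_dualStar_sum (f : Module.Dual ℂ H) (s : Finset (Module.Dual ℂ H × Module.Dual ℂ H))
    (hf : comulX H f = ∑ p ∈ s, p.1 ⊗ₜ p.2) :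
    comulX H (dualStar f) = ∑ p ∈ s, dualStar p.1 ⊗ₜ dualStar p.2 := by
  apply (TensorProduct.dualDistribEquiv ℂ H H).injective
  change TensorProduct.dualDistrib ℂ H H _ = TensorProduct.dualDistrib ℂ H H _
  refine TensorProduct.ext' fun x y => ?_
  have h1 := dualDistrib_comulX f (star (antipode ℂ x)) (star (antipode ℂ y))
  rw [hf] at h1
  rw [dualDistrib_comulX, dualStar_apply, antipode_mul_antidistrib, star_mul, ← h1]
  simp [dualStar_apply]

end EdgeAdjoint

/-! ### Vertex and face operators as orthogonal projections -/

section Adjoint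

variable {E : Type u} [Fintype E] [DecidableEq E] {H : Type v} [NormedRing H] [StarRing H]
  [HopfAlgebra ℂ H] [StarModule ℂ H] [FiniteDimensional ℂ H] {φ : Module.Dual ℂ H}

/-- `Y` is adjoint to `X` for the inner product on the space of states. -/
def IsStateAdjoint (φ : Module.Dual ℂ H) (X Y : Module.End ℂ (StateSpace E H)) : Prop :=
  ∀ v w, stateInner φ (X v) w = stateInner φ v (Y w)

theorem IsStateAdjoint.add {X X' Y Y' : Module.End ℂ (StateSpace E H)} (h : IsStateAdjoint φ X Y)
    (h' : IsStateAdjoint φ X' Y') : IsStateAdjoint φ (X + X') (Y + Y') := fun v w => by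
  have h1 := h v w
  have h2 := h' v w
  simp only [stateInner, LinearMap.add_apply, map_add, star_add] at h1 h2 ⊢
  rw [h1, h2]

theorem IsStateAdjoint.mul {X X' Y Y' : Module.End ℂ (StateSpace E H)} (h : IsStateAdjoint φ X Y)
    (h' : IsStateAdjoint φ X' Y') : IsStateAdjoint φ (X * X') (Y' * Y) := fun v w => by
  rw [Module.End.mul_apply, h, h', Module.End.mul_apply]

theorem isStateAdjoint_algebraMap (z : ℂ) : IsStateAdjoint φ
    (algebraMap ℂ (Module.End ℂ (StateSpace E H)) z) (algebraMap ℂ _ (star z)) := fun v w => by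
  simp [stateInner, Module.algebraMap_end_apply]

theorem IsEdgeAdjoint.isStateAdjoint {R S : Module.End ℂ H} (h : IsEdgeAdjoint φ R S) (e : E) :
    IsStateAdjoint φ (onEdge e R) (onEdge e S) := by
  intro v w
  induction v using PiTensorProduct.induction_on with
  | add v v' hv hv' =>
    simp only [stateInner, map_add, LinearMap.add_apply, star_add] at hv hv' ⊢
    rw [hv, hv']
  | smul_tprod r x =>
    induction w using PiTensorProduct.induction_on with
    | add w w' hw hw' =>
      simp only [stateInner, map_add, star_add] at hw hw' ⊢
      rw [hw, hw']
    | smul_tprod s y =>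
      have h1 : stateInner φ (onEdge e R (⨂ₜ[ℂ] e, x e)) (⨂ₜ[ℂ] e, y e) =
          stateInner φ (⨂ₜ[ℂ] e, x e) (onEdge e S (⨂ₜ[ℂ] e, y e)) := by
        rw [onEdge_tprod, onEdge_tprod, stateInner_tprod, stateInner_tprod]
        refine Finset.prod_congr rfl fun e' _ => ?_
        by_cases he : e' = e
        · subst he
          simpa using h _ _
        · rw [Function.update_of_ne he, Function.update_of_ne he]
      simp only [stateInner, map_smul, map_smulₛₗ, LinearMap.smul_apply, star_smul] at h1 ⊢
      rw [h1]

variable (hstar : ∀ x : H, comul (R := ℂ) (star x) = star (comul (R := ℂ) x))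
  (hφ : IsHaarTrace φ) (hs : ∀ x, φ (star x) = star (φ x))

include hstar hφ hs

theorem isStateAdjoint_vertexOp (Γ : SurfaceGraph E) (d : E × Bool) (a : H) :
    IsStateAdjoint φ (vertexOp Γ d a) (vertexOp Γ d (star a)) := by
  refine sweedlerProd_adjoint (Adj := IsStateAdjoint φ) (comul_star_sum hstar)
    (counit_star hstar) isStateAdjoint_algebraMap
    (fun _ _ _ _ => IsStateAdjoint.add) (fun _ _ _ _ => IsStateAdjoint.mul) (fun d a => ?_)
    commute_dartL (nodup_cycleFrom _ _) a
  rcases d with ⟨e, _ | _⟩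
  · exact (isEdgeAdjoint_actLPlus a).isStateAdjoint e
  · exact (isEdgeAdjoint_actLMinus hstar hφ hs a).isStateAdjoint e

theorem isStateAdjoint_faceOp (Γ : SurfaceGraph E) (d : E × Bool) (f : Module.Dual ℂ H) :
    IsStateAdjoint φ (faceOp Γ d f) (faceOp Γ d (dualStar f)) := by
  refine sweedlerProd_adjoint (Adj := IsStateAdjoint φ) (comulX_dualStar_sum hstar hφ hs)
    (fun f => by simp [counitX, dualStar_apply]) isStateAdjoint_algebraMap
    (fun _ _ _ _ => IsStateAdjoint.add) (fun _ _ _ _ => IsStateAdjoint.mul) (fun d f => ?_)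
    commute_dartT (nodup_loopAt Γ d) f
  rcases d with ⟨e, _ | _⟩
  · exact (isEdgeAdjoint_actTPlus hstar hφ f).isStateAdjoint e
  · exact (isEdgeAdjoint_actTMinus hstar hφ hs f).isStateAdjoint e

/-- A self-adjoint idempotent operator on the space of states. -/
structure IsProjection (φ : Module.Dual ℂ H) (P : Module.End ℂ (StateSpace E H)) : Prop where
  mul_self : P * P = P
  adjoint : IsStateAdjoint φ P P

theorem isProjection_vertexOp {h : H} (hh : IsHaarIntegral h) (Γ : SurfaceGraph E)
    (d : E × Bool) : IsProjection φ (vertexOp Γ d h) where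
  mul_self := by rw [← vertexOp_mul, hh.mul_left, hh.counit_eq_one, one_smul]
  adjoint := by
    have := isStateAdjoint_vertexOp hstar hφ hs Γ d h
    rwa [hh.star_eq hstar] at this

theorem isProjection_faceOp (Γ : SurfaceGraph E) (d : E × Bool) :
    IsProjection φ (faceOp Γ d φ) where
  mul_self := by
    rw [← faceOp_convolution hφ.antipodeInv_eq, hφ.toIsHaarFunctional.convolution_self]
  adjoint := by
    have := isStateAdjoint_faceOp hstar hφ hs Γ d φ
    rwa [dualStar_eq_self hstar hφ hs] at this

end Adjoint

/-! ### The energy bound -/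

section Energy

variable {E : Type u} [Fintype E] [DecidableEq E] {H : Type v} [NormedRing H] [StarRing H]
  [HopfAlgebra ℂ H] [StarModule ℂ H] [FiniteDimensional ℂ H] {φ : Module.Dual ℂ H}

/-- An orthonormal basis of `H` gives an orthonormal basis of the space of states. -/
theorem stateInner_eq_sum {n : ℕ} (b : Module.Basis (Fin n) ℂ H)
    (hb : ∀ i j, φ (star (b i) * b j) = if i = j then 1 else 0) (v w : StateSpace E H) :
    stateInner φ v w = ∑ K, star ((Basis.piTensorProduct fun _ : E => b).repr v K) *
      (Basis.piTensorProduct fun _ : E => b).repr w K := by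
  set B := Basis.piTensorProduct fun _ : E => b with hB
  have hBB : ∀ K L, innerForm φ (B K) (B L) = if K = L then 1 else 0 := by
    intro K L
    have h1 := stateInner_tprod φ (fun e => b (K e)) fun e => b (L e)
    rw [stateInner, star_eq_iff_star_eq] at h1
    rw [hB, Basis.piTensorProduct_apply, Basis.piTensorProduct_apply, ← h1]
    by_cases hKL : K = L
    · simp [hKL, hb]
    · obtain ⟨e, he⟩ := Function.ne_iff.1 hKL
      rw [if_neg hKL, Finset.prod_eq_zero (Finset.mem_univ e) (by rw [hb, if_neg he]), star_zero]
  have h2 : innerForm φ v w = innerForm φ (∑ K, B.repr v K • B K) (∑ K, B.repr w K • B K) := by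
    rw [B.sum_repr, B.sum_repr]
  rw [stateInner, h2]
  simp only [map_sum, map_smul, map_smulₛₗ, LinearMap.sum_apply, LinearMap.smul_apply, hBB]
  simp [mul_comm]

/-- The inner product `⟨v, w⟩` as a linear functional of `w`. -/
noncomputable def stateInnerRight (φ : Module.Dual ℂ H) (v : StateSpace E H) :
    StateSpace E H →ₗ[ℂ] ℂ :=
  (starLinearEquiv ℂ (A := ℂ)).toLinearMap.comp (innerForm φ v)

theorem stateInnerRight_apply (v w : StateSpace E H) :
    stateInnerRight φ v w = stateInner φ v w := rfl

/-- Expectation values of a projection lie between `0` and `1`. -/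
theorem IsProjection.expectation {P : Module.End ℂ (StateSpace E H)} (hP : IsProjection φ P)
    (hpos : ∀ v : StateSpace E H, (stateInner φ v v).im = 0 ∧ 0 ≤ (stateInner φ v v).re)
    (v : StateSpace E H) :
    (stateInner φ v (P v)).im = 0 ∧ (stateInner φ v (P v)).re ≤ (stateInner φ v v).re := by
  have hPP : ∀ w, P (P w) = P w := fun w => by rw [← Module.End.mul_apply, hP.mul_self]
  have h1 : stateInner φ (P v) (P v) = stateInner φ v (P v) := by rw [hP.adjoint, hPP]
  have h2 : stateInner φ (v - P v) (v - P v) = stateInner φ v v - stateInner φ v (P v) := by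
    have h3 : stateInner φ (v - P v) (v - P v) =
        stateInner φ v (v - P v) - stateInner φ (P v) (v - P v) := by
      exact (congrArg star (LinearMap.congr_fun (map_sub (innerForm φ) v (P v)) (v - P v))).trans
        (star_sub _ _)
    rw [h3, hP.adjoint, map_sub, hPP, sub_self, ← stateInnerRight_apply, ← stateInnerRight_apply,
      map_sub, map_zero, sub_zero]
    rfl
  have h4 := (hpos (v - P v)).2
  rw [h2, Complex.sub_re] at h4
  exact ⟨h1 ▸ (hpos _).1, by linarith⟩

/-- A non-zero vector fixed by all terms of the Hamiltonian is a ground state. -/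
theorem isGroundState_of_fixed (Γ : SurfaceGraph E) {h : H} (siteV : Γ.Vertex → E × Bool)
    (siteF : Γ.Face → E × Bool) {ψ : StateSpace E H} (hψ : ψ ≠ 0)
    (hpos : ∀ v : StateSpace E H, (stateInner φ v v).im = 0 ∧ 0 ≤ (stateInner φ v v).re)
    (hA : ∀ d, IsProjection φ (vertexOp Γ d h)) (hB : ∀ d, IsProjection φ (faceOp Γ d φ))
    (hAψ : ∀ d, vertexOp Γ d h ψ = ψ) (hBψ : ∀ d, faceOp Γ d φ ψ = ψ) :
    IsGroundState φ (hamiltonian Γ h φ siteV siteF) ψ := by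
  refine ⟨hψ, -(Fintype.card Γ.Vertex : ℝ) - Fintype.card Γ.Face, ?_, fun v => ?_⟩
  · simp [hamiltonian, LinearMap.sum_apply, hAψ, hBψ, sub_smul, Nat.cast_smul_eq_nsmul]
  · have h1 : stateInner φ v (hamiltonian Γ h φ siteV siteF v) =
        -(∑ s, stateInner φ v (vertexOp Γ (siteV s) h v)) -
          ∑ p, stateInner φ v (faceOp Γ (siteF p) φ v) := by
      simp only [← stateInnerRight_apply, hamiltonian, LinearMap.sub_apply, LinearMap.neg_apply,
        LinearMap.sum_apply, map_sub, map_neg, map_sum]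
    have h2 : ∑ s, (stateInner φ v (vertexOp Γ (siteV s) h v)).re ≤
        Fintype.card Γ.Vertex * (stateInner φ v v).re := by
      refine (Finset.sum_le_sum fun s _ => ((hA (siteV s)).expectation hpos v).2).trans_eq ?_
      simp
    have h3 : ∑ p, (stateInner φ v (faceOp Γ (siteF p) φ v)).re ≤
        Fintype.card Γ.Face * (stateInner φ v v).re := by
      refine (Finset.sum_le_sum fun p _ => ((hB (siteF p)).expectation hpos v).2).trans_eq ?_
      simp
    rw [h1]
    constructor
    · simp [Complex.im_sum, ((hA _).expectation hpos v).1, ((hB _).expectation hpos v).1]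
    · simp only [Complex.sub_re, Complex.neg_re, Complex.re_sum]
      linarith

end Energy

/-! ### The network state does not vanish -/

section Nonzero

variable {E : Type u} [Fintype E] [DecidableEq E] {H : Type v} [NormedRing H] [HopfAlgebra ℂ H]
  [FiniteDimensional ℂ H] {φ : Module.Dual ℂ H} {h : H}

/-- An operator on `H`, acting on all state legs. -/
noncomputable def onStates (R : Module.End ℂ H) : Module.End ℂ (LegSpace H E) :=
  PiTensorProduct.map fun _ => tripleMap none R

theorem onStates_legTensor (R : Module.End ℂ H) (t : E → TripleSpace H) :
    onStates R (legTensor H E t) = legTensor H E fun e => tripleMap none R (t e) :=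
  PiTensorProduct.map_tprod _ _

theorem contraction_onStates (Γ : SurfaceGraph E) (o : Γ.Face → E × Bool)
    (ho : ∀ p, Γ.faceOf (o p) = p) (hc : ∀ x y, φ (x * y) = φ (y * x)) (R : Module.End ℂ H) :
    contraction Γ o φ ho hc ∘ₗ onStates R =
      PiTensorProduct.map (fun _ => R) ∘ₗ contraction Γ o φ ho hc := by
  refine legSpace_ext fun z => ?_
  let z' : E × Option Bool → H
    | (e, none) => R (z (e, none))
    | (e, some b) => z (e, some b)
  have h1 : onStates R (pureLegs z) = pureLegs z' := by
    rw [pureLegs, onStates_legTensor, pureLegs]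
    rfl
  rw [LinearMap.comp_apply, LinearMap.comp_apply, h1, contraction_pureLegs, contraction_pureLegs,
    map_smul, PiTensorProduct.map_tprod]
  rfl

theorem IsHaarFunctional.tripleMap_edgeTensor (hφ : IsHaarFunctional φ) (x : H) :
    tripleMap none (φ.smulRight 1) (edgeTensor x) = φ x • triple fun _ => 1 := by
  have h1 : ∀ t : H ⊗[ℂ] H, tripleMap none (φ.smulRight 1) (splitPieces H t) =
      splitPieces H (1 ⊗ₜ TensorProduct.lid ℂ H (φ.rTensor H t)) := by
    intro t
    induction t with
    | zero => simp
    | tmul x y => simp [splitPieces, tripleMap, TensorProduct.smul_tmul']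
    | add x y hx hy => simp only [map_add, TensorProduct.tmul_add, hx, hy]
  rw [edgeTensor, h1, hφ.right]
  simp [splitPieces, triple, Algebra.TensorProduct.one_def]

/-- Applying `x ↦ φ(x) 1` to each edge turns the network state into a non-zero multiple of
`1 ⊗ ⋯ ⊗ 1`. -/
theorem networkState_ne_zero (hφ : IsHaarTrace φ) (hh : φ h ≠ 0) (Γ : SurfaceGraph E)
    (o : Γ.Face → E × Bool) (ho : ∀ p, Γ.faceOf (o p) = p) :
    networkState Γ o (fun _ => h) (fun _ => φ) ≠ 0 := by
  intro h0
  have h1 := LinearMap.congr_fun (contraction_onStates Γ o ho hφ.mul_comm (φ.smulRight 1))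
    (legTensor H E fun _ => edgeTensor h)
  have h2 : (legTensor H E fun _ : E => φ h • triple fun _ => (1 : H)) =
      φ h ^ Fintype.card E • pureLegs fun _ => (1 : H) := by
    rw [MultilinearMap.map_smul_univ]
    simp [pureLegs]
  rw [LinearMap.comp_apply, LinearMap.comp_apply, ← networkState_eq_contraction, h0, map_zero,
    onStates_legTensor] at h1
  simp only [hφ.toIsHaarFunctional.tripleMap_edgeTensor] at h1
  rw [h2, map_smul, contraction_pureLegs] at h1
  have h3 : faceWeight Γ o φ ((fun _ => (1 : H)) ∘ pieceLeg) = 1 := by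
    refine Finset.prod_eq_one fun p _ => ?_
    rw [List.prod_eq_one, hφ.map_one]
    intro x hx
    obtain ⟨d, -, rfl⟩ := List.mem_map.1 hx
    rfl
  have h4 := congrArg (PiTensorProduct.lift
    ((MultilinearMap.mkPiAlgebra ℂ E ℂ).compLinearMap fun _ => φ)) h1
  rw [h3, one_smul, map_smul, map_zero] at h4
  simp [hφ.map_one, hh] at h4

end Nonzero

end QuantumDouble

open QuantumDouble in
theorem mainTheorem3 {H : Type v} [NormedRing H] [StarRing H] [CStarRing H]
    [HopfAlgebra ℂ H] [NormSMulClass ℂ H] [StarModule ℂ H] [FiniteDimensional ℂ H]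
    (hstar : ∀ x : H, comul (R := ℂ) (star x) = star (comul (R := ℂ) x))
    (h : H) (hh : QuantumDouble.IsHaarIntegral h)
    (φ : Module.Dual ℂ H) (hφ : QuantumDouble.IsHaarFunctional φ)
    {E : Type u} [Fintype E] [DecidableEq E] (Γ : SurfaceGraph E)
    (siteV : Γ.Vertex → E × Bool) (hV : ∀ s, Γ.vertexOf (siteV s) = s)
    (siteF : Γ.Face → E × Bool) (hF : ∀ p, Γ.faceOf (siteF p) = p)
    (o : Γ.Face → E × Bool) (ho : ∀ p, Γ.faceOf (o p) = p)
    (ψ : QuantumDouble.StateSpace E H)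
    (hψ : ψ = QuantumDouble.networkState Γ o (fun _ => h) (fun _ => φ)) :
    (∀ d, QuantumDouble.vertexOp Γ d h ψ = ψ) ∧
    (∀ d, QuantumDouble.faceOp Γ d φ ψ = ψ) ∧
    QuantumDouble.IsGroundState φ (QuantumDouble.hamiltonian Γ h φ siteV siteF) ψ ∧
    (∀ d, ∀ u : Module.Dual ℂ H ⊗[ℂ] H,
      QuantumDouble.siteOp Γ d u ψ = QuantumDouble.doubleCounit H u • ψ) := by
  have := hφ.nontrivial
  have hφτ := hφ.eq_regularTrace hstar
  have hφ' : IsHaarTrace φ := ⟨hφ, fun x y => by rw [hφτ, regularTrace_mul_comm]⟩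
  have hs : ∀ x, φ (star x) = star (φ x) := fun x => by rw [hφτ, regularTrace_star]
  -- A vector in the kernel of the form `φ(x y)` has `φ(x x^*) = 0`.
  have hfaithful : ∀ x, (∀ y, φ (x * y) = 0) → x = 0 := fun x hx => by
    refine star_eq_zero.1 (eq_zero_of_regularTrace_star_mul_self ?_)
    rw [star_star, ← hφτ, hx]
  -- `φ(h) = φ(h^* h)`, as `h` is self-adjoint and idempotent.
  have hh0 : φ h ≠ 0 := fun h0 => by
    have hzero : h = 0 := by
      refine eq_zero_of_regularTrace_star_mul_self ?_
      rw [hh.star_eq hstar, hh.mul_left, hh.counit_eq_one, one_smul, ← hφτ, h0]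
    have := hh.counit_eq_one
    rw [hzero, map_zero] at this
    exact zero_ne_one this
  have hpos : ∀ v : StateSpace E H, (stateInner φ v v).im = 0 ∧ 0 ≤ (stateInner φ v v).re := by
    obtain ⟨b, hb⟩ := exists_orthonormal_basis_regularTrace (H := H)
    rw [← hφτ] at hb
    intro v
    rw [stateInner_eq_sum b hb]
    simp only [Complex.star_def, ← Complex.normSq_eq_conj_mul_self, ← Complex.ofReal_sum]
    exact ⟨Complex.ofReal_im _, Finset.sum_nonneg fun _ _ => Complex.normSq_nonneg _⟩
  have hA : ∀ d a, vertexOp Γ d a ψ = counit (R := ℂ) a • ψ := fun d a => by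
    rw [hψ, vertexOp_networkState hh hφ' Γ o ho]
  have hB : ∀ d f, faceOp Γ d f ψ = f 1 • ψ := fun d f => by
    rw [hψ, faceOp_networkState hφ' (hh.comm_comul hφ' hfaithful) Γ o ho]
  have hAh : ∀ d, vertexOp Γ d h ψ = ψ := fun d => by rw [hA, hh.counit_eq_one, one_smul]
  have hBφ : ∀ d, faceOp Γ d φ ψ = ψ := fun d => by rw [hB, hφ.map_one, one_smul]
  refine ⟨hAh, hBφ, ?_, fun d u => ?_⟩
  · exact isGroundState_of_fixed Γ siteV siteF (hψ ▸ networkState_ne_zero hφ' hh0 Γ o ho) hpos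
      (isProjection_vertexOp hstar hφ' hs hh Γ) (isProjection_faceOp hstar hφ' hs Γ) hAh hBφ
  · induction u with
    | zero => simp
    | tmul f a => simp [siteOp, doubleCounit, counitX, hA, hB, smul_smul, mul_comm]
    | add u v hu hv => simp only [map_add, LinearMap.add_apply, add_smul, hu, hv]
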